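/- Let $d\ge 1$, and equip $\mathbb Z^d$ with the graph norm $\|x\|=\sum_i|x_i|$. Let $(\Omega,\mathcal B^\Omega,\mathbb P^\Omega,\operatorname{dist})$ be a metric space with its Borel $\sigma$-algebra and a probability measure, of finite metric dimension: for some $\nu,C>0$ and every $\epsilon\in(0,1]$, $\Omega$ admits an $\epsilon$-net of cardinality at most $(C/\epsilon)^\nu$. Let $(T^x)_{x\in\mathbb Z^d}$ be an ergodic measure-preserving action of $\mathbb Z^d$ on $\Omega$ whose maps are Lipschitz with constants growing at most polynomially: for some $C>0$ and $q\in\mathbb N$, $\operatorname{dist}(T^x\omega,T^x\omega')\le C(1+\|x\|)^q\operatorname{dist}(\omega,\omega')$ for all $x,\omega,\omega'$ (for instance, an action by isometries). Let $(\Theta,\mathcal B^\Theta,\mathbb P^\Theta)$ be a probability space and let $v(\omega,\theta)$, $\omega\in\Omega$, be a real-valued stochastic process on $\Theta$, all of whose realisations $v(\cdot,\theta)$ are uniformly $\kappa$-Hölder continuous on $\Omega$, for a fixed $\kappa>0$ (with a constant that may depend on $\theta$). Let $A,\eta\in\mathbb R$ with $A\eta<1$ be such that the following hold. $(\mathrm{UPA})_A$: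 there is $c>0$ such that $\inf_{\omega\in\Omega}\min_{0<\|x\|\le L}\operatorname{dist}(T^x\omega,\omega)\ge cL^{-A}$ for all integers $L\ge1$. $(\mathrm{LIB})_\eta$: there are $C>0$ and $\epsilon_0>0$ such that for every $\omega\in\Omega$ and $\epsilon\in(0,\epsilon_0]$ the conditional distribution of $v(\omega,\cdot)$ given the values $v(\omega',\cdot)$ for all $\omega'$ with $\operatorname{dist}(\omega',\omega)\ge\epsilon$ is almost surely absolutely continuous with respect to Lebesgue measure, with a density bounded by $\exp(C\epsilon^{-\eta})$. For $g>0$ let $H(\omega,\theta;g)$ be the operator on $\ell^2(\mathbb Z^d)$ $$(H(\omega,\theta;g)f)(x)=\sum_{\|y-x\|=1}f(y)+g\,v(T^x\omega,\theta)f(x).$$ Then there exist events $\Theta^+(g)\in\mathcal B^\Theta$, $g>0$, with $\mathbb P^\Theta(\Theta^+(g))\to1$ as $g\to+\infty$, such that for every $g>0$, every $\theta\in\Theta^+(g)$ and almost every $\omega\in\Omega$, the spectrum of the self-adjoint operator $H(\omega,\theta;g)$ is pure point (its eigenvectors span a dense subspace of $\ell^2(\mathbb Z^d)$), and every eigenfunction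 $\psi$ satisfies $\sup_{x\in\mathbb Z^d}|\psi(x)|e^{\|x\|}<\infty$. -/

import Mathlib

open MeasureTheory ProbabilityTheory Filter Topology
open scoped ENNReal NNReal

namespace QuasiPeriodic

/-- The graph (`ℓ¹`) norm on the lattice `ℤ^d`. -/
def latticeNorm {d : ℕ} (x : Fin d → ℤ) : ℕ := ∑ i, (x i).natAbs

/-- The Hilbert space `ℓ²(ℤ^d)` of complex square-summable functions. -/
abbrev EllTwo (d : ℕ) : Type := lp (fun _ : Fin d → ℤ => ℂ) 2

/-- The sum of `f` over the nearest neighbours `x ± eᵢ` of `x`, plus `V x * f x`. -/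
def schrodingerExpr {d : ℕ} (V : (Fin d → ℤ) → ℝ) (f : (Fin d → ℤ) → ℂ) :
    (Fin d → ℤ) → ℂ :=
  fun x => (∑ i : Fin d, (f (x + Pi.single i 1) + f (x - Pi.single i 1))) + (V x : ℂ) * f x

theorem schrodingerExpr_add {d : ℕ} (V : (Fin d → ℤ) → ℝ) (f h : (Fin d → ℤ) → ℂ) :
    schrodingerExpr V (f + h) = schrodingerExpr V f + schrodingerExpr V h := by
  funext x
  simp only [schrodingerExpr, Pi.add_apply, Finset.sum_add_distrib]
  ring

theorem schrodingerExpr_smul {d : ℕ} (V : (Fin d → ℤ) → ℝ) (c : ℂ) (f : (Fin d → ℤ) → ℂ) :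
    schrodingerExpr V (c • f) = c • schrodingerExpr V f := by
  funext x
  simp only [schrodingerExpr, Pi.smul_apply, smul_eq_mul, ← mul_add, ← Finset.mul_sum]
  ring

theorem schrodingerExpr_zero {d : ℕ} (V : (Fin d → ℤ) → ℝ) :
    schrodingerExpr V (0 : (Fin d → ℤ) → ℂ) = 0 := by
  funext x
  simp [schrodingerExpr]

/-- The discrete Schrödinger operator with potential `V` on `ℓ²(ℤ^d)`, on its maximal domain
(all of `ℓ²(ℤ^d)` when `V` is bounded). -/
noncomputable def schrodinger {d : ℕ} (V : (Fin d → ℤ) → ℝ) : EllTwo d →ₗ.[ℂ] EllTwo d where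
  domain :=
    { carrier := {f | Memℓp (schrodingerExpr V (f : (Fin d → ℤ) → ℂ)) 2}
      add_mem' := by
        intro f h hf hh
        simp only [Set.mem_ofPred_eq, lp.coeFn_add, schrodingerExpr_add] at *
        exact hf.add hh
      zero_mem' := by
        simp only [Set.mem_ofPred_eq, lp.coeFn_zero, schrodingerExpr_zero]
        exact zero_memℓp
      smul_mem' := by
        intro c f hf
        simp only [Set.mem_ofPred_eq, lp.coeFn_smul, schrodingerExpr_smul] at *
        exact hf.const_smul c }
  toFun :=
    { toFun := fun f => ⟨schrodingerExpr V ((f : EllTwo d) : (Fin d → ℤ) → ℂ), f.2⟩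
      map_add' := by
        intro f h
        ext x
        exact congrFun (schrodingerExpr_add V _ _) x
      map_smul' := by
        intro c f
        ext x
        exact congrFun (schrodingerExpr_smul V c _) x }

/-- `ψ` is an eigenvector of the (partially defined) operator `H` with eigenvalue `E`. -/
def IsEigenvector {K : Type*} [AddCommGroup K] [Module ℂ K] (H : K →ₗ.[ℂ] K) (E : ℂ) (ψ : K) :
    Prop :=
  ψ ≠ 0 ∧ ∃ h : ψ ∈ H.domain, H ⟨ψ, h⟩ = E • ψ

/-- A self-adjoint operator on a Hilbert space has pure point spectrum when its eigenvectors
span a dense subspace. -/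
def HasPurePointSpectrum {K : Type*} [NormedAddCommGroup K] [InnerProductSpace ℂ K]
    [CompleteSpace K] (H : K →ₗ.[ℂ] K) : Prop :=
  IsSelfAdjoint H ∧
    (Submodule.span ℂ {ψ : K | ∃ E : ℂ, IsEigenvector H E ψ}).topologicalClosure = ⊤

/-- For some `ν > 0` and `C > 0`, the space admits for every `ε ∈ (0, 1]` an `ε`-net of
cardinality at most `(C / ε) ^ ν`. -/
def FiniteMetricDimension (Ω : Type*) [MetricSpace Ω] : Prop :=
  ∃ ν : ℝ, 0 < ν ∧ ∃ C : ℝ, 0 < C ∧ ∀ ε : ℝ, 0 < ε → ε ≤ 1 →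
    ∃ N : Finset Ω, (N.card : ℝ) ≤ (C / ε) ^ ν ∧ ∀ ω : Ω, ∃ ω' ∈ N, dist ω ω' ≤ ε

/-- The translations `T^x` are Lipschitz, with constants of at most polynomial growth in `‖x‖`
(for an action by isometries take `C = 1`, `q = 0`). -/
def TemperedAction (d : ℕ) (Ω : Type*) [MetricSpace Ω] [AddAction (Fin d → ℤ) Ω] : Prop :=
  ∃ C : ℝ, 0 < C ∧ ∃ q : ℕ, ∀ (x : Fin d → ℤ) (ω ω' : Ω),
    dist (x +ᵥ ω) (x +ᵥ ω') ≤ C * (1 + (latticeNorm x : ℝ)) ^ q * dist ω ω'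

/-- The Diophantine condition `(UPA)_A`:
`inf_ω min_{0 < ‖x‖ ≤ L} dist (T^x ω) ω ≥ c L ^ (-A)` for all `L`. -/
def UPA (d : ℕ) (Ω : Type*) [MetricSpace Ω] [AddAction (Fin d → ℤ) Ω] (A : ℝ) : Prop :=
  ∃ c : ℝ, 0 < c ∧ ∀ (L : ℕ) (ω : Ω) (x : Fin d → ℤ),
    0 < latticeNorm x → latticeNorm x ≤ L → c * (L : ℝ) ^ (-A) ≤ dist (x +ᵥ ω) ω

/-- The conditional distribution of the random variable `v ω` given the values of the process
`v` outside the `ε`-neighbourhood `{ω' | dist ω' ω < ε}` of `ω`. -/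
noncomputable def condLaw {Ω Θ : Type*} [MetricSpace Ω] [MeasurableSpace Θ] (P : Measure Θ)
    [IsFiniteMeasure P] (v : Ω → Θ → ℝ) (ω : Ω) (ε : ℝ) :
    Kernel ({ω' : Ω // ε ≤ dist ω' ω} → ℝ) ℝ :=
  condDistrib (v ω) (fun θ (ω' : {ω' : Ω // ε ≤ dist ω' ω}) => v ω' θ) P

/-- The local interpolation bound `(LIB)_η`: for `ε ∈ (0, ε₀]`, the conditional distribution of
`v ω` given the values of `v` outside the `ε`-neighbourhood of `ω` almost surely has a density
(with respect to Lebesgue measure) that is bounded by `exp (C ε ^ (-η))`. -/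
def LIB {Ω Θ : Type*} [MetricSpace Ω] [MeasurableSpace Θ] (P : Measure Θ) [IsFiniteMeasure P]
    (v : Ω → Θ → ℝ) (η : ℝ) : Prop :=
  ∃ C : ℝ, 0 < C ∧ ∃ ε₀ : ℝ, 0 < ε₀ ∧ ∀ ε : ℝ, 0 < ε → ε ≤ ε₀ → ∀ ω : Ω, ∀ᵐ θ ∂P,
    ∃ p : ℝ → ℝ≥0∞, Measurable p ∧
      condLaw P v ω ε (fun ω' : {ω' : Ω // ε ≤ dist ω' ω} => v ω' θ) = volume.withDensity p ∧
      ∀ t : ℝ, p t ≤ ENNReal.ofReal (Real.exp (C * ε ^ (-η)))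

/-- `v` is a stochastic process indexed by `Ω`, all of whose realisations are uniformly
`κ`-Hölder continuous functions on `Ω`. -/
def IsHolderProcess {Ω Θ : Type*} [MetricSpace Ω] [MeasurableSpace Θ] (v : Ω → Θ → ℝ)
    (κ : ℝ≥0) : Prop :=
  (∀ ω, Measurable (v ω)) ∧ ∀ θ, ∃ K : ℝ≥0, HolderWith K κ (fun ω => v ω θ)

/-- The operator `H(ω, θ; g)`, with potential `x ↦ g * v (T^x ω, θ)`. -/
noncomputable def hamiltonian {d : ℕ} {Ω Θ : Type*} [AddAction (Fin d → ℤ) Ω]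
    (v : Ω → Θ → ℝ) (g : ℝ) (ω : Ω) (θ : Θ) : EllTwo d →ₗ.[ℂ] EllTwo d :=
  schrodinger (fun x : Fin d → ℤ => g * v (x +ᵥ ω) θ)

end QuasiPeriodic

namespace QuasiPeriodic

/-! ### The lattice -/

section Lattice

variable {d : ℕ}

/-! Dividing by `g` turns the operator into `γ Δ + V` with `γ = 1 / g` small and `V x = v (T^x ω,
θ)`. The proof is a multiscale analysis with lengths `L_s = 2 ^ s ^ 2`. A site is resonant at scale
`s` and energy `E` if the restriction of the operator to some ball about it, of radius at most `8 J
L_s`, has an approximate eigenvector of energy `E` with error `exp (-L_s ^ σ)`.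

Probability. By (UPA) the orbit points seen in a window of size `M` are separated by a multiple of
`M ^ (-A)`, so by (LIB) each value of the potential, given the others, has a density at most `exp (C
M ^ β)` with `β < 1` (`exists_condDensityBound`). Moving the potential at one site moves the
eigenvalues (`abs_sub_le_of_mem_resonantAt`). Hence `p` separated resonances at a common energy
have, after a union over an energy grid, probability about `tol ^ (p - 1)`, up to factors negligible
for `β < σ < 1` (`measure_gridEvent_le`). This is used twice. For `p = 2` the bound is summable, and
Borel–Cantelli on `Θ × Ω` excludes pairs of separated resonances at large scales for almost every
`ω`. For `p = J + 1` with `J` large it beats the cardinality of a net of `Ω` fine enough to resolve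
the potential; so, with large probability, no `ω` at all, hence no translate of the window, has `J +
1` separated resonances at any scale from `s₁` on (`exists_good_event`).

Determinism. Since resonances are covered by `J` balls, the induction `isGood_of_resSites_disjoint`
shows that a site without scale-`s` resonances within `L_{s+1}` suppresses solutions by about `exp
(-16 L_{s+1})`. A nonzero slowly growing solution therefore forces a resonance near the origin at
every large scale; the exclusion of pairs makes the distant sites good, and the solution decays
(`exists_abs_le_exp_neg`).

Spectral theory. For almost every energy of a spectral measure there is a slowly growing solution.
It decays, so the energy is one of countably many eigenvalues, and every spectral measure is pure
point (`hasPurePointSpectrum_schrodinger`). An eigenfunction is bounded, hence slowly growing, hence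
decays. -/

theorem latticeNorm_zero : latticeNorm (0 : Fin d → ℤ) = 0 := by simp [latticeNorm]

theorem latticeNorm_neg (x : Fin d → ℤ) : latticeNorm (-x) = latticeNorm x := by
  simp [latticeNorm]

theorem latticeNorm_sub_comm (x y : Fin d → ℤ) : latticeNorm (x - y) = latticeNorm (y - x) := by
  rw [← latticeNorm_neg, neg_sub]

theorem latticeNorm_add_le (x y : Fin d → ℤ) :
    latticeNorm (x + y) ≤ latticeNorm x + latticeNorm y := by
  unfold latticeNorm
  rw [← Finset.sum_add_distrib]
  exact Finset.sum_le_sum fun i _ => Int.natAbs_add_le _ _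

theorem latticeNorm_sub_le (x y z : Fin d → ℤ) :
    latticeNorm (x - z) ≤ latticeNorm (x - y) + latticeNorm (y - z) := by
  have := latticeNorm_add_le (x - y) (y - z)
  simpa using this

theorem latticeNorm_eq_zero {x : Fin d → ℤ} : latticeNorm x = 0 ↔ x = 0 := by
  simp [latticeNorm, funext_iff]

theorem natAbs_le_latticeNorm (x : Fin d → ℤ) (i : Fin d) : (x i).natAbs ≤ latticeNorm x :=
  Finset.single_le_sum (f := fun i => (x i).natAbs) (fun _ _ => Nat.zero_le _) (Finset.mem_univ i)

theorem latticeNorm_single (i : Fin d) : latticeNorm (Pi.single i (1 : ℤ)) = 1 := by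
  unfold latticeNorm
  rw [Finset.sum_eq_single i]
  · simp
  · intro j _ hj
    simp [hj]
  · simp

/-- The ball of radius `r` about `x` in the graph metric. -/
noncomputable def latticeBall (x : Fin d → ℤ) (r : ℕ) : Finset (Fin d → ℤ) :=
  (Finset.Icc (x - fun _ => (r : ℤ)) (x + fun _ => (r : ℤ))).filter
    fun u => latticeNorm (u - x) ≤ r

theorem mem_latticeBall {x u : Fin d → ℤ} {r : ℕ} :
    u ∈ latticeBall x r ↔ latticeNorm (u - x) ≤ r := by
  unfold latticeBall
  rw [Finset.mem_filter, and_iff_right_iff_imp]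
  intro h
  have h2 : ∀ i, ((u - x) i).natAbs ≤ r := fun i => (natAbs_le_latticeNorm _ i).trans h
  rw [Finset.mem_Icc, Pi.le_def, Pi.le_def]
  refine ⟨fun i => ?_, fun i => ?_⟩ <;>
  · have := h2 i
    simp only [Pi.sub_apply, Pi.add_apply] at this ⊢
    omega

theorem card_latticeBall_le (x : Fin d → ℤ) (r : ℕ) :
    (latticeBall x r).card ≤ (2 * r + 1) ^ d := by
  refine (Finset.card_filter_le _ _).trans ?_
  rw [Pi.card_Icc]
  simp only [Pi.add_apply, Pi.sub_apply, Int.card_Icc]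
  refine (Finset.prod_le_pow_card _ _ (2 * r + 1) fun i _ => ?_).trans (by simp)
  omega

theorem self_mem_latticeBall (x : Fin d → ℤ) (r : ℕ) : x ∈ latticeBall x r := by
  simp [mem_latticeBall, latticeNorm_zero]

theorem card_latticeBall_pos (x : Fin d → ℤ) (r : ℕ) : 0 < (latticeBall x r).card :=
  Finset.card_pos.2 ⟨x, self_mem_latticeBall x r⟩

end Lattice

/-! ### Solutions of the eigenvalue equation, resonances and good sites -/

section Solutions

variable {d : ℕ}

/-- The sum of `f` over the nearest neighbours of `x`. -/
def neighborSum (f : (Fin d → ℤ) → ℝ) (x : Fin d → ℤ) : ℝ :=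
  ∑ i : Fin d, (f (x + Pi.single i 1) + f (x - Pi.single i 1))

/-- The operator `γ Δ + V` on real functions on the lattice. -/
def hopping (γ : ℝ) (V f : (Fin d → ℤ) → ℝ) (x : Fin d → ℤ) : ℝ :=
  γ * neighborSum f x + V x * f x

/-- The restriction of `γ Δ + V` to the finite set `B` has an approximate normalised eigenvector
with energy `E` and error at most `δ`. -/
def IsResonant (γ : ℝ) (V : (Fin d → ℤ) → ℝ) (B : Finset (Fin d → ℤ)) (E δ : ℝ) : Prop :=
  ∃ f : (Fin d → ℤ) → ℝ, (∀ x, x ∉ B → f x = 0) ∧ ∑ x ∈ B, f x ^ 2 = 1 ∧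
    ∑ x ∈ B, (hopping γ V f x - E * f x) ^ 2 ≤ δ ^ 2

/-- Solutions of `(γ Δ + V) ψ = E ψ` on the ball of radius `L` about `x` gain a factor `q`
at the centre. -/
def IsGood (γ : ℝ) (V : (Fin d → ℤ) → ℝ) (E : ℝ) (x : Fin d → ℤ) (L : ℕ) (q : ℝ) : Prop :=
  ∀ (ψ : (Fin d → ℤ) → ℝ) (W : ℝ), (∀ u ∈ latticeBall x L, hopping γ V ψ u = E * ψ u) →
    (∀ w ∈ latticeBall x (L + 1), |ψ w| ≤ W) → |ψ x| ≤ q * W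

theorem abs_neighborSum_le {f : (Fin d → ℤ) → ℝ} {x : Fin d → ℤ} {W : ℝ}
    (h : ∀ w, latticeNorm (w - x) = 1 → |f w| ≤ W) : |neighborSum f x| ≤ 2 * d * W := by
  unfold neighborSum
  refine (Finset.abs_sum_le_sum_abs _ _).trans ?_
  refine (Finset.sum_le_card_nsmul _ _ (2 * W) fun i _ => ?_).trans (by simp; ring_nf; rfl)
  have h1 := h (x + Pi.single i 1) (by simp [latticeNorm_single])
  have h2 := h (x - Pi.single i 1) (by
    rw [show x - Pi.single i 1 - x = -Pi.single i (1 : ℤ) by abel, latticeNorm_neg,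
      latticeNorm_single])
  exact (abs_add_le _ _).trans (by linarith)

theorem neighborSum_sub (f h : (Fin d → ℤ) → ℝ) (x : Fin d → ℤ) :
    neighborSum (f - h) x = neighborSum f x - neighborSum h x := by
  simp only [neighborSum, ← Finset.sum_sub_distrib, Pi.sub_apply]
  exact Finset.sum_congr rfl fun i _ => by ring

theorem neighborSum_smul (c : ℝ) (f : (Fin d → ℤ) → ℝ) (x : Fin d → ℤ) :
    neighborSum (c • f) x = c * neighborSum f x := by
  simp only [neighborSum, Finset.mul_sum, Pi.smul_apply, smul_eq_mul, mul_add]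

theorem hopping_sub (γ : ℝ) (V f h : (Fin d → ℤ) → ℝ) (x : Fin d → ℤ) :
    hopping γ V (f - h) x = hopping γ V f x - hopping γ V h x := by
  simp only [hopping, neighborSum_sub, Pi.sub_apply]; ring

theorem hopping_smul (γ c : ℝ) (V f : (Fin d → ℤ) → ℝ) (x : Fin d → ℤ) :
    hopping γ V (c • f) x = c * hopping γ V f x := by
  simp only [hopping, neighborSum_smul, Pi.smul_apply, smul_eq_mul]; ring

/-- On a non-resonant ball, solutions are controlled by their values on the outer sphere. -/
theorem abs_le_of_not_isResonant {γ : ℝ} {V : (Fin d → ℤ) → ℝ} {E δ : ℝ} {y : Fin d → ℤ} {r : ℕ}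
    (hγ : 0 ≤ γ) (hδ : 0 < δ)
    (h : ¬ IsResonant γ V (latticeBall y r) E δ) {ψ : (Fin d → ℤ) → ℝ} {W : ℝ} (hW : 0 ≤ W)
    (hψ : ∀ u ∈ latticeBall y r, hopping γ V ψ u = E * ψ u)
    (hbd : ∀ w, latticeNorm (w - y) = r + 1 → |ψ w| ≤ W) {u : Fin d → ℤ}
    (hu : u ∈ latticeBall y r) :
    |ψ u| ≤ (latticeBall y r).card / δ * (2 * d * γ) * W := by
  set B := latticeBall y r with hB
  set n : ℝ := ((B.card : ℕ) : ℝ) with hn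
  have hn1 : 1 ≤ n := Nat.one_le_cast.2 (card_latticeBall_pos y r)
  -- The truncation of `ψ` to the ball fails the eigenvalue equation only through the hopping from
  -- the outer sphere, where `ψ` is at most `W`. A large norm of `f` would make it, once normalised,
  -- an approximate eigenvector.
  let f : (Fin d → ℤ) → ℝ := fun x => if x ∈ B then ψ x else 0
  have hf0 : ∀ x, x ∉ B → f x = 0 := fun x hx => if_neg hx
  have hfψ : ∀ x, x ∈ B → f x = ψ x := fun x hx => if_pos hx
  set N : ℝ := ∑ x ∈ B, f x ^ 2 with hN
  have hres : ∀ x ∈ B, (hopping γ V f x - E * f x) ^ 2 ≤ (2 * d * γ * W) ^ 2 := by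
    intro x hx
    have e : hopping γ V f x - E * f x = - (γ * neighborSum (ψ - f) x) := by
      have h1 := hψ x hx
      have h2 := hopping_sub γ V ψ f x
      have h3 : hopping γ V (ψ - f) x = γ * neighborSum (ψ - f) x := by
        simp [hopping, hfψ x hx]
      rw [hfψ x hx]
      linarith
    rw [e, neg_sq]
    refine sq_le_sq' ?_ ?_ |>.trans le_rfl
    all_goals
      have hb : |neighborSum (ψ - f) x| ≤ 2 * d * W := by
        refine abs_neighborSum_le fun w hw => ?_
        by_cases hwB : w ∈ B
        · simp [hfψ w hwB, hW]
        · rw [Pi.sub_apply, hf0 w hwB, sub_zero]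
          apply hbd
          have h1 := latticeNorm_sub_le w x y
          rw [hB, mem_latticeBall] at hwB hx
          omega
      have h4 : |γ * neighborSum (ψ - f) x| ≤ 2 * d * γ * W := by
        rw [abs_mul, abs_of_nonneg hγ]
        calc γ * |neighborSum (ψ - f) x| ≤ γ * (2 * d * W) := by gcongr
          _ = _ := by ring
      have := abs_le.1 h4
      linarith
  have hdg : 0 ≤ 2 * d * γ := by positivity
  have hNle : δ ^ 2 * N ≤ n * (2 * d * γ * W) ^ 2 := by
    by_contra! hlt
    have hNpos : 0 < N := by
      by_contra! hN0
      have h1 : 0 ≤ n * (2 * d * γ * W) ^ 2 := by positivity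
      nlinarith [sq_nonneg δ]
    apply h
    refine ⟨(Real.sqrt N)⁻¹ • f, fun x hx => by simp [hf0 x hx], ?_, ?_⟩
    · simp only [Pi.smul_apply, smul_eq_mul, mul_pow, inv_pow, Real.sq_sqrt hNpos.le]
      rw [← Finset.mul_sum, ← hN, inv_mul_cancel₀ hNpos.ne']
    · have e : ∀ x ∈ B, (hopping γ V ((Real.sqrt N)⁻¹ • f) x - E * ((Real.sqrt N)⁻¹ • f) x) ^ 2
          = N⁻¹ * (hopping γ V f x - E * f x) ^ 2 := by
        intro x _
        rw [hopping_smul, Pi.smul_apply, smul_eq_mul, mul_left_comm, ← mul_sub, mul_pow, inv_pow,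
          Real.sq_sqrt hNpos.le]
      rw [Finset.sum_congr rfl e, ← Finset.mul_sum, inv_mul_le_iff₀ hNpos]
      calc _ ≤ B.card • (2 * d * γ * W) ^ 2 := Finset.sum_le_card_nsmul _ _ _ hres
        _ = n * (2 * d * γ * W) ^ 2 := by simp [hn]
        _ ≤ _ := by linarith
  have h1 : ψ u ^ 2 ≤ N := by
    rw [← hfψ u hu]
    exact Finset.single_le_sum (f := fun x => f x ^ 2) (fun _ _ => sq_nonneg _) hu
  have h2 : (δ * |ψ u|) ^ 2 ≤ (n * (2 * d * γ * W)) ^ 2 := by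
    rw [mul_pow, sq_abs, mul_pow]
    have : n * (2 * d * γ * W) ^ 2 ≤ n ^ 2 * (2 * d * γ * W) ^ 2 := by
      gcongr
      nlinarith
    nlinarith [sq_nonneg δ]
  have h3 := (sq_le_sq₀ (by positivity) (by positivity)).1 h2
  rw [div_mul_eq_mul_div, div_mul_eq_mul_div, le_div_iff₀ hδ]
  linarith

/-- Iterating a bound that gains a factor `q` whenever the height `φ` grows by at most `h`. -/
theorem abs_le_pow_mul_of_forall {X : Type*} {φ : X → ℕ} {ψ : X → ℝ} {S : Set X} {q W : ℝ}
    {h T : ℕ} (hW : ∀ w ∈ S, |ψ w| ≤ W)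
    (hstep : ∀ u ∈ S, φ u + h ≤ T → ∀ W', (∀ w ∈ S, φ w ≤ φ u + h → |ψ w| ≤ W') →
      |ψ u| ≤ q * W') (n : ℕ) :
    ∀ u ∈ S, φ u + n * h ≤ T → |ψ u| ≤ q ^ n * W := by
  induction n with
  | zero => intro u hu _; simpa using hW u hu
  | succ n ih =>
    intro u hu hn
    rw [pow_succ', mul_assoc]
    refine hstep u hu (by nlinarith) _ fun w hw hwu => ih w hw ?_
    nlinarith

/-- A set with at most `J` points that are pairwise more than `R` apart is covered by `J`
balls of radius `R`. -/
theorem exists_cover_of_separated {Z : Set (Fin d → ℤ)} {J R : ℕ}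
    (h : ¬ ∃ u : Fin (J + 1) → Fin d → ℤ, (∀ i, u i ∈ Z) ∧
      ∀ i j, i ≠ j → R < latticeNorm (u i - u j)) :
    ∃ C : Finset (Fin d → ℤ), C.card ≤ J ∧ ∀ z ∈ Z, ∃ c ∈ C, latticeNorm (z - c) ≤ R := by
  classical
  let P : ℕ → Prop := fun n => ∃ C : Finset (Fin d → ℤ), C.card = n ∧ (∀ c ∈ C, c ∈ Z) ∧
    ∀ c ∈ C, ∀ c' ∈ C, c ≠ c' → R < latticeNorm (c - c')
  have hP : ∀ n, P n → n ≤ J := by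
    rintro n ⟨C, rfl, hCZ, hC⟩
    by_contra! hlt
    obtain ⟨C', hC', hcard⟩ := Finset.exists_subset_card_eq (s := C) (n := J + 1) hlt
    apply h
    let e := C'.equivFinOfCardEq hcard
    refine ⟨fun i => (e.symm i).1, fun i => hCZ _ (hC' (e.symm i).2), fun i j hij =>
      hC _ (hC' (e.symm i).2) _ (hC' (e.symm j).2) fun hh => hij ?_⟩
    exact e.symm.injective (Subtype.ext hh)
  have h0 : P 0 := ⟨∅, by simp⟩
  -- A separated subset of `Z` of maximal cardinality: a point of `Z` far from all of it could be
  -- added.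
  obtain ⟨C, hC1, hC2, hC3⟩ : P (Nat.findGreatest P J) := Nat.findGreatest_spec (Nat.zero_le _) h0
  refine ⟨C, hC1.le.trans (Nat.findGreatest_le J), fun z hz => ?_⟩
  by_contra! hfar
  have hzC : z ∉ C := fun hz' => by
    have := hfar z hz'
    simp [latticeNorm_zero] at this
  have hP' : P (Nat.findGreatest P J + 1) := by
    refine ⟨insert z C, by rw [Finset.card_insert_of_notMem hzC, hC1], ?_, ?_⟩
    · intro c hc
      rcases Finset.mem_insert.1 hc with rfl | hc
      exacts [hz, hC2 c hc]
    · intro c hc c' hc' hne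
      rcases Finset.mem_insert.1 hc with rfl | h1 <;> rcases Finset.mem_insert.1 hc' with rfl | h2
      · exact absurd rfl hne
      · exact hfar c' h2
      · rw [latticeNorm_sub_comm]; exact hfar c h1
      · exact hC3 c h1 c' h2 hne
  have := Nat.le_findGreatest (hP _ hP') hP'
  omega

end Solutions

/-! ### The deterministic induction step -/

section Step

variable {d : ℕ}

/-- The number of radii below `|u - x|` outside the finite set `S`. -/
def clearRadii (x : Fin d → ℤ) (S : Finset ℕ) (u : Fin d → ℤ) : ℕ :=
  (Finset.range (latticeNorm (u - x)) \ S).card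

theorem latticeNorm_le_clearRadii_add (x : Fin d → ℤ) (S : Finset ℕ) (u : Fin d → ℤ) :
    latticeNorm (u - x) ≤ clearRadii x S u + S.card := by
  have h := Finset.card_sdiff_add_card_inter (Finset.range (latticeNorm (u - x))) S
  have h2 := Finset.card_le_card
    (Finset.inter_subset_right (s₁ := Finset.range (latticeNorm (u - x))) (s₂ := S))
  rw [Finset.card_range] at h
  unfold clearRadii
  omega

/-- Moving outwards from `u` to `w` raises the height only through unshadowed radii, so shadowed
layers are crossed for free. -/
theorem clearRadii_le {x : Fin d → ℤ} {S : Finset ℕ} {u w : Fin d → ℤ} {a k : ℕ}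
    (h : ∀ t, latticeNorm (u - x) ≤ t → t < latticeNorm (w - x) → t ∉ S → a ≤ t ∧ t < a + k) :
    clearRadii x S w ≤ clearRadii x S u + k := by
  unfold clearRadii
  have hsub : Finset.range (latticeNorm (w - x)) \ S ⊆
      (Finset.range (latticeNorm (u - x)) \ S) ∪ Finset.Ico a (a + k) := by
    intro t ht
    simp only [Finset.mem_sdiff, Finset.mem_range, Finset.mem_union, Finset.mem_Ico] at ht ⊢
    by_cases htu : t < latticeNorm (u - x)
    · exact Or.inl ⟨htu, ht.2⟩
    · exact Or.inr (h t (not_lt.1 htu) ht.1 ht.2)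
  refine (Finset.card_le_card hsub).trans ((Finset.card_union_le _ _).trans ?_)
  simp

theorem clearRadii_zero (x : Fin d → ℤ) (S : Finset ℕ) : clearRadii x S x = 0 := by
  simp [clearRadii, latticeNorm_zero]

theorem card_biUnion_Icc_le {X : Type*} (C : Finset X) (g : X → ℕ) (s J : ℕ) (hC : C.card ≤ J) :
    (C.biUnion fun c => Finset.Icc (g c - s) (g c + s)).card ≤ J * (2 * s + 1) := by
  refine Finset.card_biUnion_le.trans ?_
  refine (Finset.sum_le_card_nsmul C _ (2 * s + 1) fun c _ => ?_).trans ?_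
  · rw [Nat.card_Icc]; omega
  · rw [smul_eq_mul]; exact Nat.mul_le_mul_right _ hC

/-- If the sites that are not good at scale `L` lie in few balls and there are no resonances,
then the centre is good at the larger scale `L'`. -/
theorem isGood_of_cover {γ : ℝ} {V : (Fin d → ℤ) → ℝ} {E : ℝ} {x : Fin d → ℤ}
    {L L' J s R n : ℕ} {q δ : ℝ} (hγ : 0 ≤ γ) (hγd : 2 * d * γ ≤ 1) (hδ : 0 < δ) (hδ1 : δ ≤ 1)
    (hq : 0 ≤ q) (C : Finset (Fin d → ℤ)) (hC : C.card ≤ J)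
    (hcov : ∀ u ∈ latticeBall x L', ¬ IsGood γ V E u L q → ∃ c ∈ C, latticeNorm (u - c) ≤ s)
    (hR : J * (2 * s + 1) ≤ R)
    (hnr : ∀ u ∈ latticeBall x L', ∀ ρ ≤ R, ¬ IsResonant γ V (latticeBall u ρ) E δ)
    (hn : n * (L + 2) + J * (2 * (s + R + 1) + 1) + R + L + 2 ≤ L') :
    IsGood γ V E x L' ((q * ((2 * R + 1) ^ d / δ)) ^ n) := by
  intro ψ W hψ hW
  -- The radii about `x` shadowed by the bad balls, enlarged by `R + 1`. Height counts only the
  -- other radii, so escaping from a bad region costs no height, and the total shadow is paid for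
  -- once in `hn`.
  set Sh : Finset ℕ := C.biUnion fun c =>
    Finset.Icc (latticeNorm (c - x) - (s + R + 1)) (latticeNorm (c - x) + (s + R + 1)) with hSh
  have hShc : Sh.card ≤ J * (2 * (s + R + 1) + 1) := card_biUnion_Icc_le C _ _ J hC
  have hfac : 1 ≤ (2 * (R : ℝ) + 1) ^ d / δ := by
    rw [le_div_iff₀ hδ, one_mul]
    exact hδ1.trans (one_le_pow₀ (by linarith [Nat.cast_nonneg (α := ℝ) R]))
  refine abs_le_pow_mul_of_forall (φ := clearRadii x Sh) (S := {u | u ∈ latticeBall x (L' + 1)})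
    (h := L + 2) (T := n * (L + 2)) hW ?_ n x (self_mem_latticeBall _ _)
    (by rw [clearRadii_zero]; omega)
  intro u hu hφ W' hW'
  simp only [Set.mem_ofPred_eq] at hu hW'
  have hux : latticeNorm (u - x) + R + L + 2 ≤ L' := by
    have := latticeNorm_le_clearRadii_add x Sh u
    omega
  have hW'0 : 0 ≤ W' := (abs_nonneg _).trans (hW' u hu (Nat.le_add_right _ _))
  by_cases hgood : IsGood γ V E u L q
  · have h1 : |ψ u| ≤ q * W' := by
      refine hgood ψ W' (fun w hw => hψ w ?_) fun w hw => hW' w ?_ ?_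
      · rw [mem_latticeBall] at hw ⊢
        have := latticeNorm_sub_le w u x
        omega
      · rw [mem_latticeBall] at hw ⊢
        have := latticeNorm_sub_le w u x
        omega
      · refine clearRadii_le (a := latticeNorm (u - x)) fun t ht1 ht2 _ => ⟨ht1, ?_⟩
        rw [mem_latticeBall] at hw
        have := latticeNorm_sub_le w u x
        omega
    refine h1.trans ?_
    rw [mul_right_comm]
    exact le_mul_of_one_le_right (by positivity) hfac
  · obtain ⟨c, hc, huc⟩ := hcov u (by rw [mem_latticeBall]; omega) hgood
    -- Around a bad site, radii whose sphere meets a bad site lie in `J` intervals of `2 * s + 1`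
    -- integers, at most `R` in all, so one of the `R + 1` radii is free. The ball just inside this
    -- sphere has radius `t - 1 ≤ R` and is not resonant.
    obtain ⟨t, htR, ht1, htgood⟩ : ∃ t ≤ R + 1, 1 ≤ t ∧
        ∀ w, latticeNorm (w - u) = t → IsGood γ V E w L q := by
      by_contra! hbad
      have hsub : Finset.Icc 1 (R + 1) ⊆ C.biUnion fun c =>
          Finset.Icc (latticeNorm (c - u) - s) (latticeNorm (c - u) + s) := by
        intro t ht
        rw [Finset.mem_Icc] at ht
        obtain ⟨w, hwt, hw⟩ := hbad t ht.2 ht.1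
        have h1 := latticeNorm_sub_le w u x
        obtain ⟨c', hc', hwc⟩ := hcov w (by rw [mem_latticeBall]; omega) hw
        rw [Finset.mem_biUnion]
        refine ⟨c', hc', ?_⟩
        rw [Finset.mem_Icc]
        have h2 := latticeNorm_sub_le w c' u
        have h3 := latticeNorm_sub_le c' w u
        rw [latticeNorm_sub_comm c' w] at h3
        omega
      have h1 := Finset.card_le_card hsub
      have h2 := card_biUnion_Icc_le C (fun c => latticeNorm (c - u)) s J hC
      rw [Nat.card_Icc] at h1
      omega
    obtain ⟨ρ, rfl⟩ : ∃ ρ, t = ρ + 1 := ⟨t - 1, by omega⟩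
    have hsphere : ∀ w, latticeNorm (w - u) = ρ + 1 → |ψ w| ≤ q * W' := by
      intro w hw
      have hwx := latticeNorm_sub_le w u x
      refine htgood w hw ψ W' (fun w' hw' => hψ w' ?_) fun w' hw' => hW' w' ?_ ?_
      · rw [mem_latticeBall] at hw' ⊢
        have := latticeNorm_sub_le w' w x
        omega
      · rw [mem_latticeBall] at hw' ⊢
        have := latticeNorm_sub_le w' w x
        omega
      -- The radii from `|u - x|` to `|u - x| + R` all lie in the shadow of `c`; only the last `L +
      -- 1` can count.
      · refine (clearRadii_le (u := u) (a := latticeNorm (u - x) + (R + 1)) (k := L + 1)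
          fun t ht1 ht2 htS => ⟨?_, ?_⟩).trans (by omega)
        · by_contra! hlt
          apply htS
          rw [hSh, Finset.mem_biUnion]
          refine ⟨c, hc, ?_⟩
          rw [Finset.mem_Icc]
          have h2 := latticeNorm_sub_le u c x
          have h3 := latticeNorm_sub_le c u x
          rw [latticeNorm_sub_comm c u] at h3
          omega
        · rw [mem_latticeBall] at hw'
          have := latticeNorm_sub_le w' w x
          omega
    have h1 := abs_le_of_not_isResonant hγ hδ (hnr u (by rw [mem_latticeBall]; omega) ρ
      (by omega)) (mul_nonneg hq hW'0) (fun w hw => hψ w (by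
        rw [mem_latticeBall] at hw ⊢
        have := latticeNorm_sub_le w u x
        omega)) hsphere (self_mem_latticeBall u ρ)
    refine h1.trans ?_
    have hcard : ((latticeBall u ρ).card : ℝ) ≤ (2 * (R : ℝ) + 1) ^ d := by
      calc ((latticeBall u ρ).card : ℝ) ≤ (2 * (ρ : ℝ) + 1) ^ d := by
            exact_mod_cast card_latticeBall_le u ρ
        _ ≤ _ := by
            have : (ρ : ℝ) ≤ R := by exact_mod_cast (show ρ ≤ R by omega)
            gcongr
    calc _ ≤ (2 * (R : ℝ) + 1) ^ d / δ * 1 * (q * W') := by gcongr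
      _ = _ := by ring

/-- At sufficiently weak coupling, absence of one-site resonances makes the centre good. -/
theorem isGood_of_sites {γ : ℝ} {V : (Fin d → ℤ) → ℝ} {E : ℝ} {x : Fin d → ℤ}
    {L : ℕ} {δ : ℝ} (hγ : 0 ≤ γ) (hδ : 0 < δ)
    (hnr : ∀ u ∈ latticeBall x L, ¬ IsResonant γ V (latticeBall u 0) E δ) :
    IsGood γ V E x L ((2 * d * γ / δ) ^ L) := by
  intro ψ W hψ hW
  refine abs_le_pow_mul_of_forall (φ := fun u => latticeNorm (u - x))
    (S := {u | u ∈ latticeBall x (L + 1)}) (h := 1) (T := L) hW ?_ L x (self_mem_latticeBall _ _)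
    (by simp [latticeNorm_zero])
  intro u hu hφ W' hW'
  simp only [Set.mem_ofPred_eq] at hu hW'
  have hW'0 : 0 ≤ W' := (abs_nonneg _).trans (hW' u hu (Nat.le_add_right _ _))
  have hc : (latticeBall u 0).card = 1 :=
    le_antisymm (by simpa using card_latticeBall_le u 0) (card_latticeBall_pos u 0)
  have h1 := abs_le_of_not_isResonant hγ hδ (hnr u (by rw [mem_latticeBall]; omega)) hW'0
    (fun w hw => hψ w (by
      rw [mem_latticeBall] at hw ⊢
      have := latticeNorm_sub_le w u x
      omega)) (fun w hw => by
        have := latticeNorm_sub_le w u x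
        exact hW' w (by rw [mem_latticeBall]; omega) (by omega)) (self_mem_latticeBall u 0)
  rw [hc, Nat.cast_one] at h1
  exact h1.trans_eq (by ring)

theorem IsGood.mono {γ : ℝ} {V : (Fin d → ℤ) → ℝ} {E : ℝ} {x : Fin d → ℤ} {L : ℕ} {q q' : ℝ}
    (h : IsGood γ V E x L q) (hq : q ≤ q') : IsGood γ V E x L q' := fun ψ W hψ hW =>
  (h ψ W hψ hW).trans (mul_le_mul_of_nonneg_right hq
    ((abs_nonneg _).trans (hW x (self_mem_latticeBall _ _))))

end Step

/-! ### Induction on scales and decay of slowly growing solutions -/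

section Scales

variable {d : ℕ}

/-- The length scales of the induction. -/
def scale (s : ℕ) : ℕ := 2 ^ s ^ 2

/-- The largest radius of the balls inspected for resonances at scale `s`. -/
def resRadius (J s : ℕ) : ℕ := 8 * J * scale s

/-- The radius of the window in which resonances of scale `s` have to be rare. -/
def window (s : ℕ) : ℕ := 32 * scale (s + 2)

/-- The width of a resonance at scale `s`. -/
noncomputable def tol (σ : ℝ) (s : ℕ) : ℝ := Real.exp (-(scale s : ℝ) ^ σ)

/-- The factor gained at the centre of a good ball of scale `s`. -/
noncomputable def gain (s : ℕ) : ℝ := Real.exp (-(16 * (1 + (1 / 2) ^ s) * scale s))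

/-- The sites with a resonance of scale `s` at energy `E`. -/
def resSites (γ : ℝ) (V : (Fin d → ℤ) → ℝ) (J : ℕ) (σ E : ℝ) (s : ℕ) : Set (Fin d → ℤ) :=
  {u | ∃ r ≤ resRadius J s, IsResonant γ V (latticeBall u r) E (tol σ s)}

/-- There are `p` well separated sites in the window about the origin which have resonances of
scale `s` at the same energy `E`. -/
def SeparatedResonances (γ : ℝ) (V : (Fin d → ℤ) → ℝ) (J : ℕ) (σ : ℝ) (s p : ℕ) (E : ℝ) : Prop :=
  ∃ u : Fin p → Fin d → ℤ, (∀ i, u i ∈ latticeBall 0 (window s)) ∧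
    (∀ i j, i ≠ j → 2 * resRadius J s < latticeNorm (u i - u j)) ∧
    ∀ i, u i ∈ resSites γ V J σ E s

/-- The requirements on how large the scale has to be. -/
structure LargeScale (d J : ℕ) (σ : ℝ) (s : ℕ) : Prop where
  four_le : 4 ≤ s
  J_lt : 16 * J < 2 ^ (2 * s + 1)
  J_sq_le : 31 * (34 * J ^ 2 + 1) ≤ 14 * 2 ^ s
  loss_le : d * Real.log (2 * resRadius J s + 1) + (scale s : ℝ) ^ σ ≤ (1 / 2) ^ s * scale s

theorem scale_pos (s : ℕ) : 0 < scale s := by unfold scale; positivity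

theorem scale_succ (s : ℕ) : scale (s + 1) = 2 ^ (2 * s + 1) * scale s := by
  unfold scale; rw [← pow_add]; congr 1; ring

theorem scale_strictMono : StrictMono scale := by
  refine strictMono_nat_of_lt_succ fun s => ?_
  rw [scale_succ]
  have h1 := scale_pos s
  have h2 : 1 < 2 ^ (2 * s + 1) := Nat.one_lt_two_pow (by omega)
  nlinarith

theorem le_scale (s : ℕ) : s ≤ scale s := scale_strictMono.le_apply

theorem tol_pos (σ : ℝ) (s : ℕ) : 0 < tol σ s := Real.exp_pos _

theorem tol_le_one (σ : ℝ) (s : ℕ) : tol σ s ≤ 1 := by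
  unfold tol
  rw [Real.exp_le_one_iff, neg_nonpos]
  positivity

theorem gain_pos (s : ℕ) : 0 < gain s := Real.exp_pos _

/-- The rate `16 (1 + 2 ^ (-s))` decreases with the scale, leaving room for the losses of each step,
but never falls below 16. -/
theorem gain_le (s : ℕ) : gain s ≤ Real.exp (-(16 * scale s)) := by
  unfold gain
  rw [Real.exp_le_exp]
  have : (0 : ℝ) ≤ (1 / 2) ^ s * scale s := by positivity
  nlinarith

/-- The number of jumps available between consecutive scales makes up for the losses. -/
theorem pow_le_gain_succ {J : ℕ} {σ : ℝ} {s : ℕ} (h : LargeScale d J σ s) :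
    (gain s * ((2 * (resRadius J s : ℝ) + 1) ^ d / tol σ s)) ^ (2 ^ (2 * s + 1) - (34 * J ^ 2 + 1))
      ≤ gain (s + 1) := by
  set c : ℕ := 34 * J ^ 2 + 1 with hc
  set L : ℝ := ((scale s : ℕ) : ℝ) with hL
  set t : ℝ := (1 / 2) ^ s with ht
  have hLpos : 0 < L := Nat.cast_pos.2 (scale_pos s)
  have htpos : 0 < t := by positivity
  have ht1 : t ≤ 1 := pow_le_one₀ (by norm_num) (by norm_num)
  have h2s : (2 : ℝ) ^ s * t = 1 := by rw [ht, ← mul_pow]; norm_num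
  have hcs : (31 : ℝ) * c ≤ 14 * 2 ^ s := by exact_mod_cast h.J_sq_le
  have hcb : c ≤ 2 ^ (2 * s + 1) := by
    have h1 := h.J_sq_le
    have h2 : 2 ^ s ≤ 2 ^ (2 * s + 1) := Nat.pow_le_pow_right (by norm_num) (by omega)
    rw [← hc] at h1
    omega
  have hfac : (2 * (resRadius J s : ℝ) + 1) ^ d / tol σ s ≤ Real.exp (t * L) := by
    have hpos : (0 : ℝ) < 2 * (resRadius J s : ℝ) + 1 := by positivity
    have e1 : (2 * (resRadius J s : ℝ) + 1) ^ d =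
        Real.exp (d * Real.log (2 * resRadius J s + 1)) := by
      rw [Real.exp_nat_mul, Real.exp_log hpos]
    rw [e1, tol, Real.exp_neg, div_inv_eq_mul, ← Real.exp_add, Real.exp_le_exp]
    exact h.loss_le
  have hbase : gain s * ((2 * (resRadius J s : ℝ) + 1) ^ d / tol σ s) ≤
      Real.exp (-((16 + 15 * t) * L)) := by
    calc _ ≤ gain s * Real.exp (t * L) := by gcongr; exact (gain_pos s).le
      _ = _ := by
        rw [gain, ← Real.exp_add]; congr 1; rw [← ht, ← hL]; ring
  have hnn : 0 ≤ gain s * ((2 * (resRadius J s : ℝ) + 1) ^ d / tol σ s) :=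
    mul_nonneg (gain_pos s).le (div_nonneg (by positivity) (tol_pos σ s).le)
  refine (pow_le_pow_left₀ hnn hbase _).trans ?_
  rw [← Real.exp_nat_mul, gain, Real.exp_le_exp, scale_succ, Nat.cast_sub hcb]
  push_cast
  rw [← hL]
  have e2 : (1 / 2 : ℝ) ^ (s + 1) = t / 2 := by rw [pow_succ, ← ht]; ring
  have e3 : (2 : ℝ) ^ (2 * s + 1) = 2 * (2 ^ s) ^ 2 := by rw [pow_succ, pow_mul']; ring
  rw [e2, e3]
  set B : ℝ := 2 ^ s with hB
  have hBpos : 0 < B := by positivity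
  have e4 : 2 * B ^ 2 * t = 2 * B := by
    calc 2 * B ^ 2 * t = 2 * B * (B * t) := by ring
      _ = _ := by rw [h2s]; ring
  -- Each jump gains the rate `16 + 15 t` (that is, `16 (1 + t)` less a loss `t`), while the next
  -- scale requires `16 + 8 t`. The surplus `7 t` over `2 B ^ 2` jumps is `14 B`, as `B t = 1`, and
  -- pays for the `c` missing jumps, each worth at most 31.
  have key : c * (16 + 15 * t) ≤ 7 * (2 * B ^ 2 * t) := by
    rw [e4]
    have : (0 : ℝ) ≤ c := Nat.cast_nonneg c
    nlinarith
  have key2 : 2 * B ^ 2 * (16 + 8 * t) ≤ (2 * B ^ 2 - c) * (16 + 15 * t) := by nlinarith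
  have key3 := mul_le_mul_of_nonneg_right key2 hLpos.le
  linarith

/-- The inductive step and the initial scale: in the absence of resonances of scale `s`, the
centre is good at scale `s + 1`, provided that resonances are rare from scale `s₁` on. -/
theorem isGood_of_resSites_disjoint {γ : ℝ} {V : (Fin d → ℤ) → ℝ} {J : ℕ} {σ E : ℝ} {s₁ : ℕ}
    (hJ : 1 ≤ J) (hγ : 0 ≤ γ) (hγ1 : 2 * d * γ ≤ Real.exp (-32) * tol σ s₁)
    (hlarge : ∀ s, s₁ ≤ s → LargeScale d J σ s)
    (hrare : ∀ s, s₁ ≤ s → ∀ y, ¬ ∃ u : Fin (J + 1) → Fin d → ℤ,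
      (∀ i, u i ∈ latticeBall y (window s)) ∧
      (∀ i j, i ≠ j → 2 * resRadius J s < latticeNorm (u i - u j)) ∧
      ∀ i, u i ∈ resSites γ V J σ E s) (s : ℕ) (hs : s₁ ≤ s) :
    ∀ x, (∀ u ∈ latticeBall x (scale (s + 1)), u ∉ resSites γ V J σ E s) →
      IsGood γ V E x (scale (s + 1)) (gain (s + 1)) := by
  have hγd : 2 * d * γ ≤ 1 := by
    refine hγ1.trans (mul_le_one₀ ?_ (tol_pos _ _).le (tol_le_one _ _))
    rw [Real.exp_le_one_iff]; norm_num
  induction s, hs using Nat.le_induction with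
  | base =>
    intro x hx
    refine (isGood_of_sites hγ (tol_pos σ s₁) fun u hu hres =>
      hx u hu ⟨0, Nat.zero_le _, hres⟩).mono ?_
    -- The rate 32 is an upper bound for `16 (1 + 2 ^ (-s))`, so the initial scale needs only
    -- one-site balls.
    have h1 : 2 * d * γ / tol σ s₁ ≤ Real.exp (-32) := by
      rwa [div_le_iff₀ (tol_pos _ _)]
    refine (pow_le_pow_left₀ (div_nonneg (by positivity) (tol_pos _ _).le) h1 _).trans ?_
    rw [← Real.exp_nat_mul, gain, Real.exp_le_exp]
    have h2 : ((1 / 2 : ℝ)) ^ (s₁ + 1) ≤ 1 := pow_le_one₀ (by norm_num) (by norm_num)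
    have h3 : (0 : ℝ) ≤ scale (s₁ + 1) := Nat.cast_nonneg _
    nlinarith
  | succ s hs ih =>
    intro x hx
    set L := scale (s + 1) with hL
    have hl := hlarge s hs
    have hl' := hlarge (s + 1) (by omega)
    have hLs : 16 * J * scale s ≤ L := by
      rw [hL, scale_succ]; exact Nat.mul_le_mul_right _ hl.J_lt.le
    have hLL' : scale (s + 1 + 1) = 2 ^ (2 * (s + 1) + 1) * L := scale_succ (s + 1)
    have hLle : L ≤ scale (s + 1 + 1) := scale_strictMono.monotone (by omega)
    obtain ⟨C, hC, hcov⟩ := exists_cover_of_separated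
      (Z := {u | u ∈ latticeBall x (window s) ∧ u ∈ resSites γ V J σ E s}) (J := J)
      (R := 2 * resRadius J s) (by
        rintro ⟨u, hu, hsep⟩
        exact hrare s hs x ⟨u, fun i => (hu i).1, hsep, fun i => (hu i).2⟩)
    refine (isGood_of_cover (n := 2 ^ (2 * (s + 1) + 1) - (34 * J ^ 2 + 1)) (s := 2 * L) (J := J)
      (R := resRadius J (s + 1)) (L := L) (q := gain (s + 1)) (δ := tol σ (s + 1)) hγ hγd
      (tol_pos _ _) (tol_le_one _ _) (gain_pos _).le C hC ?_ ?_ ?_ ?_).mono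
      (pow_le_gain_succ hl')
    · intro u hu hbad
      -- By induction a bad site has a scale-`s` resonance within `L`, which is within `2 *
      -- resRadius J s < L` of a centre. Hence the covering radius `2 * L`.
      have h1 : ∃ z ∈ latticeBall u L, z ∈ resSites γ V J σ E s := by
        by_contra! hno
        exact hbad (ih u hno)
      obtain ⟨z, hzu, hz⟩ := h1
      rw [mem_latticeBall] at hu hzu
      obtain ⟨c, hc, hzc⟩ := hcov z ⟨by
        rw [mem_latticeBall]
        have := latticeNorm_sub_le z u x
        have : window s = 32 * scale (s + 1 + 1) := rfl
        omega, hz⟩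
      refine ⟨c, hc, ?_⟩
      have h2 := latticeNorm_sub_le u z c
      rw [latticeNorm_sub_comm u z] at h2
      have h3 : 2 * resRadius J s = 16 * J * scale s := by unfold resRadius; ring
      omega
    · unfold resRadius
      rw [← hL]
      have := scale_pos (s + 1)
      nlinarith
    · intro u hu ρ hρ hres
      exact hx u hu ⟨ρ, hρ, hres⟩
    -- Length budget in units of `L`: the shadows, the escape radius and the rounding `L + 2`
    -- instead of `L` cost at most `34 J ^ 2 + 1` of the `2 ^ (2 * (s + 1) + 1)` available jumps.
    · have hLpos : 1 ≤ L := scale_pos (s + 1)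
      have h4 := hl'.J_sq_le
      have hb : 2 * 2 ^ (2 * (s + 1) + 1) ≤ L := by
        rw [hL, scale, ← pow_succ']
        refine Nat.pow_le_pow_right (by norm_num) ?_
        have := hl.four_le
        nlinarith
      have hcb : 34 * J ^ 2 + 1 ≤ 2 ^ (2 * (s + 1) + 1) := by
        have h2 : 2 ^ (s + 1) ≤ 2 ^ (2 * (s + 1) + 1) :=
          Nat.pow_le_pow_right (by norm_num) (by omega)
        omega
      rw [hLL']
      unfold resRadius
      rw [← hL]
      obtain ⟨m, hm⟩ := Nat.exists_eq_add_of_le hcb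
      rw [hm] at hb ⊢
      rw [Nat.add_sub_cancel_left]
      have hJL : L ≤ J * L := Nat.le_mul_of_pos_left _ hJ
      have hJJL : J * L ≤ J ^ 2 * L := by
        rw [pow_two, mul_assoc]; exact Nat.le_mul_of_pos_left _ hJ
      have hJJ : J ≤ J * L := Nat.le_mul_of_pos_right _ hLpos
      nlinarith

/-- Solutions that grow slowly decay exponentially if, at all large scales, no two separated
sites have resonances at the same energy. -/
theorem exists_abs_le_exp_neg {γ : ℝ} {V : (Fin d → ℤ) → ℝ} {J : ℕ} {σ E : ℝ} {s₁ : ℕ}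
    (hlarge : ∀ s, s₁ ≤ s → LargeScale d J σ s)
    (hgood : ∀ s, s₁ ≤ s → ∀ x, (∀ u ∈ latticeBall x (scale (s + 1)), u ∉ resSites γ V J σ E s) →
      IsGood γ V E x (scale (s + 1)) (gain (s + 1)))
    (htwo : ∀ᶠ s in atTop, ¬ SeparatedResonances γ V J σ s 2 E)
    {ψ : (Fin d → ℤ) → ℝ} (hψ : ∀ x, hopping γ V ψ x = E * ψ x) {C : ℝ}
    (hC : ∀ x, |ψ x| ≤ C * Real.exp (latticeNorm x / 4)) :
    ∃ C', ∀ x, |ψ x| ≤ C' * Real.exp (-latticeNorm x) := by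
  have hC0 : 0 ≤ C := by
    have := (abs_nonneg _).trans (hC 0)
    simpa [latticeNorm_zero] using this
  by_cases hzero : ∀ x, ψ x = 0
  · exact ⟨0, fun x => by simp [hzero x]⟩
  push Not at hzero
  obtain ⟨u₀, hu₀⟩ := hzero
  -- Without a resonance near the origin, `u₀` would be good, and the gain at rate 16 against growth
  -- at rate 1/4 would force `ψ u₀` below any positive number.
  have hnear : ∀ᶠ s in atTop, ∃ z ∈ latticeBall 0 (2 * scale (s + 1)),
      z ∈ resSites γ V J σ E s := by
    have hlim : Tendsto (fun s : ℕ => C * Real.exp 1 * Real.exp (-(scale (s + 1) : ℝ))) atTop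
        (𝓝 (C * Real.exp 1 * 0)) := by
      refine Tendsto.const_mul _ (Real.tendsto_exp_neg_atTop_nhds_zero.comp ?_)
      exact tendsto_natCast_atTop_atTop.comp
        (scale_strictMono.tendsto_atTop.comp (tendsto_add_atTop_nat 1))
    rw [mul_zero] at hlim
    filter_upwards [hlim.eventually (gt_mem_nhds (abs_pos.2 hu₀)), eventually_ge_atTop s₁,
      eventually_ge_atTop (latticeNorm u₀)] with s hs1 hs2 hs3
    by_contra! hno
    have hs4 : latticeNorm u₀ ≤ scale (s + 1) := hs3.trans ((Nat.le_succ s).trans (le_scale _))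
    have h1 := hgood s hs2 u₀ fun u hu => hno u (by
      rw [mem_latticeBall, sub_zero]
      rw [mem_latticeBall] at hu
      have := latticeNorm_sub_le u u₀ 0
      rw [sub_zero, sub_zero] at this
      omega)
    have h2 := h1 ψ (C * Real.exp ((2 * scale (s + 1) + 1) / 4)) (fun u _ => hψ u) fun w hw => by
      refine (hC w).trans ?_
      gcongr
      rw [mem_latticeBall] at hw
      have := latticeNorm_sub_le w u₀ 0
      rw [sub_zero, sub_zero] at this
      exact_mod_cast (show latticeNorm w ≤ 2 * scale (s + 1) + 1 by omega)
    have h3 : gain (s + 1) * (C * Real.exp ((2 * scale (s + 1) + 1) / 4)) ≤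
        C * Real.exp 1 * Real.exp (-(scale (s + 1) : ℝ)) := by
      calc _ ≤ Real.exp (-(16 * scale (s + 1))) * (C * Real.exp ((2 * scale (s + 1) + 1) / 4)) := by
            gcongr; exact gain_le _
        _ = C * Real.exp (-(16 * scale (s + 1)) + (2 * scale (s + 1) + 1) / 4) := by
            rw [Real.exp_add]; ring
        _ ≤ C * Real.exp (1 + -(scale (s + 1) : ℝ)) := by
            refine mul_le_mul_of_nonneg_left (Real.exp_le_exp.2 ?_) hC0
            have : (0 : ℝ) ≤ scale (s + 1) := Nat.cast_nonneg _
            linarith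
        _ = _ := by rw [Real.exp_add]; ring
    linarith
  obtain ⟨s₂, hs₂⟩ := eventually_atTop.1 (hnear.and (htwo.and (eventually_ge_atTop s₁)))
  refine ⟨C * Real.exp (2 * (8 * scale (s₂ + 1))), fun x => ?_⟩
  by_cases hsmall : latticeNorm x ≤ 8 * scale (s₂ + 1)
  · refine (hC x).trans ?_
    rw [mul_assoc, ← Real.exp_add]
    gcongr
    have : (latticeNorm x : ℝ) ≤ 8 * scale (s₂ + 1) := by exact_mod_cast hsmall
    linarith
  -- The scale adapted to `x`: large enough for sites at norm at most `2 ‖x‖` to lie well inside the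
  -- window, small enough for `x` to be far from the resonance `z₀`.
  obtain ⟨s, hss, hxs, hxs'⟩ : ∃ s, s₂ ≤ s ∧ 8 * scale (s + 1) ≤ latticeNorm x ∧
      latticeNorm x ≤ 8 * scale (s + 2) := by
    classical
    have hex : ∃ s, latticeNorm x ≤ 8 * scale (s + 2) :=
      ⟨latticeNorm x, by have := le_scale (latticeNorm x + 2); omega⟩
    have hspec := Nat.find_spec hex
    have h1 : s₂ ≤ Nat.find hex := by
      by_contra! hlt
      have : scale (Nat.find hex + 2) ≤ scale (s₂ + 1) := scale_strictMono.monotone (by omega)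
      omega
    refine ⟨Nat.find hex, h1, ?_, hspec⟩
    rcases Nat.eq_zero_or_pos (Nat.find hex) with h0 | hpos
    · have : s₂ = 0 := by omega
      rw [h0]
      subst this
      omega
    · have := Nat.find_min hex (m := Nat.find hex - 1) (by omega)
      rw [show Nat.find hex - 1 + 2 = Nat.find hex + 1 by omega] at this
      omega
  obtain ⟨⟨z₀, hz₀, hz₀r⟩, htwo', hs₁⟩ := hs₂ s hss
  set L := scale (s + 1) with hL
  have hLpos : 1 ≤ L := scale_pos _
  rw [mem_latticeBall, sub_zero] at hz₀
  have hwin : window s = 32 * scale (s + 2) := rfl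
  have hLle : L ≤ scale (s + 2) := scale_strictMono.monotone (by omega)
  have hRL : 2 * resRadius J s < L := by
    have h3 : 2 * resRadius J s = 16 * J * scale s := by unfold resRadius; ring
    rw [h3, hL, scale_succ]
    exact Nat.mul_lt_mul_of_pos_right (hlarge s hs₁).J_lt (scale_pos s)
  -- A resonance within `L` of `u` has norm at least `3 L`, and `z₀` has norm at most `2 L`. They
  -- would form a separated pair.
  have hgoodu : ∀ u, 4 * L ≤ latticeNorm u → latticeNorm u ≤ 2 * latticeNorm x →
      IsGood γ V E u L (gain (s + 1)) := by
    intro u hu1 hu2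
    refine hgood s hs₁ u fun z hz hzr => htwo' ⟨![z₀, z], ?_, ?_, ?_⟩
    · rw [mem_latticeBall] at hz
      have h1 := latticeNorm_sub_le z u 0
      rw [sub_zero, sub_zero] at h1
      intro i
      fin_cases i
      · simp only [mem_latticeBall, sub_zero]
        change latticeNorm z₀ ≤ _
        omega
      · simp only [mem_latticeBall, sub_zero]
        change latticeNorm z ≤ _
        omega
    · rw [mem_latticeBall] at hz
      have h1 := latticeNorm_sub_le u z 0
      rw [sub_zero, sub_zero, latticeNorm_sub_comm] at h1
      have h2 := latticeNorm_sub_le z z₀ 0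
      rw [sub_zero, sub_zero] at h2
      have h3 : 2 * resRadius J s < latticeNorm (z - z₀) := by omega
      intro i j hij
      fin_cases i <;> fin_cases j
      · exact absurd rfl hij
      · change _ < latticeNorm (z₀ - z)
        rwa [latticeNorm_sub_comm]
      · exact h3
      · exact absurd rfl hij
    · intro i
      fin_cases i
      exacts [hz₀r, hzr]
  obtain ⟨ρ, hρ⟩ := Nat.exists_eq_add_of_le (show 4 * L ≤ latticeNorm x by omega)
  have hiter := abs_le_pow_mul_of_forall (φ := fun u => latticeNorm (u - x)) (ψ := ψ)
    (S := {u | u ∈ latticeBall x ρ}) (h := L + 1) (T := ρ) (q := gain (s + 1))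
    (W := C * Real.exp (2 * latticeNorm x / 4)) (fun w hw => by
      refine (hC w).trans ?_
      gcongr
      simp only [Set.mem_ofPred_eq, mem_latticeBall] at hw
      have := latticeNorm_sub_le w x 0
      rw [sub_zero, sub_zero] at this
      exact_mod_cast (show latticeNorm w ≤ 2 * latticeNorm x by omega))
    (fun u hu hφ W' hW' => by
      simp only [Set.mem_ofPred_eq, mem_latticeBall] at hu hφ hW'
      have h1 := latticeNorm_sub_le x u 0
      have h2 := latticeNorm_sub_le u x 0
      rw [sub_zero, sub_zero] at h1 h2
      rw [latticeNorm_sub_comm] at h1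
      refine hgoodu u (by omega) (by omega) ψ W' (fun w _ => hψ w) fun w hw => ?_
      rw [mem_latticeBall] at hw
      have h3 := latticeNorm_sub_le w u x
      exact hW' w (by omega) (by omega)) (ρ / (L + 1)) x
    (self_mem_latticeBall _ _) (by
      simp only [sub_self, latticeNorm_zero, zero_add]
      exact Nat.div_mul_le_self _ _)
  set n := ρ / (L + 1) with hn
  -- As `‖x‖ ≥ 8 L`, at least half of the way to the origin is available for jumps. The rate 16 then
  -- yields decay at rate 2, of which the a priori growth takes back 1/2.
  have hnL : 2 * latticeNorm x ≤ 16 * L * n := by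
    have h1 := Nat.div_add_mod ρ (L + 1)
    have h2 := Nat.mod_lt ρ (show 0 < L + 1 by omega)
    rw [← hn] at h1
    clear_value n
    have h3 : n ≤ L * n := Nat.le_mul_of_pos_left _ hLpos
    have h4 : (L + 1) * n = L * n + n := by ring
    have h5 : 16 * L * n = 16 * (L * n) := by ring
    rw [h4] at h1
    rw [h5]
    omega
  have hnL' : 2 * (latticeNorm x : ℝ) ≤ 16 * L * n := by exact_mod_cast hnL
  calc |ψ x| ≤ gain (s + 1) ^ n * (C * Real.exp (2 * latticeNorm x / 4)) := hiter
    _ ≤ Real.exp (-(16 * L)) ^ n * (C * Real.exp (2 * latticeNorm x / 4)) := by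
        gcongr
        · exact (gain_pos _).le
        · exact gain_le _
    _ = C * Real.exp (-(16 * L * n) + 2 * latticeNorm x / 4) := by
        rw [← Real.exp_nat_mul, Real.exp_add]
        rw [show (n : ℝ) * -(16 * L) = -(16 * L * n) by ring]; ring
    _ ≤ C * Real.exp (2 * (8 * scale (s₂ + 1)) + -latticeNorm x) := by
        refine mul_le_mul_of_nonneg_left (Real.exp_le_exp.2 ?_) hC0
        have : (0 : ℝ) ≤ scale (s₂ + 1) := Nat.cast_nonneg _
        have : (0 : ℝ) ≤ latticeNorm x := Nat.cast_nonneg _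
        linarith
    _ = _ := by rw [Real.exp_add]; ring

end Scales

/-! ### Comparison of scales, windows and tolerances -/

section Asymptotics

/-- Quadratic exponents with different leading coefficients dominate each other. -/
theorem eventually_mul_two_rpow_le {a b : ℝ} (hab : a < b) (m c : ℝ) :
    ∀ᶠ s : ℕ in atTop, c * (2 : ℝ) ^ (a * (s : ℝ) ^ 2 + m * s) ≤ (2 : ℝ) ^ (b * (s : ℝ) ^ 2) := by
  obtain ⟨k, hk⟩ := pow_unbounded_of_one_lt c (one_lt_two (α := ℝ))
  filter_upwards [eventually_ge_atTop 1,
    tendsto_natCast_atTop_atTop.eventually_ge_atTop ((|m| + k) / (b - a))] with s hs1 hs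
  have hs1' : (1 : ℝ) ≤ s := by exact_mod_cast hs1
  have hs2 : |m| + k ≤ (b - a) * s := by
    rw [div_le_iff₀ (by linarith)] at hs
    linarith
  calc c * (2 : ℝ) ^ (a * (s : ℝ) ^ 2 + m * s)
      ≤ (2 : ℝ) ^ (k : ℝ) * (2 : ℝ) ^ (a * (s : ℝ) ^ 2 + m * s) := by
        rw [Real.rpow_natCast]; gcongr
    _ = (2 : ℝ) ^ ((k : ℝ) + (a * (s : ℝ) ^ 2 + m * s)) := (Real.rpow_add (by norm_num) _ _).symm
    _ ≤ _ := by
        refine Real.rpow_le_rpow_of_exponent_le (by norm_num) ?_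
        have h1 : (k : ℝ) ≤ k * s := le_mul_of_one_le_right (Nat.cast_nonneg k) hs1'
        have h2 : m * s ≤ |m| * s := mul_le_mul_of_nonneg_right (le_abs_self m) (by linarith)
        nlinarith

theorem scale_rpow (σ : ℝ) (s : ℕ) : (scale s : ℝ) ^ σ = (2 : ℝ) ^ (σ * (s : ℝ) ^ 2) := by
  unfold scale
  push_cast
  rw [← Real.rpow_natCast, ← Real.rpow_mul (by norm_num)]
  congr 1
  push_cast
  ring

theorem window_rpow (β : ℝ) (s : ℕ) :
    (window s : ℝ) ^ β = (2 : ℝ) ^ (9 * β) * (2 : ℝ) ^ (β * (s : ℝ) ^ 2 + 4 * β * s) := by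
  unfold window scale
  push_cast
  rw [show (32 : ℝ) = 2 ^ 5 by norm_num, ← pow_add, ← Real.rpow_natCast,
    ← Real.rpow_mul (by norm_num), ← Real.rpow_add (by norm_num)]
  congr 1
  push_cast
  ring

theorem one_le_window (s : ℕ) : 1 ≤ window s := by
  unfold window
  have := scale_pos (s + 2)
  omega

/-- The window has size `2 ^ (s ^ 2 + 4 s + 9)`, hence exceeds `L_s` by less than any positive power
of `L_s`. -/
theorem eventually_window_rpow_le {β σ : ℝ} (hβσ : β < σ) (c : ℝ) :
    ∀ᶠ s : ℕ in atTop, c * (window s : ℝ) ^ β ≤ (scale s : ℝ) ^ σ := by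
  filter_upwards [eventually_mul_two_rpow_le hβσ (4 * β) (c * 2 ^ (9 * β))] with s hs
  rw [window_rpow, scale_rpow, ← mul_assoc]
  exact hs

/-- The logarithm and `L ^ σ` are both `O (L ^ σ)`, while `2 ^ (-s) L = 2 ^ (s ^ 2 - s)` has leading
exponent 1 > σ. -/
theorem eventually_largeScale (d J : ℕ) {σ : ℝ} (hσ : 0 < σ) (hσ1 : σ < 1) :
    ∀ᶠ s : ℕ in atTop, LargeScale d J σ s := by
  have h1 : ∀ᶠ s : ℕ in atTop, 31 * (34 * J ^ 2 + 1) + 16 * J ≤ s := eventually_ge_atTop _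
  filter_upwards [eventually_ge_atTop 4, h1,
    eventually_mul_two_rpow_le hσ1 1 (d * ((16 * J + 1) ^ σ / σ) + 1)] with s hs4 hsJ hs
  have h2 : s < 2 ^ s := Nat.lt_two_pow_self
  refine ⟨hs4, ?_, by omega, ?_⟩
  · have h3 : 2 ^ s ≤ 2 ^ (2 * s + 1) := Nat.pow_le_pow_right (by norm_num) (by omega)
    omega
  · have hL : (1 : ℝ) ≤ scale s := by exact_mod_cast scale_pos s
    have hR : 2 * (resRadius J s : ℝ) + 1 ≤ (16 * J + 1) * scale s := by
      unfold resRadius; push_cast; nlinarith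
    have hlog : Real.log (2 * resRadius J s + 1) ≤ (16 * J + 1) ^ σ / σ * (scale s : ℝ) ^ σ := by
      refine (Real.log_le_rpow_div (by positivity) hσ).trans ?_
      rw [div_mul_eq_mul_div, ← Real.mul_rpow (by positivity) (by positivity)]
      gcongr
    have h3 : d * Real.log (2 * resRadius J s + 1) + (scale s : ℝ) ^ σ ≤
        (d * ((16 * J + 1) ^ σ / σ) + 1) * (scale s : ℝ) ^ σ := by
      have := mul_le_mul_of_nonneg_left hlog (Nat.cast_nonneg (α := ℝ) d)
      linarith
    have h4 : (scale s : ℝ) = 2 ^ (1 * (s : ℝ) ^ 2) := by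
      rw [← scale_rpow, Real.rpow_one]
    rw [← h4, Real.rpow_add (by norm_num), ← scale_rpow, one_mul, Real.rpow_natCast] at hs
    refine h3.trans ?_
    rw [one_div, inv_pow, inv_mul_eq_div, le_div_iff₀ (by positivity)]
    linarith

/-- Constants, powers of the window `M` and even `exp s` are absorbed into `exp (const * M ^ β)`,
which the tolerance beats. -/
theorem eventually_mul_tol_le {β σ : ℝ} (hβ : 0 < β) (hβσ : β < σ) (c₀ c₁ a : ℝ) :
    ∀ᶠ s : ℕ in atTop, c₀ * Real.exp (c₁ * (window s : ℝ) ^ β) * (window s : ℝ) ^ a * tol σ s ≤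
      (1 / 2) ^ s := by
  filter_upwards [eventually_window_rpow_le hβσ (2 * (|c₀| + c₁ + |a| / β)),
    eventually_window_rpow_le hβσ (2 * β⁻¹)] with s hs1 hs2
  have hM1 : (1 : ℝ) ≤ window s := by exact_mod_cast one_le_window s
  set M : ℝ := ((window s : ℕ) : ℝ) with hM
  have hMβ : 1 ≤ M ^ β := Real.one_le_rpow hM1 hβ.le
  have hlogM : Real.log M ≤ M ^ β / β := Real.log_le_rpow_div (by linarith) hβ
  have h1 : c₀ ≤ Real.exp (|c₀| * M ^ β) := by
    have := Real.add_one_le_exp (|c₀| * M ^ β)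
    have h2 : |c₀| ≤ |c₀| * M ^ β := le_mul_of_one_le_right (abs_nonneg _) hMβ
    have := le_abs_self c₀
    linarith
  have h2 : M ^ a ≤ Real.exp (|a| / β * M ^ β) := by
    rw [Real.rpow_def_of_pos (by linarith), Real.exp_le_exp]
    have h3 : 0 ≤ Real.log M := Real.log_nonneg hM1
    calc Real.log M * a ≤ Real.log M * |a| := mul_le_mul_of_nonneg_left (le_abs_self a) h3
      _ ≤ M ^ β / β * |a| := by gcongr
      _ = _ := by ring
  have hsM : (s : ℝ) * β ≤ M ^ β := by
    have h3 : (s : ℝ) ≤ Real.log M := by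
      rw [Real.le_log_iff_exp_le (by linarith)]
      have h4 : Real.exp 1 ≤ 3 := Real.exp_one_lt_three.le
      calc Real.exp s = Real.exp 1 ^ s := by rw [← Real.exp_nat_mul, mul_one]
        _ ≤ 4 ^ s := by gcongr; linarith
        _ ≤ M := by
          rw [hM]
          have h5 : 4 ^ s ≤ window s := by
            unfold window scale
            rw [show 4 = 2 ^ 2 by norm_num, ← pow_mul]
            calc 2 ^ (2 * s) ≤ 2 ^ (s + 2) ^ 2 := Nat.pow_le_pow_right (by norm_num) (by nlinarith)
              _ ≤ _ := by omega
          exact_mod_cast h5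
    have := h3.trans hlogM
    rwa [le_div_iff₀ hβ] at this
  have hhalf : Real.exp (-(s : ℝ)) ≤ (1 / 2) ^ s := by
    rw [show -(s : ℝ) = s * (-1) by ring, Real.exp_nat_mul]
    gcongr
    rw [Real.exp_neg, one_div]
    gcongr
    linarith [Real.add_one_le_exp (1 : ℝ)]
  refine le_trans ?_ hhalf
  calc c₀ * Real.exp (c₁ * M ^ β) * M ^ a * tol σ s
      ≤ Real.exp (|c₀| * M ^ β) * Real.exp (c₁ * M ^ β) * Real.exp (|a| / β * M ^ β) * tol σ s := by
        have := (tol_pos σ s).le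
        gcongr
    _ = Real.exp ((|c₀| + c₁ + |a| / β) * M ^ β + -(scale s : ℝ) ^ σ) := by
        rw [tol, ← Real.exp_add, ← Real.exp_add, ← Real.exp_add]; congr 1; ring
    _ ≤ _ := by
        rw [Real.exp_le_exp]
        have : (s : ℝ) ≤ β⁻¹ * M ^ β := by
          rw [inv_mul_eq_div, le_div_iff₀ hβ]; exact hsM
        linarith

end Asymptotics

/-! ### Wegner-type estimates by varying the potential at one site -/

section Wegner

variable {d : ℕ}

/-- The potentials for which the restriction of `γ Δ + V` to `B` has a resonance at energy `E`
whose approximate eigenvector is not small at `x`. -/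
def resonantAt (γ : ℝ) (B : Finset (Fin d → ℤ)) (x : Fin d → ℤ) (E δ : ℝ) :
    Set ((Fin d → ℤ) → ℝ) :=
  {V | ∃ f : (Fin d → ℤ) → ℝ, (∀ y, y ∉ B → f y = 0) ∧ ∑ y ∈ B, f y ^ 2 = 1 ∧
    1 ≤ B.card * f x ^ 2 ∧ ∑ y ∈ B, (hopping γ V f y - E * f y) ^ 2 ≤ δ ^ 2}

theorem continuous_hopping (γ : ℝ) (y : Fin d → ℤ) :
    Continuous fun p : ((Fin d → ℤ) → ℝ) × ((Fin d → ℤ) → ℝ) => hopping γ p.1 p.2 y := by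
  unfold hopping neighborSum
  fun_prop

/-- Candidate eigenvectors take values in `[-1, 1]`, so they form part of a compact space, and a
projection along a compact factor is closed. Measurability of the resonance events rests on this. -/
theorem isClosed_resonantAt (γ : ℝ) (B : Finset (Fin d → ℤ)) (x : Fin d → ℤ) (E δ : ℝ) :
    IsClosed (resonantAt γ B x E δ) := by
  let K : Set ((Fin d → ℤ) → ℝ) := {f | ∀ y, f y ∈ Set.Icc (-1 : ℝ) 1}
  have hK : IsCompact K := by
    have : K = Set.pi Set.univ fun _ => Set.Icc (-1 : ℝ) 1 := by
      ext f; simp [K, Pi.le_def, forall_and]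
    rw [this]
    exact isCompact_univ_pi fun _ => isCompact_Icc
  have : CompactSpace K := isCompact_iff_compactSpace.1 hK
  let S : Set (((Fin d → ℤ) → ℝ) × K) := {p | (∀ y, y ∉ B → p.2.1 y = 0) ∧
    ∑ y ∈ B, p.2.1 y ^ 2 = 1 ∧ 1 ≤ B.card * p.2.1 x ^ 2 ∧
    ∑ y ∈ B, (hopping γ p.1 p.2.1 y - E * p.2.1 y) ^ 2 ≤ δ ^ 2}
  have hS : IsClosed S := by
    have hev : ∀ y, Continuous fun p : ((Fin d → ℤ) → ℝ) × K => p.2.1 y := fun y =>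
      (continuous_apply y).comp (continuous_subtype_val.comp continuous_snd)
    have hhop : ∀ y, Continuous fun p : ((Fin d → ℤ) → ℝ) × K => hopping γ p.1 p.2.1 y := fun y =>
      (continuous_hopping γ y).comp
        (continuous_fst.prodMk (continuous_subtype_val.comp continuous_snd))
    have h1 : IsClosed {p : ((Fin d → ℤ) → ℝ) × K | ∀ y, y ∉ B → p.2.1 y = 0} := by
      simp only [Set.ofPred_forall]
      exact isClosed_iInter fun y => isClosed_iInter fun _ => isClosed_eq (hev y) continuous_const
    refine h1.inter (IsClosed.inter ?_ (IsClosed.inter ?_ ?_))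
    · exact isClosed_eq (continuous_finsetSum _ fun y _ => (hev y).pow 2) continuous_const
    · exact isClosed_le continuous_const (continuous_const.mul ((hev x).pow 2))
    · exact isClosed_le (continuous_finsetSum _ fun y _ =>
        ((hhop y).sub (continuous_const.mul (hev y))).pow 2) continuous_const
  have : resonantAt γ B x E δ = Prod.fst '' S := by
    ext V
    constructor
    · rintro ⟨f, hf0, hf1, hf2, hf3⟩
      refine ⟨(V, ⟨f, fun y => ?_⟩), ⟨hf0, hf1, hf2, hf3⟩, rfl⟩
      by_cases hy : y ∈ B
      · have : f y ^ 2 ≤ 1 := by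
          rw [← hf1]
          exact Finset.single_le_sum (f := fun y => f y ^ 2) (fun _ _ => sq_nonneg _) hy
        exact abs_le.1 ((sq_le_one_iff_abs_le_one _).1 this)
      · simp [hf0 y hy]
    · rintro ⟨⟨V', f⟩, ⟨hf0, hf1, hf2, hf3⟩, rfl⟩
      exact ⟨f.1, hf0, hf1, hf2, hf3⟩
  rw [this]
  exact isClosedMap_fst_of_compactSpace _ hS

theorem measurableSet_resonantAt (γ : ℝ) (B : Finset (Fin d → ℤ)) (x : Fin d → ℤ) (E δ : ℝ) :
    MeasurableSet (resonantAt γ B x E δ) :=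
  (isClosed_resonantAt γ B x E δ).measurableSet

theorem resonantAt_congr {γ : ℝ} {B : Finset (Fin d → ℤ)} {x : Fin d → ℤ} {E δ : ℝ}
    {V V' : (Fin d → ℤ) → ℝ} (h : ∀ y ∈ B, V y = V' y) :
    V ∈ resonantAt γ B x E δ ↔ V' ∈ resonantAt γ B x E δ := by
  refine exists_congr fun f => and_congr_right fun _ => and_congr_right fun _ =>
    and_congr_right fun _ => ?_
  rw [Finset.sum_congr rfl fun y hy => ?_]
  simp only [hopping, h y hy]

theorem sum_mul_shift {B : Finset (Fin d → ℤ)} {f f' : (Fin d → ℤ) → ℝ}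
    (hf : ∀ y, y ∉ B → f y = 0) (hf' : ∀ y, y ∉ B → f' y = 0) (e : Fin d → ℤ) :
    ∑ y ∈ B, f' y * f (y + e) = ∑ y ∈ B, f y * f' (y - e) := by
  have h1 : ∑' y, f' y * f (y + e) = ∑ y ∈ B, f' y * f (y + e) :=
    tsum_eq_sum fun y hy => by simp [hf' y hy]
  have h2 : ∑' y, f y * f' (y - e) = ∑ y ∈ B, f y * f' (y - e) :=
    tsum_eq_sum fun y hy => by simp [hf y hy]
  rw [← h1, ← h2, ← (Equiv.addRight e).tsum_eq fun y => f y * f' (y - e)]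
  refine tsum_congr fun y => ?_
  simp [mul_comm]

theorem sum_mul_neighborSum_comm {B : Finset (Fin d → ℤ)} {f f' : (Fin d → ℤ) → ℝ}
    (hf : ∀ y, y ∉ B → f y = 0) (hf' : ∀ y, y ∉ B → f' y = 0) :
    ∑ y ∈ B, f' y * neighborSum f y = ∑ y ∈ B, f y * neighborSum f' y := by
  simp only [neighborSum, Finset.mul_sum]
  rw [Finset.sum_comm, Finset.sum_comm (s := B) (t := Finset.univ)]
  refine Finset.sum_congr rfl fun i _ => ?_
  simp only [mul_add, Finset.sum_add_distrib]
  have h1 := sum_mul_shift hf hf' (Pi.single i 1)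
  have h2 := sum_mul_shift hf' hf (Pi.single i 1)
  linarith

/-- For given values of the potential off `x`, the values at `x` which produce a resonance lie in
a short interval. -/
theorem abs_sub_le_of_mem_resonantAt {γ : ℝ} {B : Finset (Fin d → ℤ)} {x : Fin d → ℤ} {E δ : ℝ}
    (hδ : 0 ≤ δ) (hx : x ∈ B) {V V' : (Fin d → ℤ) → ℝ} (hVV' : ∀ y ∈ B, y ≠ x → V y = V' y)
    (h : V ∈ resonantAt γ B x E δ) (h' : V' ∈ resonantAt γ B x E δ) :
    |V x - V' x| ≤ 2 * δ * B.card := by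
  obtain ⟨f, hf0, hf1, hf2, hf3⟩ := h
  obtain ⟨f', hf0', hf1', hf2', hf3'⟩ := h'
  set n : ℝ := ((B.card : ℕ) : ℝ) with hn
  have hn0 : 0 ≤ n := Nat.cast_nonneg _
  have cs : ∀ a b : (Fin d → ℤ) → ℝ, ∑ y ∈ B, a y ^ 2 = 1 → ∑ y ∈ B, b y ^ 2 ≤ δ ^ 2 →
      |∑ y ∈ B, a y * b y| ≤ δ := by
    intro a b ha hb
    have h1 := Finset.sum_mul_sq_le_sq_mul_sq B a b
    rw [ha, one_mul] at h1
    exact abs_le_of_sq_le_sq (h1.trans hb) hδ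
  have k1 := cs f' _ hf1' hf3
  have k2 := cs f _ hf1 hf3'
  -- Pair each approximate eigenvector with the equation of the other. Hopping and energy cancel by
  -- symmetry, and only the change of the potential at `x` is left. The left side is at most `2 *
  -- δ`, and `|f x * f' x| ≥ 1 / n`.
  have key : ∑ y ∈ B, f' y * (hopping γ V f y - E * f y) -
      ∑ y ∈ B, f y * (hopping γ V' f' y - E * f' y) = (V x - V' x) * (f x * f' x) := by
    have e1 : ∀ y ∈ B, f' y * (hopping γ V f y - E * f y) - f y * (hopping γ V' f' y - E * f' y) =
        γ * (f' y * neighborSum f y) - γ * (f y * neighborSum f' y) +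
          (V y - V' y) * (f y * f' y) := by
      intro y _
      simp only [hopping]; ring
    rw [← Finset.sum_sub_distrib, Finset.sum_congr rfl e1, Finset.sum_add_distrib,
      Finset.sum_sub_distrib, ← Finset.mul_sum, ← Finset.mul_sum, sum_mul_neighborSum_comm hf0 hf0',
      sub_self, zero_add]
    refine Finset.sum_eq_single_of_mem x hx fun y hy hyx => ?_
    rw [hVV' y hy hyx, sub_self, zero_mul]
  have k3 : |V x - V' x| * |f x * f' x| ≤ 2 * δ := by
    rw [← abs_mul, ← key]
    exact (abs_sub _ _).trans (by linarith)
  have k4 : 1 ≤ n * |f x * f' x| := by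
    have : 1 ^ 2 ≤ (n * |f x * f' x|) ^ 2 := by
      rw [mul_pow, sq_abs, mul_pow]
      nlinarith [mul_le_mul hf2 hf2' zero_le_one (by positivity)]
    exact (sq_le_sq₀ zero_le_one (by positivity)).1 this
  calc |V x - V' x| ≤ |V x - V' x| * (n * |f x * f' x|) := le_mul_of_one_le_right (abs_nonneg _) k4
    _ = |V x - V' x| * |f x * f' x| * n := by ring
    _ ≤ _ := by gcongr

/-- A resonance persists, with a larger error, under small changes of potential and energy, and
its approximate eigenvector is not small somewhere. -/
theorem IsResonant.exists_mem_resonantAt {γ : ℝ} {B : Finset (Fin d → ℤ)} {E E' δ : ℝ}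
    {V V' : (Fin d → ℤ) → ℝ} (h : IsResonant γ V B E δ)
    (hV : ∀ y ∈ B, |V y - V' y| ≤ δ) (hE : |E - E'| ≤ δ) :
    ∃ x ∈ B, V' ∈ resonantAt γ B x E' (3 * δ) := by
  obtain ⟨f, hf0, hf1, hf3⟩ := h
  obtain ⟨x, hx, hfx⟩ : ∃ x ∈ B, 1 ≤ B.card * f x ^ 2 := by
    by_contra! hlt
    have hne : B.Nonempty := by
      by_contra hB
      rw [Finset.not_nonempty_iff_eq_empty] at hB
      simp [hB] at hf1
    have h1 : ∑ x ∈ B, (B.card : ℝ) * f x ^ 2 < ∑ x ∈ B, (1 : ℝ) := Finset.sum_lt_sum_of_nonempty hne hlt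
    rw [← Finset.mul_sum, hf1] at h1
    simp at h1
  refine ⟨x, hx, f, hf0, hf1, hfx, ?_⟩
  -- Splitting with weights 3 and 3/2 makes the total `3 δ ^ 2 + 6 δ ^ 2 = (3 δ) ^ 2`.
  have hterm : ∀ y ∈ B, (hopping γ V' f y - E' * f y) ^ 2 ≤
      3 * (hopping γ V f y - E * f y) ^ 2 + 3 / 2 * ((4 * δ ^ 2) * f y ^ 2) := by
    intro y hy
    have e : hopping γ V' f y - E' * f y = (hopping γ V f y - E * f y) +
        ((V' y - V y) + (E - E')) * f y := by
      simp only [hopping]; ring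
    rw [e]
    set a := hopping γ V f y - E * f y
    set b := ((V' y - V y) + (E - E')) with hb
    have hb2 : b ^ 2 ≤ 4 * δ ^ 2 := by
      have hb1 : |b| ≤ 2 * δ := by
        have := hV y hy
        rw [abs_sub_comm] at this
        exact (abs_add_le _ _).trans (by linarith)
      calc b ^ 2 = |b| ^ 2 := (sq_abs b).symm
        _ ≤ (2 * δ) ^ 2 := by gcongr
        _ = _ := by ring
    have := mul_le_mul_of_nonneg_right hb2 (sq_nonneg (f y))
    nlinarith [sq_nonneg (2 * a - b * f y)]
  calc _ ≤ ∑ y ∈ B, (3 * (hopping γ V f y - E * f y) ^ 2 + 3 / 2 * ((4 * δ ^ 2) * f y ^ 2)) :=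
        Finset.sum_le_sum hterm
    _ = 3 * ∑ y ∈ B, (hopping γ V f y - E * f y) ^ 2 + 6 * δ ^ 2 := by
        rw [Finset.sum_add_distrib, ← Finset.mul_sum, ← Finset.mul_sum, ← Finset.mul_sum, hf1]; ring
    _ ≤ _ := by nlinarith

/-- Resonances occur only at energies in a bounded range. -/
theorem IsResonant.abs_le {γ : ℝ} {B : Finset (Fin d → ℤ)} {E δ K : ℝ} {V : (Fin d → ℤ) → ℝ}
    (hγ : 0 ≤ γ) (hγd : 2 * d * γ ≤ 1) (hδ : 0 ≤ δ) (hδ1 : δ ≤ 1) (hV : ∀ y, |V y| ≤ K)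
    (h : IsResonant γ V B E δ) : |E| ≤ K + 1 + B.card := by
  obtain ⟨f, hf0, hf1, hf3⟩ := h
  have hne : B.Nonempty := by
    by_contra hB
    rw [Finset.not_nonempty_iff_eq_empty] at hB
    simp [hB] at hf1
  -- At a maximum of `|f|` the hopping term is at most `2 d γ |f x|`, and `n |f x| ≥ 1` absorbs the
  -- error `δ`.
  obtain ⟨x, hx, hmax⟩ := B.exists_max_image (fun x => |f x|) hne
  set n : ℝ := ((B.card : ℕ) : ℝ) with hn
  have hn1 : 1 ≤ n := Nat.one_le_cast.2 (Finset.card_pos.2 hne)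
  have hfx : 1 ≤ n * |f x| := by
    have h1 : (1 : ℝ) ≤ n * |f x| ^ 2 := by
      calc (1 : ℝ) = ∑ y ∈ B, f y ^ 2 := hf1.symm
        _ ≤ B.card • |f x| ^ 2 := by
            refine Finset.sum_le_card_nsmul _ _ _ fun y hy => ?_
            rw [← sq_abs]
            exact pow_le_pow_left₀ (abs_nonneg _) (hmax y hy) 2
        _ = _ := by simp [hn]
    have h2 : |f x| ≤ 1 := by
      have : f x ^ 2 ≤ 1 := by
        rw [← hf1]
        exact Finset.single_le_sum (f := fun y => f y ^ 2) (fun _ _ => sq_nonneg _) hx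
      exact (sq_le_one_iff_abs_le_one _).1 this
    nlinarith [abs_nonneg (f x)]
  have hfpos : 0 < |f x| := by
    by_contra! h0
    nlinarith [abs_nonneg (f x)]
  have h1 : |hopping γ V f x - E * f x| ≤ δ := by
    have : (hopping γ V f x - E * f x) ^ 2 ≤ δ ^ 2 :=
      (Finset.single_le_sum (f := fun y => (hopping γ V f y - E * f y) ^ 2)
        (fun _ _ => sq_nonneg _) hx).trans hf3
    exact abs_le_of_sq_le_sq this hδ
  have h2 : |neighborSum f x| ≤ 2 * d * |f x| := abs_neighborSum_le fun w _ => by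
    by_cases hw : w ∈ B
    · exact hmax w hw
    · simp [hf0 w hw]
  have h3 : |E| * |f x| ≤ (K + 1 + n) * |f x| := by
    calc |E| * |f x| = |γ * neighborSum f x + V x * f x - (hopping γ V f x - E * f x)| := by
          rw [← abs_mul]; congr 1; simp only [hopping]; ring
      _ ≤ |γ * neighborSum f x| + |V x * f x| + |hopping γ V f x - E * f x| :=
          (abs_sub _ _).trans (by gcongr; exact abs_add_le _ _)
      _ ≤ γ * (2 * d * |f x|) + K * |f x| + δ := by
          rw [abs_mul, abs_of_nonneg hγ, abs_mul]
          have := hV x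
          gcongr
      _ ≤ _ := by nlinarith
  exact le_of_mul_le_mul_right h3 hfpos

end Wegner

/-! ### Conditional densities and short intervals -/

section Conditioning

/-- Given `Y`, the random variable `X` falls into sets of diameter at most `ℓ` with probability
at most `D ℓ` when its conditional density is bounded by `D`. -/
theorem measure_inter_le_of_condDistrib {Θ 𝒴 : Type*} [MeasurableSpace Θ] [MeasurableSpace 𝒴]
    {P : Measure Θ} [IsProbabilityMeasure P] {Y : Θ → 𝒴} {X : Θ → ℝ} (hY : Measurable Y)
    (hX : Measurable X) {D ℓ : ℝ} (hD : 0 ≤ D)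
    (h : ∀ᵐ θ ∂P, ∃ p : ℝ → ℝ≥0∞, Measurable p ∧ condDistrib X Y P (Y θ) = volume.withDensity p ∧
      ∀ t, p t ≤ ENNReal.ofReal D)
    {A : Set 𝒴} (hA : MeasurableSet A) {S : Set (𝒴 × ℝ)} (hS : MeasurableSet S)
    (hdiam : ∀ y t t', (y, t) ∈ S → (y, t') ∈ S → |t - t'| ≤ ℓ) :
    P {θ | Y θ ∈ A ∧ (Y θ, X θ) ∈ S} ≤ ENNReal.ofReal (D * ℓ) * P {θ | Y θ ∈ A} := by
  set κ := condDistrib X Y P with hκ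
  have hmeas : Measurable fun y => κ y (Prod.mk y ⁻¹' S) := Kernel.measurable_kernel_prodMk_left hS
  have hae : ∀ᵐ y ∂P.map Y, κ y (Prod.mk y ⁻¹' S) ≤ ENNReal.ofReal (D * ℓ) := by
    rw [ae_map_iff hY.aemeasurable (measurableSet_le hmeas measurable_const)]
    filter_upwards [h] with θ ⟨p, hp, hκp, hpD⟩
    rw [hκp]
    have hvol : volume (Prod.mk (Y θ) ⁻¹' S) ≤ ENNReal.ofReal ℓ := by
      refine (Real.volume_le_diam _).trans (Metric.ediam_le fun t ht t' ht' => ?_)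
      rw [edist_dist, Real.dist_eq]
      exact ENNReal.ofReal_le_ofReal (hdiam _ _ _ ht ht')
    rw [withDensity_apply _ (measurable_prodMk_left hS)]
    calc _ ≤ ∫⁻ _ in Prod.mk (Y θ) ⁻¹' S, ENNReal.ofReal D := lintegral_mono hpD
      _ = ENNReal.ofReal D * volume (Prod.mk (Y θ) ⁻¹' S) := setLIntegral_const _ _
      _ ≤ ENNReal.ofReal D * ENNReal.ofReal ℓ := by gcongr
      _ = _ := (ENNReal.ofReal_mul hD).symm
  have hset : MeasurableSet ((Prod.fst ⁻¹' A) ∩ S) := (measurable_fst hA).inter hS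
  -- Disintegration: the joint law of `(Y, X)` is the law of `Y` composed with the conditional
  -- distribution.
  have h1 : P {θ | Y θ ∈ A ∧ (Y θ, X θ) ∈ S} = (P.map Y ⊗ₘ κ) ((Prod.fst ⁻¹' A) ∩ S) := by
    rw [hκ, compProd_map_condDistrib hX.aemeasurable, Measure.map_apply (hY.prodMk hX) hset]
    rfl
  rw [h1, Measure.compProd_apply hset]
  have h2 : ∀ y, κ y (Prod.mk y ⁻¹' ((Prod.fst ⁻¹' A) ∩ S)) =
      A.indicator (fun y => κ y (Prod.mk y ⁻¹' S)) y := by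
    intro y
    by_cases hy : y ∈ A
    · rw [Set.indicator_of_mem hy]
      congr 1
      ext t
      simp [hy]
    · rw [Set.indicator_of_notMem hy]
      convert measure_empty (μ := κ y)
      ext t
      simp [hy]
  simp_rw [h2]
  rw [lintegral_indicator hA]
  calc _ ≤ ∫⁻ _ in A, ENNReal.ofReal (D * ℓ) ∂P.map Y :=
        lintegral_mono_ae (ae_restrict_of_ae hae)
    _ = ENNReal.ofReal (D * ℓ) * P.map Y A := setLIntegral_const _ _
    _ = _ := by rw [Measure.map_apply hY hA]; rfl

end Conditioning

/-! ### Product bounds for random fields -/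

section Fields

/-- The random field `X` has conditional distributions, at each site of `F` given the other sites
of `F`, with densities at most `D`. -/
def CondDensityBound {Θ ι : Type*} [MeasurableSpace Θ] (P : Measure Θ) (X : Θ → ι → ℝ)
    (F : Finset ι) (D : ℝ) : Prop :=
  ∀ x ∈ F, ∀ A S : Set (ι → ℝ), MeasurableSet A → MeasurableSet S →
    (∀ f f' : ι → ℝ, (∀ y ∈ F, y ≠ x → f y = f' y) → f ∈ A → f' ∈ A) →
    (∀ f f' : ι → ℝ, (∀ y ∈ F, f y = f' y) → f ∈ S → f' ∈ S) →
    ∀ ℓ : ℝ, (∀ f ∈ S, ∀ f' ∈ S, (∀ y ∈ F, y ≠ x → f y = f' y) → |f x - f' x| ≤ ℓ) →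
    P {θ | X θ ∈ A ∧ X θ ∈ S} ≤ ENNReal.ofReal (D * ℓ) * P {θ | X θ ∈ A}

/-- The other sites of `F` lie at distance at least `ε` from `τ x`, so their values are functions of
the conditioning variable `Y`. Conditioning on all of `Y` gives more information than on `F` alone,
and the bound survives averaging. The map `G` rebuilds the field on `F` from `Y` and the value at
`x`; off `F` it is 0, which no event sees. -/
theorem condDensityBound_of_condLaw {ι Ω Θ : Type*} [MetricSpace Ω] [MeasurableSpace Θ]
    {P : Measure Θ} [IsProbabilityMeasure P] {v : Ω → Θ → ℝ} (hv : ∀ ω, Measurable (v ω))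
    {τ : ι → Ω} {F : Finset ι} {ε D : ℝ} (hD : 0 ≤ D)
    (hsep : ∀ x ∈ F, ∀ y ∈ F, y ≠ x → ε ≤ dist (τ y) (τ x))
    (h : ∀ ω, ∀ᵐ θ ∂P, ∃ p : ℝ → ℝ≥0∞, Measurable p ∧
      condLaw P v ω ε (fun ω' : {ω' : Ω // ε ≤ dist ω' ω} => v ω' θ) = volume.withDensity p ∧
      ∀ t : ℝ, p t ≤ ENNReal.ofReal D) :
    CondDensityBound P (fun θ x => v (τ x) θ) F D := by
  classical
  intro x hx A S hA hS hAdep hSdep ℓ hdiam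
  let Y : Θ → {ω' : Ω // ε ≤ dist ω' (τ x)} → ℝ := fun θ ω' => v ω' θ
  have hY : Measurable Y := measurable_pi_lambda _ fun ω' => hv _
  let G : ({ω' : Ω // ε ≤ dist ω' (τ x)} → ℝ) × ℝ → ι → ℝ := fun q y =>
    if hy : y ∈ F ∧ y ≠ x then q.1 ⟨τ y, hsep x hx y hy.1 hy.2⟩ else if y = x then q.2 else 0
  have hG : Measurable G := by
    refine measurable_pi_lambda _ fun y => ?_
    by_cases hy : y ∈ F ∧ y ≠ x
    · simp only [G, hy, dif_pos, ne_eq, not_false_eq_true, and_self]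
      exact (measurable_pi_apply _).comp measurable_fst
    · by_cases hyx : y = x
      · simp only [G, hyx, ne_eq, not_true_eq_false, and_false, dif_neg, not_false_eq_true, if_true]
        exact measurable_snd
      · simp only [G, hy, dif_neg, not_false_eq_true, hyx, if_false]
        exact measurable_const
  have hGx : ∀ q, G q x = q.2 := fun q => by simp [G]
  have hGy : ∀ θ t, ∀ y ∈ F, y ≠ x → G (Y θ, t) y = v (τ y) θ := fun θ t y hy hyx => by
    simp [G, hy, hyx, Y]
  have hGeq : ∀ η t t', ∀ y ∈ F, y ≠ x → G (η, t) y = G (η, t') y := fun η t t' y hy hyx => by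
    simp [G, hy, hyx]
  have hGθ : ∀ θ, ∀ y ∈ F, G (Y θ, v (τ x) θ) y = v (τ y) θ := fun θ y hy => by
    by_cases hyx : y = x
    · rw [hyx, hGx]
    · exact hGy θ _ y hy hyx
  have hmain := measure_inter_le_of_condDistrib (P := P) hY (hv (τ x)) hD (h (τ x))
    (A := {η | G (η, 0) ∈ A}) (hG.comp (measurable_id.prodMk measurable_const) hA)
    (S := G ⁻¹' S) (hG hS) (ℓ := ℓ) (fun η t t' ht ht' => by
      have := hdiam _ ht _ ht' (hGeq η t t')
      rwa [hGx, hGx] at this)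
  have e1 : ∀ θ, (Y θ ∈ {η | G (η, 0) ∈ A}) ↔ (fun x => v (τ x) θ) ∈ A := fun θ =>
    ⟨hAdep _ _ (hGy θ 0), hAdep _ _ fun y hy hyx => (hGy θ 0 y hy hyx).symm⟩
  have e2 : ∀ θ, ((Y θ, v (τ x) θ) ∈ G ⁻¹' S) ↔ (fun x => v (τ x) θ) ∈ S := fun θ =>
    ⟨hSdep _ _ (hGθ θ), hSdep _ _ fun y hy => (hGθ θ y hy).symm⟩
  simp only [e1, e2] at hmain
  exact hmain

/-- Events attached to disjoint sets of sites, each confining the field at one site to a short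
interval, have a joint probability that is bounded by a product. -/
theorem CondDensityBound.measure_forall_le {Θ ι : Type*} [MeasurableSpace Θ] {P : Measure Θ}
    [IsProbabilityMeasure P] {X : Θ → ι → ℝ} {F : Finset ι} {D ℓ : ℝ}
    (h : CondDensityBound P X F D) {p : ℕ} (B : Fin p → Finset ι) (x : Fin p → ι)
    (S : Fin p → Set (ι → ℝ)) (hx : ∀ i, x i ∈ B i) (hB : ∀ i, B i ⊆ F)
    (hdisj : ∀ i j, i ≠ j → ∀ y ∈ B i, y ∉ B j) (hS : ∀ i, MeasurableSet (S i))
    (hSdep : ∀ i, ∀ f f' : ι → ℝ, (∀ y ∈ B i, f y = f' y) → f ∈ S i → f' ∈ S i)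
    (hdiam : ∀ i, ∀ f ∈ S i, ∀ f' ∈ S i, (∀ y ∈ B i, y ≠ x i → f y = f' y) →
      |f (x i) - f' (x i)| ≤ ℓ) :
    P {θ | ∀ i, X θ ∈ S i} ≤ ENNReal.ofReal (D * ℓ) ^ p := by
  induction p with
  | zero => simp
  | succ p ih =>
    have h1 := ih (fun i => B i.succ) (fun i => x i.succ) (fun i => S i.succ)
      (fun i => hx _) (fun i => hB _) (fun i j hij => hdisj _ _ (by simpa using hij))
      (fun i => hS _) (fun i => hSdep _) (fun i => hdiam _)
    -- Peel off one event: the remaining ones do not involve the site `x 0`, because the blocks are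
    -- disjoint.
    have h2 := h (x 0) (hB 0 (hx 0)) {f | ∀ i : Fin p, f ∈ S i.succ} (S 0)
      (by
        simp only [Set.ofPred_forall]
        exact MeasurableSet.iInter fun i => hS _) (hS 0)
      (fun f f' hff' hf i => hSdep _ f f' (fun y hy => hff' y (hB _ hy) fun hyx =>
        hdisj 0 i.succ (Fin.succ_ne_zero i).symm (x 0) (hx 0) (hyx ▸ hy)) (hf i))
      (fun f f' hff' hf => hSdep 0 f f' (fun y hy => hff' y (hB 0 hy)) hf) ℓ
      (fun f hf f' hf' hff' => hdiam 0 f hf f' hf' fun y hy => hff' y (hB 0 hy))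
    have h3 : {θ | ∀ i, X θ ∈ S i} = {θ | X θ ∈ {f | ∀ i : Fin p, f ∈ S i.succ} ∧ X θ ∈ S 0} := by
      ext θ
      simp only [Set.mem_ofPred_eq, Fin.forall_fin_succ]
      exact and_comm
    rw [h3, pow_succ']
    exact h2.trans (mul_le_mul_right h1 _)

end Fields

/-! ### Probability of several separated resonances -/

section Events

variable {d : ℕ}

open Classical in
/-- The possible locations of `p` well separated resonant balls with marked sites. -/
noncomputable def resTuples (d J s p : ℕ) : Finset (Fin p → (Fin d → ℤ) × ℕ × (Fin d → ℤ)) :=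
  (Fintype.piFinset fun _ => latticeBall 0 (window s) ×ˢ Finset.range (resRadius J s + 1) ×ˢ
    latticeBall 0 (window s + resRadius J s)).filter fun t =>
      (∀ i, (t i).2.2 ∈ latticeBall (t i).1 (t i).2.1) ∧
      ∀ i j, i ≠ j → 2 * resRadius J s < latticeNorm ((t i).1 - (t j).1)

/-- The potentials with `p` well separated resonances of scale `s` and width `δ` at energy `E`. -/
def resEvent (γ : ℝ) (J s p : ℕ) (E δ : ℝ) : Set ((Fin d → ℤ) → ℝ) :=
  ⋃ t ∈ resTuples d J s p,
    {V | ∀ i, V ∈ resonantAt γ (latticeBall (t i).1 (t i).2.1) (t i).2.2 E δ}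

/-- The number of steps of the energy grid, on either side of `0`. -/
noncomputable def gridSize (d : ℕ) (σ K : ℝ) (s : ℕ) : ℕ :=
  ⌈(K + 1 + (2 * window s) ^ d) / tol σ s⌉₊

/-- The potentials with `p` well separated resonances of scale `s` at some energy of the grid. -/
def gridEvent (γ : ℝ) (J : ℕ) (σ K : ℝ) (s p : ℕ) : Set ((Fin d → ℤ) → ℝ) :=
  ⋃ j ∈ Finset.Icc (-(gridSize d σ K s : ℤ)) (gridSize d σ K s),
    resEvent γ J s p (j * tol σ s) (3 * tol σ s)

theorem measurableSet_resEvent (γ : ℝ) (J s p : ℕ) (E δ : ℝ) :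
    MeasurableSet (resEvent γ J s p E δ : Set ((Fin d → ℤ) → ℝ)) := by
  refine Finset.measurableSet_biUnion _ fun t _ => ?_
  simp only [Set.ofPred_forall]
  exact MeasurableSet.iInter fun i => measurableSet_resonantAt _ _ _ _ _

theorem measurableSet_gridEvent (γ : ℝ) (J : ℕ) (σ K : ℝ) (s p : ℕ) :
    MeasurableSet (gridEvent γ J σ K s p : Set ((Fin d → ℤ) → ℝ)) :=
  Finset.measurableSet_biUnion _ fun _ _ => measurableSet_resEvent _ _ _ _ _ _

theorem card_resTuples_le (d J s p : ℕ) :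
    (resTuples d J s p).card ≤ ((latticeBall (0 : Fin d → ℤ) (window s)).card *
      ((resRadius J s + 1) * (latticeBall (0 : Fin d → ℤ) (window s + resRadius J s)).card)) ^ p := by
  classical
  refine (Finset.card_filter_le _ _).trans ?_
  rw [Fintype.card_piFinset]
  simp [Finset.card_product]

/-- Approximate resonances of a nearby potential are detected by the grid. -/
theorem SeparatedResonances.mem_gridEvent {γ : ℝ} {J : ℕ} {σ K E : ℝ} {s p : ℕ} (hp : p ≠ 0)
    (hγ : 0 ≤ γ) (hγd : 2 * d * γ ≤ 1) (hRM : resRadius J s + 1 ≤ window s)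
    {V V' : (Fin d → ℤ) → ℝ} (hV : ∀ y, |V y| ≤ K)
    (hVV' : ∀ y ∈ latticeBall 0 (2 * window s), |V y - V' y| ≤ tol σ s)
    (h : SeparatedResonances γ V J σ s p E) : V' ∈ gridEvent γ J σ K s p := by
  classical
  obtain ⟨u, hu, hsep, hres⟩ := h
  choose r hr hres using hres
  have htol := tol_pos σ s
  have hball : ∀ i, ∀ y ∈ latticeBall (u i) (r i), latticeNorm y ≤ window s + resRadius J s := by
    intro i y hy
    have h1 := hu i
    rw [mem_latticeBall] at hy h1
    have h2 := latticeNorm_sub_le y (u i) 0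
    have h3 := hr i
    rw [sub_zero] at h1
    rw [sub_zero, sub_zero] at h2
    omega
  have hE : |E| ≤ K + 1 + (2 * (window s : ℝ)) ^ d := by
    have h1 := (hres ⟨0, Nat.pos_of_ne_zero hp⟩).abs_le hγ hγd htol.le (tol_le_one _ _) hV
    refine h1.trans ?_
    gcongr
    have h2 := (card_latticeBall_le (u ⟨0, Nat.pos_of_ne_zero hp⟩) (r ⟨0, Nat.pos_of_ne_zero hp⟩))
    have h3 := hr ⟨0, Nat.pos_of_ne_zero hp⟩
    have h4 : (2 * r ⟨0, Nat.pos_of_ne_zero hp⟩ + 1) ^ d ≤ (2 * window s) ^ d :=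
      Nat.pow_le_pow_left (by omega) d
    exact_mod_cast h2.trans h4
  obtain ⟨j, hj, hjE⟩ : ∃ j ∈ Finset.Icc (-(gridSize d σ K s : ℤ)) (gridSize d σ K s),
      |E - j * tol σ s| ≤ tol σ s := by
    have hN : |E| / tol σ s ≤ gridSize d σ K s :=
      (div_le_div_of_nonneg_right hE htol.le).trans (Nat.le_ceil _)
    rw [div_le_iff₀ htol] at hN
    obtain ⟨hN1, hN2⟩ := abs_le.1 hN
    have hfl := Int.floor_le (E / tol σ s)
    have hfl2 := Int.lt_floor_add_one (E / tol σ s)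
    rw [le_div_iff₀ htol] at hfl
    rw [div_lt_iff₀ htol] at hfl2
    refine ⟨⌊E / tol σ s⌋, ?_, ?_⟩
    · rw [Finset.mem_Icc]
      constructor
      · rw [Int.le_floor, le_div_iff₀ htol]
        push_cast
        linarith
      · have : ((⌊E / tol σ s⌋ : ℤ) : ℝ) ≤ gridSize d σ K s := by
          refine (Int.floor_le _).trans ?_
          rw [div_le_iff₀ htol]
          linarith
        exact_mod_cast this
    · rw [abs_le]
      constructor <;> nlinarith
  have hx : ∀ i, ∃ x ∈ latticeBall (u i) (r i),
      V' ∈ resonantAt γ (latticeBall (u i) (r i)) x (j * tol σ s) (3 * tol σ s) := fun i =>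
    (hres i).exists_mem_resonantAt (fun y hy => hVV' y (by
      rw [mem_latticeBall, sub_zero]
      have := hball i y hy
      omega)) hjE
  choose x hxB hxV using hx
  refine Set.mem_biUnion hj (Set.mem_biUnion (x := fun i => (u i, r i, x i)) ?_ hxV)
  simp only [resTuples, Finset.coe_filter, Set.mem_ofPred_eq, Fintype.mem_piFinset,
    Finset.mem_product, Finset.mem_range]
  refine ⟨fun i => ⟨hu i, Nat.lt_succ_of_le (hr i), ?_⟩, hxB, hsep⟩
  rw [mem_latticeBall, sub_zero]
  exact hball i _ (hxB i)

/-- The probability of well separated resonances at a given energy. -/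
theorem measure_resEvent_le {Θ : Type*} [MeasurableSpace Θ] {P : Measure Θ}
    [IsProbabilityMeasure P] {X : Θ → (Fin d → ℤ) → ℝ} {D : ℝ} (hD : 0 ≤ D) {J s : ℕ}
    (hRM : resRadius J s + 1 ≤ window s)
    (h : CondDensityBound P X (latticeBall 0 (2 * window s)) D) (γ : ℝ) (p : ℕ) (E : ℝ) {δ : ℝ}
    (hδ : 0 ≤ δ) :
    P {θ | X θ ∈ resEvent γ J s p E δ} ≤
      ENNReal.ofReal ((2 * 30 ^ d * (window s : ℝ) ^ (3 * d + 1) * D * δ) ^ p) := by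
  set M := window s with hM
  have hM1 : 1 ≤ M := one_le_window s
  set R := resRadius J s with hR
  have hMr : (1 : ℝ) ≤ M := by exact_mod_cast hM1
  have hone : ∀ t ∈ resTuples d J s p,
      P {θ | ∀ i, X θ ∈ resonantAt γ (latticeBall (t i).1 (t i).2.1) (t i).2.2 E δ} ≤
        ENNReal.ofReal (D * (2 * δ * (2 * M) ^ d)) ^ p := by
    intro t ht
    simp only [resTuples, Finset.mem_filter, Fintype.mem_piFinset, Finset.mem_product,
      Finset.mem_range] at ht
    obtain ⟨ht1, ht2, ht3⟩ := ht
    refine h.measure_forall_le (fun i => latticeBall (t i).1 (t i).2.1) (fun i => (t i).2.2)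
      (fun i => resonantAt γ (latticeBall (t i).1 (t i).2.1) (t i).2.2 E δ) ht2 ?_ ?_
      (fun i => measurableSet_resonantAt _ _ _ _ _) (fun i f f' hff' => (resonantAt_congr hff').1)
      fun i f hf f' hf' hff' => ?_
    · intro i y hy
      have h1 := (ht1 i).1
      have h2 := (ht1 i).2.1
      rw [mem_latticeBall] at hy h1 ⊢
      have := latticeNorm_sub_le y (t i).1 0
      omega
    -- Centres more than twice the largest radius apart have disjoint balls.
    · intro i j hij y hyi hyj
      have h1 := (ht1 i).2.1
      have h2 := (ht1 j).2.1
      rw [mem_latticeBall] at hyi hyj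
      have h3 := latticeNorm_sub_le (t i).1 y (t j).1
      rw [latticeNorm_sub_comm _ y] at h3
      have := ht3 i j hij
      omega
    · refine (abs_sub_le_of_mem_resonantAt hδ (ht2 i) hff' hf hf').trans ?_
      gcongr
      have h1 := (ht1 i).2.1
      have h2 := card_latticeBall_le (t i).1 (t i).2.1
      have h3 : (2 * (t i).2.1 + 1) ^ d ≤ (2 * M) ^ d := Nat.pow_le_pow_left (by omega) d
      exact_mod_cast h2.trans h3
  -- Per resonance there are at most `(3 M) ^ d` centres, `M` radii and `(5 M) ^ d` marked sites.
  -- With the ball size `(2 M) ^ d` of the one-site estimate this produces `30 ^ d M ^ (3 d + 1)`.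
  have hcard : ((resTuples d J s p).card : ℝ) ≤ ((3 * (M : ℝ)) ^ d * (M * (5 * M) ^ d)) ^ p := by
    have h1 := card_resTuples_le d J s p
    have h2 := card_latticeBall_le (0 : Fin d → ℤ) M
    have h3 := card_latticeBall_le (0 : Fin d → ℤ) (M + R)
    have h4 : (2 * M + 1) ^ d ≤ (3 * M) ^ d := Nat.pow_le_pow_left (by omega) d
    have h5 : (2 * (M + R) + 1) ^ d ≤ (5 * M) ^ d := Nat.pow_le_pow_left (by omega) d
    have h6 : (resTuples d J s p).card ≤ ((3 * M) ^ d * (M * (5 * M) ^ d)) ^ p :=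
      h1.trans (Nat.pow_le_pow_left (Nat.mul_le_mul (h2.trans h4)
        (Nat.mul_le_mul hRM (h3.trans h5))) p)
    exact_mod_cast h6
  calc P {θ | X θ ∈ resEvent γ J s p E δ}
      ≤ ∑ t ∈ resTuples d J s p,
        P {θ | ∀ i, X θ ∈ resonantAt γ (latticeBall (t i).1 (t i).2.1) (t i).2.2 E δ} := by
        refine le_trans (measure_mono ?_) (measure_biUnion_finset_le _ _)
        intro θ hθ
        simpa [resEvent] using hθ
    _ ≤ (resTuples d J s p).card • ENNReal.ofReal (D * (2 * δ * (2 * M) ^ d)) ^ p :=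
        Finset.sum_le_card_nsmul _ _ _ hone
    _ = ENNReal.ofReal ((resTuples d J s p).card * (D * (2 * δ * (2 * M) ^ d)) ^ p) := by
        rw [nsmul_eq_mul, ENNReal.ofReal_mul (Nat.cast_nonneg _), ENNReal.ofReal_natCast,
          ENNReal.ofReal_pow (by positivity)]
    _ ≤ ENNReal.ofReal (((3 * (M : ℝ)) ^ d * (M * (5 * M) ^ d)) ^ p *
          (D * (2 * δ * (2 * M) ^ d)) ^ p) := by gcongr
    _ = _ := by
        rw [← mul_pow]
        congr 2
        rw [show (30 : ℝ) ^ d = 3 ^ d * 5 ^ d * 2 ^ d by rw [← mul_pow, ← mul_pow]; norm_num]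
        ring

/-- The probability of well separated resonances at some energy. -/
theorem measure_gridEvent_le {Θ : Type*} [MeasurableSpace Θ] {P : Measure Θ}
    [IsProbabilityMeasure P] {X : Θ → (Fin d → ℤ) → ℝ} {D : ℝ} (hD : 0 ≤ D) {J s : ℕ}
    (hRM : resRadius J s + 1 ≤ window s)
    (h : CondDensityBound P X (latticeBall 0 (2 * window s)) D) (γ : ℝ) (p : ℕ) {σ K : ℝ}
    (hK : 0 ≤ K) :
    P {θ | X θ ∈ gridEvent γ J σ K s p} ≤
      ENNReal.ofReal ((2 * K + 5 + 2 * 2 ^ d) * (window s : ℝ) ^ d / tol σ s *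
        (6 * 30 ^ d * (window s : ℝ) ^ (3 * d + 1) * D * tol σ s) ^ p) := by
  set M := window s with hM
  have hMr : (1 : ℝ) ≤ M := by exact_mod_cast one_le_window s
  have htol := tol_pos σ s
  have htol1 := tol_le_one σ s
  set N := gridSize d σ K s with hN
  have hcard : (((Finset.Icc (-(N : ℤ)) N).card : ℕ) : ℝ) ≤
      (2 * K + 5 + 2 * 2 ^ d) * (M : ℝ) ^ d / tol σ s := by
    have h1 : (Finset.Icc (-(N : ℤ)) N).card = 2 * N + 1 := by rw [Int.card_Icc]; omega
    have h2 : (N : ℝ) < (K + 1 + (2 * M) ^ d) / tol σ s + 1 :=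
      Nat.ceil_lt_add_one (by positivity)
    rw [h1, le_div_iff₀ htol]
    have h3 : (N : ℝ) * tol σ s ≤ K + 1 + (2 * M) ^ d + tol σ s := by
      calc (N : ℝ) * tol σ s ≤ ((K + 1 + (2 * M) ^ d) / tol σ s + 1) * tol σ s := by gcongr
        _ = _ := by field_simp
    have h4 : (1 : ℝ) ≤ (M : ℝ) ^ d := one_le_pow₀ hMr
    rw [mul_pow] at h3
    push_cast
    nlinarith
  calc P {θ | X θ ∈ gridEvent γ J σ K s p}
      ≤ ∑ j ∈ Finset.Icc (-(N : ℤ)) N,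
        P {θ | X θ ∈ resEvent γ J s p (j * tol σ s) (3 * tol σ s)} := by
        refine le_trans (measure_mono ?_) (measure_biUnion_finset_le _ _)
        intro θ hθ
        simpa only [gridEvent, Set.mem_iUnion, Set.mem_ofPred_eq] using hθ
    _ ≤ (Finset.Icc (-(N : ℤ)) N).card •
          ENNReal.ofReal ((2 * 30 ^ d * (M : ℝ) ^ (3 * d + 1) * D * (3 * tol σ s)) ^ p) :=
        Finset.sum_le_card_nsmul _ _ _ fun j _ =>
          measure_resEvent_le hD hRM h γ p _ (by positivity)
    _ = ENNReal.ofReal ((Finset.Icc (-(N : ℤ)) N).card *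
          (2 * 30 ^ d * (M : ℝ) ^ (3 * d + 1) * D * (3 * tol σ s)) ^ p) := by
        rw [nsmul_eq_mul, ENNReal.ofReal_mul (Nat.cast_nonneg _), ENNReal.ofReal_natCast]
    _ ≤ ENNReal.ofReal ((2 * K + 5 + 2 * 2 ^ d) * (M : ℝ) ^ d / tol σ s *
          (2 * 30 ^ d * (M : ℝ) ^ (3 * d + 1) * D * (3 * tol σ s)) ^ p) := by gcongr
    _ = _ := by
        congr 3
        ring

end Events

/-! ### Densities along orbits; resonances against nets -/

section Estimates

theorem LargeScale.resRadius_lt {d J s : ℕ} {σ : ℝ} (h : LargeScale d J σ s) :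
    resRadius J s + 1 ≤ window s := by
  have h1 := h.J_lt
  have h2 := scale_pos s
  have h3 : scale (s + 1) ≤ scale (s + 2) := scale_strictMono.monotone (by omega)
  have h4 : 16 * J * scale s < scale (s + 1) := by
    rw [scale_succ]; exact Nat.mul_lt_mul_of_pos_right h1 h2
  unfold resRadius window
  have h5 : 16 * J * scale s = 2 * (8 * J * scale s) := by ring
  omega

/-- Along orbits, the conditional densities grow at most like a stretched exponential. -/
theorem exists_condDensityBound {d : ℕ} {Ω : Type*} [MetricSpace Ω] [AddAction (Fin d → ℤ) Ω]
    {Θ : Type*} [MeasurableSpace Θ] {P : Measure Θ} [IsProbabilityMeasure P]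
    {v : Ω → Θ → ℝ} {A η : ℝ} (hv : ∀ ω, Measurable (v ω)) (hUPA : UPA d Ω A) (hLIB : LIB P v η)
    (hAη : A * η < 1) :
    ∃ β : ℝ, 0 < β ∧ β < 1 ∧ ∃ C : ℝ, ∀ (ω : Ω) (s : ℕ),
      CondDensityBound P (fun θ (x : Fin d → ℤ) => v (x +ᵥ ω) θ) (latticeBall 0 (2 * window s))
        (Real.exp (C * (window s : ℝ) ^ β)) := by
  obtain ⟨c, hc, hUPA⟩ := hUPA
  obtain ⟨C, hC, ε₀, hε₀, hLIB⟩ := hLIB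
  -- The value 1/2 only keeps the exponent positive. The two terms of the constant cover the cases
  -- where `ε` is governed by `ε₀` and by (UPA).
  refine ⟨max (A * η) (1 / 2), lt_max_of_lt_right (by norm_num), max_lt hAη (by norm_num),
    C * (ε₀ ^ (-η) + c ^ (-η) * 4 ^ max (A * η) (1 / 2)), fun ω s => ?_⟩
  set β := max (A * η) (1 / 2) with hβ
  have hβ0 : 0 < β := lt_max_of_lt_right (by norm_num)
  set M : ℝ := ((window s : ℕ) : ℝ) with hM
  have hM1 : 1 ≤ M := Nat.one_le_cast.2 (one_le_window s)
  have hM0 : 0 < 4 * M := by linarith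
  set ε := min ε₀ (c * (4 * M) ^ (-A)) with hε
  have hε0 : 0 < ε := lt_min hε₀ (by positivity)
  refine condDensityBound_of_condLaw hv (τ := fun x : Fin d → ℤ => x +ᵥ ω) (ε := ε)
    (Real.exp_pos _).le ?_ ?_
  · intro x hx y hy hyx
    rw [mem_latticeBall, sub_zero] at hx hy
    have h1 : latticeNorm (y - x) ≤ 4 * window s := by
      have := latticeNorm_add_le y (-x)
      rw [latticeNorm_neg, ← sub_eq_add_neg] at this
      omega
    have h2 : 0 < latticeNorm (y - x) := by
      rw [Nat.pos_iff_ne_zero, Ne, latticeNorm_eq_zero, sub_eq_zero]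
      exact hyx
    have h3 := hUPA (4 * window s) (x +ᵥ ω) (y - x) h2 h1
    rw [vadd_vadd, sub_add_cancel] at h3
    refine (min_le_right _ _).trans ?_
    push_cast at h3
    exact h3
  · intro ω'
    filter_upwards [hLIB ε hε0 (min_le_left _ _) ω'] with θ ⟨p, hp, hlaw, hpb⟩
    refine ⟨p, hp, hlaw, fun t => (hpb t).trans (ENNReal.ofReal_le_ofReal ?_)⟩
    rw [Real.exp_le_exp, mul_assoc]
    refine mul_le_mul_of_nonneg_left ?_ hC.le
    have hMβ : 1 ≤ M ^ β := Real.one_le_rpow hM1 hβ0.le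
    have hbase : ε₀ ^ (-η) ≤ ε₀ ^ (-η) * M ^ β := le_mul_of_one_le_right (by positivity) hMβ
    have hsecond : 0 ≤ c ^ (-η) * 4 ^ β * M ^ β := by positivity
    rw [add_mul]
    rcases le_or_gt η 0 with hη | hη
    · have : ε ^ (-η) ≤ ε₀ ^ (-η) :=
        Real.rpow_le_rpow hε0.le (min_le_left _ _) (by linarith)
      linarith
    · rcases min_choice ε₀ (c * (4 * M) ^ (-A)) with h | h
      · rw [hε, h]; linarith
      · rw [hε, h, Real.mul_rpow hc.le (by positivity), ← Real.rpow_mul hM0.le, neg_mul_neg,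
          mul_assoc (c ^ (-η)), ← Real.mul_rpow (by norm_num) (by linarith)]
        have h1 : (4 * M) ^ (A * η) ≤ (4 * M) ^ β :=
          Real.rpow_le_rpow_of_exponent_le (by linarith) (le_max_left _ _)
        have h2 : c ^ (-η) * (4 * M) ^ (A * η) ≤ c ^ (-η) * (4 * M) ^ β := by gcongr
        have h3 : 0 ≤ ε₀ ^ (-η) * M ^ β := by positivity
        linarith

/-- The bound for the probability of `p` resonances beats the cardinality of a net when `p` is
large enough. -/
theorem eventually_gridBound_le (d p : ℕ) {β σ ν : ℝ} (hβ : 0 < β) (hβσ : β < σ)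
    (hp : 2 + ν ≤ p) (c cG c' c₁ a : ℝ) (hc : 0 ≤ c) (hcG : 0 ≤ cG) (hc' : 0 ≤ c') :
    ∀ᶠ s : ℕ in atTop, c * (window s : ℝ) ^ a * tol σ s ^ (-ν) *
      (cG * (window s : ℝ) ^ d / tol σ s *
        (c' * (window s : ℝ) ^ (3 * d + 1) * Real.exp (c₁ * (window s : ℝ) ^ β) * tol σ s) ^ p) ≤
      (1 / 2) ^ s := by
  filter_upwards [eventually_mul_tol_le hβ hβσ (c * cG * c' ^ p) (p * c₁)
    (a + d + (3 * d + 1) * p)] with s hs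
  refine le_trans ?_ hs
  have hM0 : (0 : ℝ) < window s := by exact_mod_cast one_le_window s
  set M : ℝ := ((window s : ℕ) : ℝ) with hM
  have ht := tol_pos σ s
  have ht1 := tol_le_one σ s
  set t := tol σ s with htdef
  have e1 : M ^ (a + d + (3 * d + 1) * p) = M ^ a * M ^ d * (M ^ (3 * d + 1)) ^ p := by
    rw [Real.rpow_add hM0, Real.rpow_add hM0, Real.rpow_natCast, ← pow_mul]
    congr 1
    rw [← Real.rpow_natCast]
    push_cast
    rfl
  have e2 : Real.exp (p * c₁ * M ^ β) = Real.exp (c₁ * M ^ β) ^ p := by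
    rw [← Real.exp_nat_mul, mul_assoc]
  -- Of the `p` powers of the tolerance, `ν` pay for the net and one for the energy grid; the last
  -- makes the bound small.
  have e3 : t ^ (-ν) / t * t ^ p ≤ t := by
    have h1 : t ^ (-ν) / t * t ^ p = t ^ (-ν - 1 + p) := by
      rw [Real.rpow_add ht, Real.rpow_sub ht, Real.rpow_one, Real.rpow_natCast]
    rw [h1]
    calc t ^ (-ν - 1 + p) ≤ t ^ (1 : ℝ) := Real.rpow_le_rpow_of_exponent_ge ht ht1 (by linarith)
      _ = t := Real.rpow_one t
  calc c * M ^ a * t ^ (-ν) * (cG * M ^ d / t *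
        (c' * M ^ (3 * d + 1) * Real.exp (c₁ * M ^ β) * t) ^ p)
      = (c * cG * c' ^ p * Real.exp (c₁ * M ^ β) ^ p * (M ^ a * M ^ d * (M ^ (3 * d + 1)) ^ p)) *
          (t ^ (-ν) / t * t ^ p) := by
        rw [mul_pow, mul_pow, mul_pow]; ring
    _ ≤ (c * cG * c' ^ p * Real.exp (c₁ * M ^ β) ^ p * (M ^ a * M ^ d * (M ^ (3 * d + 1)) ^ p)) *
          t := by gcongr
    _ = _ := by rw [e1, e2]

end Estimates

/-! ### Uniform bounds on the realisations -/

section Regularity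

variable {Ω Θ : Type*} [MetricSpace Ω]

theorem FiniteMetricDimension.secondCountableTopology (h : FiniteMetricDimension Ω) :
    SecondCountableTopology Ω := by
  obtain ⟨ν, _, C, _, h⟩ := h
  have htb : TotallyBounded (Set.univ : Set Ω) := by
    rw [Metric.totallyBounded_iff]
    intro ε hε
    obtain ⟨N, _, hN⟩ := h (min (ε / 2) 1) (lt_min (by linarith) one_pos) (min_le_right _ _)
    refine ⟨N, N.finite_toSet, fun ω _ => ?_⟩
    obtain ⟨ω', hω', hd⟩ := hN ω
    refine Set.mem_biUnion hω' ?_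
    rw [Metric.mem_ball]
    exact lt_of_le_of_lt (hd.trans (min_le_left _ _)) (by linarith)
  have : TopologicalSpace.SeparableSpace Ω :=
    TopologicalSpace.isSeparable_univ_iff.1 htb.isSeparable
  exact UniformSpace.secondCountable_of_separable Ω

/-- The parameters for which the process is bounded and Hölder continuous with constant `K`. -/
def boundedSet (v : Ω → Θ → ℝ) (κ : ℝ≥0) (K : ℕ) : Set Θ :=
  {θ | (∀ ω, |v ω θ| ≤ K) ∧ ∀ ω ω', |v ω θ - v ω' θ| ≤ K * dist ω ω' ^ (κ : ℝ)}

theorem boundedSet_mono (v : Ω → Θ → ℝ) (κ : ℝ≥0) : Monotone (boundedSet v κ) := by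
  intro K K' hK θ h
  have hK' : (K : ℝ) ≤ K' := by exact_mod_cast hK
  refine ⟨fun ω => (h.1 ω).trans hK', fun ω ω' => (h.2 ω ω').trans ?_⟩
  gcongr

variable [MeasurableSpace Θ]

theorem IsHolderProcess.abs_sub_le {v : Ω → Θ → ℝ} {κ : ℝ≥0} (hv : IsHolderProcess v κ) (θ : Θ) :
    ∃ K : ℝ≥0, ∀ ω ω', |v ω θ - v ω' θ| ≤ K * dist ω ω' ^ (κ : ℝ) := by
  obtain ⟨K, hK⟩ := hv.2 θ
  exact ⟨K, fun ω ω' => by rw [← Real.dist_eq]; exact hK.dist_le ω ω'⟩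

theorem IsHolderProcess.continuous {v : Ω → Θ → ℝ} {κ : ℝ≥0} (hκ : 0 < κ)
    (hv : IsHolderProcess v κ) (θ : Θ) : Continuous fun ω => v ω θ :=
  let ⟨_, hK⟩ := hv.2 θ
  hK.continuous hκ

/-- Realisations are continuous, so the conditions need only be tested on a countable dense set. -/
theorem measurableSet_boundedSet [SecondCountableTopology Ω] {v : Ω → Θ → ℝ} {κ : ℝ≥0}
    (hκ : 0 < κ) (hv : IsHolderProcess v κ) (K : ℕ) : MeasurableSet (boundedSet v κ K) := by
  obtain ⟨S, hSc, hSd⟩ := TopologicalSpace.exists_countable_dense Ω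
  have hκ' : (0 : ℝ) ≤ κ := κ.2
  have e : boundedSet v κ K = {θ | ∀ ω ∈ S, |v ω θ| ≤ K} ∩
      {θ | ∀ ω ∈ S, ∀ ω' ∈ S, |v ω θ - v ω' θ| ≤ K * dist ω ω' ^ (κ : ℝ)} := by
    ext θ
    have hcont := hv.continuous hκ θ
    refine ⟨fun h => ⟨fun ω _ => h.1 ω, fun ω _ ω' _ => h.2 ω ω'⟩, fun h => ⟨fun ω => ?_, ?_⟩⟩
    · have hcl : IsClosed {ω | |v ω θ| ≤ K} := isClosed_le hcont.abs continuous_const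
      exact closure_minimal (fun ω hω => h.1 ω hω) hcl (hSd ω)
    · have hcl : IsClosed {q : Ω × Ω | |v q.1 θ - v q.2 θ| ≤ K * dist q.1 q.2 ^ (κ : ℝ)} :=
        isClosed_le ((hcont.comp continuous_fst).sub (hcont.comp continuous_snd)).abs
          (continuous_const.mul (continuous_dist.rpow_const fun _ => Or.inr hκ'))
      intro ω ω'
      exact closure_minimal (s := S ×ˢ S) (fun q hq => h.2 _ hq.1 _ hq.2) hcl
        ((hSd.prod hSd) (ω, ω'))
  rw [e]
  refine MeasurableSet.inter ?_ ?_
  · simp only [Set.ofPred_forall]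
    exact MeasurableSet.biInter hSc fun ω _ =>
      measurableSet_le (hv.1 ω).abs measurable_const
  · simp only [Set.ofPred_forall]
    exact MeasurableSet.biInter hSc fun ω _ => MeasurableSet.biInter hSc fun ω' _ =>
      measurableSet_le ((hv.1 ω).sub (hv.1 ω')).abs measurable_const

/-- A realisation is bounded: its values on a finite 1-net control it up to the Hölder constant. -/
theorem iUnion_boundedSet (hΩ : FiniteMetricDimension Ω) {v : Ω → Θ → ℝ} {κ : ℝ≥0}
    (hv : IsHolderProcess v κ) : ⋃ K, boundedSet v κ K = Set.univ := by
  refine Set.eq_univ_of_forall fun θ => ?_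
  obtain ⟨K, hK⟩ := hv.abs_sub_le θ
  obtain ⟨ν, _, C, _, hnet⟩ := hΩ
  obtain ⟨N, _, hN⟩ := hnet 1 one_pos le_rfl
  obtain ⟨n, hn⟩ := exists_nat_ge ((∑ ω ∈ N, |v ω θ|) + K)
  have hsum : 0 ≤ ∑ ω ∈ N, |v ω θ| := Finset.sum_nonneg fun _ _ => abs_nonneg _
  refine Set.mem_iUnion.2 ⟨n, fun ω => ?_, fun ω ω' => (hK ω ω').trans ?_⟩
  · obtain ⟨ω', hω', hd⟩ := hN ω
    have h1 : |v ω θ - v ω' θ| ≤ K := by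
      refine (hK ω ω').trans (mul_le_of_le_one_right K.2 ?_)
      exact Real.rpow_le_one dist_nonneg hd κ.2
    have h2 : |v ω' θ| ≤ ∑ ω ∈ N, |v ω θ| :=
      Finset.single_le_sum (f := fun ω => |v ω θ|) (fun _ _ => abs_nonneg _) hω'
    have h3 := abs_sub_abs_le_abs_sub (v ω θ) (v ω' θ)
    linarith
  · gcongr
    linarith

theorem exists_measure_compl_boundedSet_le [SecondCountableTopology Ω]
    (hΩ : FiniteMetricDimension Ω) {P : Measure Θ} [IsProbabilityMeasure P] {v : Ω → Θ → ℝ}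
    {κ : ℝ≥0} (hκ : 0 < κ) (hv : IsHolderProcess v κ) {ε : ℝ≥0∞} (hε : 0 < ε) :
    ∃ K, P (boundedSet v κ K)ᶜ ≤ ε := by
  have hanti : Antitone fun K => (boundedSet v κ K)ᶜ := fun K K' h =>
    Set.compl_subset_compl.2 (boundedSet_mono v κ h)
  have h := tendsto_measure_iInter_atTop (μ := P)
    (fun K => (measurableSet_boundedSet hκ hv K).compl.nullMeasurableSet) hanti
    ⟨0, measure_ne_top _ _⟩
  rw [← Set.compl_iUnion, iUnion_boundedSet hΩ hv, Set.compl_univ, measure_empty] at h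
  exact ((h.eventually (gt_mem_nhds hε)).exists).imp fun _ => le_of_lt

end Regularity

/-! ### Covariance under lattice translations -/

section Translation

variable {d : ℕ}

theorem hopping_translate (γ : ℝ) (V f : (Fin d → ℤ) → ℝ) (y x : Fin d → ℤ) :
    hopping γ (fun z => V (z + y)) (fun z => f (z + y)) x = hopping γ V f (x + y) := by
  simp only [hopping, neighborSum]
  congr 2
  refine Finset.sum_congr rfl fun i _ => ?_
  rw [add_right_comm, show x - Pi.single i 1 + y = x + y - Pi.single i 1 by abel]

theorem IsResonant.translate {γ : ℝ} {V : (Fin d → ℤ) → ℝ} {u : Fin d → ℤ} {r : ℕ} {E δ : ℝ}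
    (y : Fin d → ℤ) (h : IsResonant γ V (latticeBall (u + y) r) E δ) :
    IsResonant γ (fun z => V (z + y)) (latticeBall u r) E δ := by
  obtain ⟨f, hf0, hf1, hf2⟩ := h
  have hmem : ∀ z, z + y ∈ latticeBall (u + y) r ↔ z ∈ latticeBall u r := fun z => by
    rw [mem_latticeBall, mem_latticeBall, add_sub_add_right_eq_sub]
  have hsum : ∀ g : (Fin d → ℤ) → ℝ, ∑ z ∈ latticeBall u r, g (z + y) =
      ∑ z ∈ latticeBall (u + y) r, g z := fun g =>
    Finset.sum_equiv (Equiv.addRight y) (fun z => (hmem z).symm) fun _ _ => rfl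
  refine ⟨fun z => f (z + y), fun z hz => hf0 _ (mt (hmem z).1 hz), ?_, ?_⟩
  · rw [← hf1, hsum fun z => f z ^ 2]
  · simp only [hopping_translate]
    rw [hsum fun z => (hopping γ V f z - E * f z) ^ 2]
    exact hf2

/-- This turns bounds at the origin that are uniform in `ω` into bounds in the windows about all
lattice sites. -/
theorem separatedResonances_translate {γ : ℝ} {V : (Fin d → ℤ) → ℝ} {J s p : ℕ} {σ E : ℝ}
    (y : Fin d → ℤ) (h : ∃ u : Fin p → Fin d → ℤ, (∀ i, u i ∈ latticeBall y (window s)) ∧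
      (∀ i j, i ≠ j → 2 * resRadius J s < latticeNorm (u i - u j)) ∧
      ∀ i, u i ∈ resSites γ V J σ E s) :
    SeparatedResonances γ (fun z => V (z + y)) J σ s p E := by
  obtain ⟨u, hu, hsep, hres⟩ := h
  refine ⟨fun i => u i - y, fun i => ?_, fun i j hij => ?_, fun i => ?_⟩
  · rw [mem_latticeBall, sub_zero]
    exact mem_latticeBall.1 (hu i)
  · rw [sub_sub_sub_cancel_right]
    exact hsep i j hij
  · obtain ⟨r, hr, h⟩ := hres i
    exact ⟨r, hr, IsResonant.translate y (by rwa [sub_add_cancel])⟩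

end Translation

/-! ### The event of large probability -/

section GoodEvent

variable {d : ℕ}

/-- Solutions of the eigenvalue equation that grow slowly decay exponentially. -/
def DecayingSolutions (γ : ℝ) (V : (Fin d → ℤ) → ℝ) : Prop :=
  ∀ (E : ℝ) (ψ : (Fin d → ℤ) → ℝ), (∀ x, hopping γ V ψ x = E * ψ x) →
    (∃ C, ∀ x, |ψ x| ≤ C * Real.exp (latticeNorm x / 4)) →
    ∃ C, ∀ x, |ψ x| ≤ C * Real.exp (-latticeNorm x)

/-- Nets of moderate size in `Ω` approximate the potentials on the windows of all scales. -/
theorem exists_net {Ω Θ : Type*} [MetricSpace Ω] [AddAction (Fin d → ℤ) Ω] {v : Ω → Θ → ℝ}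
    {κ : ℝ≥0} (hκ : 0 < κ) (hΩ : FiniteMetricDimension Ω) (hT : TemperedAction d Ω) (σ : ℝ)
    (K : ℕ) :
    ∃ c a ν : ℝ, 0 ≤ c ∧ 0 ≤ ν ∧ ∀ s, ∃ N : Finset Ω,
      (N.card : ℝ) ≤ c * (window s : ℝ) ^ a * tol σ s ^ (-ν) ∧
      ∀ ω, ∃ ω' ∈ N, ∀ θ ∈ boundedSet v κ K, ∀ y ∈ latticeBall (0 : Fin d → ℤ) (2 * window s),
        |v (y +ᵥ ω) θ - v (y +ᵥ ω') θ| ≤ tol σ s := by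
  obtain ⟨ν, hν, C, hC, hnet⟩ := hΩ
  obtain ⟨CT, hCT, q, hT⟩ := hT
  have hκ0 : (0 : ℝ) < κ := hκ
  refine ⟨(C * (CT + 1) * 3 ^ q * (K + 1) ^ (κ : ℝ)⁻¹) ^ ν, q * ν, (κ : ℝ)⁻¹ * ν, by positivity,
    by positivity, fun s => ?_⟩
  have ht := tol_pos σ s
  have ht1 := tol_le_one σ s
  set t := tol σ s
  have hM1 : (1 : ℝ) ≤ window s := by exact_mod_cast one_le_window s
  set M : ℝ := ((window s : ℕ) : ℝ) with hM
  have hM3 : 1 ≤ 3 * M := by linarith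
  -- Points at distance `b` have potentials within `t`, as `K * b ^ κ ≤ t`; `K + 1` avoids dividing
  -- by zero. Translations in the window expand distances by at most `(CT + 1) * (3 * M) ^ q`, which
  -- fixes the mesh `e` below, with `CT + 1` ensuring `e ≤ 1`.
  set b : ℝ := (t / (K + 1)) ^ (κ : ℝ)⁻¹ with hb
  have hK1 : (1 : ℝ) ≤ K + 1 := by linarith [Nat.cast_nonneg (α := ℝ) K]
  have hb0 : 0 < b := by positivity
  have hb1 : b ≤ 1 := by
    refine Real.rpow_le_one (by positivity) ?_ (by positivity)
    exact div_le_one_of_le₀ (ht1.trans hK1) (by linarith)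
  set e : ℝ := b / ((CT + 1) * (3 * M) ^ q) with he
  have hden : 1 ≤ (CT + 1) * (3 * M) ^ q := by
    have : (1 : ℝ) ≤ (3 * M) ^ q := one_le_pow₀ (by linarith)
    nlinarith
  have he0 : 0 < e := by positivity
  have he1 : e ≤ 1 := div_le_one_of_le₀ (hb1.trans hden) (by linarith)
  obtain ⟨N, hNcard, hN⟩ := hnet e he0 he1
  refine ⟨N, hNcard.trans_eq ?_, fun ω => ?_⟩
  · have e1 : C / e = C * (CT + 1) * 3 ^ q * (K + 1) ^ (κ : ℝ)⁻¹ * M ^ q * t ^ (-(κ : ℝ)⁻¹) := by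
      rw [he, hb, Real.div_rpow ht.le (by linarith), Real.rpow_neg ht.le]
      have : t ^ (κ : ℝ)⁻¹ ≠ 0 := (Real.rpow_pos_of_pos ht _).ne'
      field_simp
      ring
    rw [e1, Real.mul_rpow (by positivity) (by positivity),
      Real.mul_rpow (by positivity) (by positivity), ← Real.rpow_natCast M q,
      ← Real.rpow_mul (by positivity), ← Real.rpow_mul ht.le, neg_mul]
  · obtain ⟨ω', hω', hd⟩ := hN ω
    refine ⟨ω', hω', fun θ hθ y hy => (hθ.2 _ _).trans ?_⟩
    rw [mem_latticeBall, sub_zero] at hy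
    have hy' : 1 + (latticeNorm y : ℝ) ≤ 3 * M := by
      have h1 : (latticeNorm y : ℝ) ≤ 2 * M := by rw [hM]; exact_mod_cast hy
      linarith
    have h1 : dist (y +ᵥ ω) (y +ᵥ ω') ≤ b := by
      calc dist (y +ᵥ ω) (y +ᵥ ω') ≤ CT * (1 + (latticeNorm y : ℝ)) ^ q * dist ω ω' := hT y ω ω'
        _ ≤ (CT + 1) * (3 * M) ^ q * e := by gcongr; linarith
        _ = b := by rw [he]; field_simp
    calc (K : ℝ) * dist (y +ᵥ ω) (y +ᵥ ω') ^ (κ : ℝ) ≤ K * b ^ (κ : ℝ) := by gcongr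
      _ = K * (t / (K + 1)) := by
          rw [hb, ← Real.rpow_mul (by positivity), inv_mul_cancel₀ hκ0.ne', Real.rpow_one]
      _ = K / (K + 1) * t := by ring
      _ ≤ 1 * t := by
          gcongr
          exact div_le_one_of_le₀ (by linarith) (by linarith)
      _ = t := one_mul t

/-- For large coupling there are events of probability close to one on which slowly growing
solutions decay exponentially, for almost all phases. -/
theorem exists_good_event {Ω : Type*} [MetricSpace Ω] [MeasurableSpace Ω] [BorelSpace Ω]
    (PΩ : Measure Ω) [IsProbabilityMeasure PΩ]
    [AddAction (Fin d → ℤ) Ω] [MeasurableConstVAdd (Fin d → ℤ) Ω]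
    {Θ : Type*} [MeasurableSpace Θ] (PΘ : Measure Θ) [IsProbabilityMeasure PΘ]
    {v : Ω → Θ → ℝ} {κ : ℝ≥0} (hκ : 0 < κ) {A η : ℝ}
    (hΩ : FiniteMetricDimension Ω) (hT : TemperedAction d Ω) (hv : IsHolderProcess v κ)
    (hUPA : UPA d Ω A) (hLIB : LIB PΘ v η) (hAη : A * η < 1) {ε : ℝ} (hε : 0 < ε) :
    ∃ g₀ : ℝ, 0 < g₀ ∧ ∀ g, g₀ ≤ g → ∃ G : Set Θ, MeasurableSet G ∧
      PΘ Gᶜ ≤ ENNReal.ofReal ε ∧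
      ∀ θ ∈ G, ∀ᵐ ω ∂PΩ, DecayingSolutions g⁻¹ fun x : Fin d → ℤ => v (x +ᵥ ω) θ := by
  have hsc := hΩ.secondCountableTopology
  obtain ⟨β, hβ0, hβ1, C₁, hcond⟩ := exists_condDensityBound hv.1 hUPA hLIB hAη
  obtain ⟨σ, hβσ, hσ1⟩ := exists_between hβ1
  have hσ0 : 0 < σ := hβ0.trans hβσ
  obtain ⟨K, hK⟩ := exists_measure_compl_boundedSet_le hΩ (P := PΘ) hκ hv
    (ε := ENNReal.ofReal (ε / 2)) (ENNReal.ofReal_pos.2 (by linarith))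
  obtain ⟨c, a, ν, hc, hν, hnet⟩ := exists_net (d := d) hκ hΩ hT σ (v := v) K
  choose N hNcard hN using hnet
  -- Here `ν` is the exponent of the nets of potentials, and `J + 1 ≥ 2 + ν` resonances beat them.
  set J := ⌈ν⌉₊ + 1 with hJ
  have hJν : 2 + ν ≤ ((J + 1 : ℕ) : ℝ) := by
    have := Nat.le_ceil ν
    rw [hJ]; push_cast; linarith
  have hev := (eventually_largeScale d J hσ0 hσ1).and
    ((eventually_gridBound_le d (J + 1) hβ0 hβσ hJν c (2 * K + 5 + 2 * 2 ^ d) (6 * 30 ^ d) C₁ a hc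
      (by positivity) (by positivity)).and
    (eventually_gridBound_le d 2 hβ0 hβσ (ν := 0) (by norm_num) 1 (2 * K + 5 + 2 * 2 ^ d)
      (6 * 30 ^ d) C₁ 0 zero_le_one (by positivity) (by positivity)))
  have hsmall : ∀ᶠ s : ℕ in atTop, 2 * (1 / 2 : ℝ) ^ s < ε / 2 := by
    have h1 : Tendsto (fun s : ℕ => 2 * (1 / 2 : ℝ) ^ s) atTop (𝓝 (2 * 0)) :=
      (tendsto_pow_atTop_nhds_zero_of_lt_one (by norm_num) (by norm_num)).const_mul 2
    rw [mul_zero] at h1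
    exact h1.eventually (gt_mem_nhds (by linarith))
  obtain ⟨s₀, hs₀⟩ := eventually_atTop.1 hev
  obtain ⟨s₁, hs₁, hs₁ε⟩ := ((eventually_ge_atTop s₀).and hsmall).exists
  have hlarge : ∀ s, s₁ ≤ s → LargeScale d J σ s := fun s hs => (hs₀ s (hs₁.trans hs)).1
  have hden : 0 < Real.exp (-32) * tol σ s₁ := mul_pos (Real.exp_pos _) (tol_pos _ _)
  -- The coupling must make the hopping small against the tolerance of the initial scale `s₁`, which
  -- depends on `ε` only through the probability tail. The `+ 1` keeps the threshold positive when
  -- `d = 0`.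
  refine ⟨(2 * d + 1) / (Real.exp (-32) * tol σ s₁), by positivity, fun g hg => ?_⟩
  have hg0 : 0 < g := lt_of_lt_of_le (by positivity) hg
  set γ := g⁻¹ with hγdef
  have hγ : 0 ≤ γ := inv_nonneg.2 hg0.le
  have hγ1 : 2 * d * γ ≤ Real.exp (-32) * tol σ s₁ := by
    rw [div_le_iff₀ hden] at hg
    rw [hγdef, ← div_eq_mul_inv, div_le_iff₀ hg0]
    linarith
  have hγd : 2 * d * γ ≤ 1 := by
    refine hγ1.trans (mul_le_one₀ ?_ (tol_pos _ _).le (tol_le_one _ _))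
    rw [Real.exp_le_one_iff]; norm_num
  let X : Ω → Θ → (Fin d → ℤ) → ℝ := fun ω θ x => v (x +ᵥ ω) θ
  have hXm : ∀ ω, Measurable (X ω) := fun ω => measurable_pi_lambda _ fun x => hv.1 _
  have hprob : ∀ (p s : ℕ) (ω : Ω), s₁ ≤ s → PΘ {θ | X ω θ ∈ gridEvent γ J σ K s p} ≤
      ENNReal.ofReal ((2 * K + 5 + 2 * 2 ^ d) * (window s : ℝ) ^ d / tol σ s *
        (6 * 30 ^ d * (window s : ℝ) ^ (3 * d + 1) * Real.exp (C₁ * (window s : ℝ) ^ β) *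
          tol σ s) ^ p) := fun p s ω hs =>
    measure_gridEvent_le (Real.exp_pos _).le (hlarge s hs).resRadius_lt (hcond ω s) γ p
      (Nat.cast_nonneg K)
  -- The net replaces all phases: an event with `J + 1` resonances for any `ω` is seen, with
  -- enlarged error, at a net point.
  let U : ℕ → Set Θ := fun s => ⋃ ω ∈ N s, {θ | X ω θ ∈ gridEvent γ J σ K s (J + 1)}
  have hUm : ∀ s, MeasurableSet (U s) := fun s =>
    Finset.measurableSet_biUnion _ fun ω _ => hXm ω (measurableSet_gridEvent _ _ _ _ _ _)
  have hUP : ∀ s, s₁ ≤ s → PΘ (U s) ≤ ENNReal.ofReal ((1 / 2) ^ s) := by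
    intro s hs
    refine (measure_biUnion_finset_le _ _).trans ?_
    refine (Finset.sum_le_card_nsmul _ _ _ fun ω _ => hprob (J + 1) s ω hs).trans ?_
    rw [nsmul_eq_mul, ← ENNReal.ofReal_natCast, ← ENNReal.ofReal_mul (Nat.cast_nonneg _)]
    refine ENNReal.ofReal_le_ofReal (le_trans ?_ (hs₀ s (hs₁.trans hs)).2.1)
    have ht := (tol_pos σ s).le
    gcongr
    exact hNcard s
  let W : ℕ → Set (Θ × Ω) := fun s => {q | X q.2 q.1 ∈ gridEvent γ J σ K s 2}
  have hjoint : Measurable fun q : Θ × Ω => X q.2 q.1 := by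
    refine measurable_pi_lambda _ fun x => ?_
    have h1 : Measurable (Function.uncurry v) :=
      measurable_uncurry_of_continuous_of_measurable (fun θ => hv.continuous hκ θ) hv.1
    exact h1.comp (((measurable_const_vadd x).comp measurable_snd).prodMk measurable_fst)
  have hWm : ∀ s, MeasurableSet (W s) := fun s => hjoint (measurableSet_gridEvent _ _ _ _ _ _)
  have hWP : ∀ s, s₁ ≤ s → (PΘ.prod PΩ) (W s) ≤ ENNReal.ofReal ((1 / 2) ^ s) := by
    intro s hs
    rw [Measure.prod_apply_symm (hWm s)]
    calc _ ≤ ∫⁻ _, ENNReal.ofReal ((1 / 2) ^ s) ∂PΩ := by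
          refine lintegral_mono fun ω => (hprob 2 s ω hs).trans (ENNReal.ofReal_le_ofReal ?_)
          have := (hs₀ s (hs₁.trans hs)).2.2
          simpa using this
      _ = _ := by simp
  have hgeom : ∑' s : ℕ, ENNReal.ofReal ((1 / 2) ^ (s + s₁)) = ENNReal.ofReal (2 * (1 / 2) ^ s₁) := by
    rw [← ENNReal.ofReal_tsum_of_nonneg (fun s => by positivity)]
    · simp_rw [pow_add]
      rw [tsum_mul_right, tsum_geometric_two]
    · simp_rw [pow_add]
      exact summable_geometric_two.mul_right _
  have hBC : ∀ᵐ q ∂PΘ.prod PΩ, ∀ᶠ s in atTop, q ∉ W (s + s₁) := by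
    refine ae_eventually_notMem (ne_top_of_le_ne_top ?_
      (ENNReal.tsum_le_tsum fun s => hWP (s + s₁) (by omega)))
    rw [hgeom]
    exact ENNReal.ofReal_ne_top
  have hae : ∀ᵐ θ ∂PΘ, ∀ᵐ ω ∂PΩ, ∀ᶠ s in atTop, (θ, ω) ∉ W (s + s₁) :=
    Measure.ae_ae_of_ae_prod hBC
  -- The exceptional parameters need not form a measurable set; a measurable null superset is
  -- removed.
  obtain ⟨Z, hZ, hZm, hZ0⟩ := exists_measurable_superset_of_null (ae_iff.1 hae)
  refine ⟨boundedSet v κ K \ ((⋃ s, U (s + s₁)) ∪ Z), (measurableSet_boundedSet hκ hv K).diff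
    ((MeasurableSet.iUnion fun s => hUm _).union hZm), ?_, ?_⟩
  · have h1 : (boundedSet v κ K \ ((⋃ s, U (s + s₁)) ∪ Z))ᶜ =
        (boundedSet v κ K)ᶜ ∪ ((⋃ s, U (s + s₁)) ∪ Z) := by
      rw [Set.sdiff_eq, Set.compl_inter, compl_compl]
    rw [h1]
    calc _ ≤ PΘ (boundedSet v κ K)ᶜ + (PΘ (⋃ s, U (s + s₁)) + PΘ Z) :=
          (measure_union_le _ _).trans (by gcongr; exact measure_union_le _ _)
      _ ≤ ENNReal.ofReal (ε / 2) + (ENNReal.ofReal (ε / 2) + 0) := by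
          gcongr
          · refine (measure_iUnion_le _).trans ((ENNReal.tsum_le_tsum fun s =>
              hUP (s + s₁) (by omega)).trans ?_)
            rw [hgeom]
            exact ENNReal.ofReal_le_ofReal hs₁ε.le
          · exact hZ0.le
      _ = ENNReal.ofReal ε := by
          rw [add_zero, ← ENNReal.ofReal_add (by linarith) (by linarith), add_halves]
  · rintro θ ⟨hθK, hθ⟩
    rw [Set.mem_union, not_or] at hθ
    have hθae : ∀ᵐ ω ∂PΩ, ∀ᶠ s in atTop, (θ, ω) ∉ W (s + s₁) := by
      by_contra hcon
      exact hθ.2 (hZ hcon)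
    have huniform : ∀ s, s₁ ≤ s → ∀ ω E, ¬ SeparatedResonances γ (X ω θ) J σ s (J + 1) E := by
      intro s hs ω E hsep
      obtain ⟨ω', hω', hclose⟩ := hN s ω
      apply hθ.1
      refine Set.mem_iUnion.2 ⟨s - s₁, Set.mem_biUnion (x := ω') ?_ ?_⟩
      · rwa [Nat.sub_add_cancel hs]
      · rw [Nat.sub_add_cancel hs]
        exact hsep.mem_gridEvent (Nat.succ_ne_zero _) hγ hγd (hlarge s hs).resRadius_lt
          (fun y => hθK.1 _) (hclose θ hθK)
    filter_upwards [hθae] with ω hω E ψ hψ ⟨C, hC⟩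
    refine exists_abs_le_exp_neg hlarge (isGood_of_resSites_disjoint (by omega) hγ hγ1 hlarge ?_)
      ?_ hψ hC
    · intro s hs y hex
      -- The window about `y` for the phase `ω` is the window about 0 for `T^y ω`.
      refine huniform s hs (y +ᵥ ω) E ?_
      have := separatedResonances_translate y hex
      simpa only [X, vadd_vadd] using this
    · rw [← Filter.map_add_atTop_eq_nat s₁, eventually_map]
      filter_upwards [hω] with s hs hsep
      exact hs (hsep.mem_gridEvent two_ne_zero hγ hγd (hlarge _ (by omega)).resRadius_lt
        (fun y => hθK.1 _) fun y _ => by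
          rw [show X ω θ y = v (y +ᵥ ω) θ from rfl, sub_self, abs_zero]
          exact (tol_pos σ _).le)

end GoodEvent

/-! ### Spectral measures from the continuous functional calculus -/

section SpectralMeasure

open scoped InnerProductSpace CompactlySupported

variable {K : Type*} [NormedAddCommGroup K] [InnerProductSpace ℂ K] [CompleteSpace K]

theorem inner_cfcHom_mul {A : K →L[ℂ] K} (hA : IsSelfAdjoint A) (f h : C(spectrum ℝ A, ℝ))
    (φ : K) : ⟪φ, cfcHom hA (f * h) φ⟫_ℂ = ⟪cfcHom hA f φ, cfcHom hA h φ⟫_ℂ := by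
  have hsa : (cfcHom hA f).adjoint = cfcHom hA f := by
    rw [← ContinuousLinearMap.star_eq_adjoint, ← map_star, star_trivial]
  rw [map_mul, mul_apply_eq_comp, ← ContinuousLinearMap.adjoint_inner_left, hsa]

/-- The spectral functional `f ↦ ⟪φ, f(A) φ⟫` of a vector. -/
noncomputable def spectralFunctional {A : K →L[ℂ] K} (hA : IsSelfAdjoint A) (φ : K) :
    C_c(spectrum ℝ A, ℝ) →ₚ[ℝ] ℝ :=
  PositiveLinearMap.mk₀
    { toFun := fun f => (⟪φ, cfcHom hA (f : C(spectrum ℝ A, ℝ)) φ⟫_ℂ).re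
      map_add' := fun f h => by
        have : ((f + h : C_c(spectrum ℝ A, ℝ)) : C(spectrum ℝ A, ℝ)) = (f : C(spectrum ℝ A, ℝ)) + h :=
          rfl
        rw [this, map_add, add_apply, inner_add_right, Complex.add_re]
      map_smul' := fun c f => by
        have : ((c • f : C_c(spectrum ℝ A, ℝ)) : C(spectrum ℝ A, ℝ)) =
            c • (f : C(spectrum ℝ A, ℝ)) := rfl
        rw [this, map_smul, smul_apply, inner_smul_right_eq_smul]
        simp }
    (fun f hf => by
      -- A nonnegative function is a square, so the functional is a squared norm.
      let h : C(spectrum ℝ A, ℝ) := ⟨fun E => Real.sqrt (f E), f.continuous.sqrt⟩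
      have e : (f : C(spectrum ℝ A, ℝ)) = h * h := by
        ext E
        exact (Real.mul_self_sqrt (hf E)).symm
      change 0 ≤ (⟪φ, cfcHom hA (f : C(spectrum ℝ A, ℝ)) φ⟫_ℂ).re
      rw [e, inner_cfcHom_mul]
      exact inner_self_nonneg (𝕜 := ℂ))

/-- The spectral representation of a self-adjoint operator relative to a vector `φ`. -/
theorem exists_spectral_representation {A : K →L[ℂ] K} (hA : IsSelfAdjoint A) (φ : K) :
    ∃ (X : Type) (_ : MeasurableSpace X) (_ : MeasurableSingletonClass X) (e : X → ℝ)
      (_ : Function.Injective e) (μ : Measure X) (_ : IsFiniteMeasure μ) (U : Lp ℝ 2 μ → K)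
      (R : K →ₗ[ℝ] Lp ℝ 2 μ),
      (∀ χ f, (⟪χ, U f⟫_ℂ).re = ⟪R χ, f⟫_ℝ) ∧ (∀ χ, ‖R χ‖ ≤ ‖χ‖) ∧
      (R φ =ᵐ[μ] fun _ => 1) ∧ (∀ χ, (⟪χ, φ⟫_ℂ).re = ∫ E, R χ E ∂μ) ∧
      ∀ χ, ∀ᵐ E ∂μ, R (A χ) E = e E * R χ E := by
  let X := spectrum ℝ A
  let Λ := spectralFunctional hA φ
  let μ : Measure X := RealRMK.rieszMeasure Λ
  have hμf : IsFiniteMeasure μ := ⟨isCompact_univ.measure_lt_top⟩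
  have hint : ∀ f : C(X, ℝ), ∫ E, f E ∂μ = (⟪φ, cfcHom hA f φ⟫_ℂ).re := fun f =>
    RealRMK.integral_rieszMeasure Λ ⟨f, HasCompactSupport.of_compactSpace f⟩
  let e : C(X, ℝ) →L[ℝ] Lp ℝ 2 μ := ContinuousMap.toLp 2 μ ℝ
  have hdense : DenseRange e := ContinuousMap.toLp_denseRange ℝ μ ℝ (by norm_num)
  have hinner : ∀ f h : C(X, ℝ), ⟪e f, e h⟫_ℝ = ∫ E, f E * h E ∂μ := by
    intro f h
    rw [L2.inner_def]
    refine integral_congr_ae ?_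
    filter_upwards [ContinuousMap.coeFn_toLp (p := 2) (𝕜 := ℝ) μ f,
      ContinuousMap.coeFn_toLp (p := 2) (𝕜 := ℝ) μ h] with E h1 h2
    simp only [e, h1, h2]
    simp [mul_comm]
  let T : C(X, ℝ) →ₗ[ℝ] K :=
    { toFun := fun f => cfcHom hA f φ
      map_add' := fun f h => by rw [map_add, add_apply]
      map_smul' := fun c f => by
        rw [map_smul, smul_apply, RingHom.id_apply] }
  have hnorm : ∀ f, ‖T f‖ = ‖e f‖ := by
    intro f
    have h1 : ‖T f‖ ^ 2 = ‖e f‖ ^ 2 := by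
      rw [← real_inner_self_eq_norm_sq (e f), hinner, ← inner_self_eq_norm_sq (𝕜 := ℂ) (T f)]
      change (⟪cfcHom hA f φ, cfcHom hA f φ⟫_ℂ).re = _
      rw [← inner_cfcHom_mul, ← hint]
      rfl
    exact (sq_eq_sq₀ (norm_nonneg _) (norm_nonneg _)).1 h1
  have hnorm' : ∀ f, ‖T f‖ ≤ 1 * ‖e.toLinearMap f‖ := fun f => by
    rw [one_mul]; exact (hnorm f).le
  -- The Hilbert space is regarded as real, so that the adjoint `R` of `U` has real values and
  -- yields real solutions. `U` extends the isometry `f ↦ f(A) φ` from continuous functions to `L²`.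
  let _ : InnerProductSpace ℝ K := InnerProductSpace.complexToReal
  let U : Lp ℝ 2 μ →L[ℝ] K := T.extendOfNorm e.toLinearMap
  have hU : ∀ f, U (e f) = cfcHom hA f φ := fun f =>
    LinearMap.extendOfNorm_eq hdense ⟨1, hnorm'⟩ f
  have hre : ∀ χ χ' : K, ⟪χ, χ'⟫_ℝ = (⟪χ, χ'⟫_ℂ).re := fun χ χ' => rfl
  have hadj : ∀ χ f, (⟪χ, U f⟫_ℂ).re = ⟪U.adjoint χ, f⟫_ℝ := fun χ f => by
    rw [ContinuousLinearMap.adjoint_inner_left, hre]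
  have hext : ∀ w w' : Lp ℝ 2 μ, (∀ f : C(X, ℝ), ⟪w, e f⟫_ℝ = ⟪w', e f⟫_ℝ) → w = w' := by
    intro w w' h
    have h1 : ∀ z, ⟪w, z⟫_ℝ = ⟪w', z⟫_ℝ := fun z =>
      hdense.induction (P := fun z => ⟪w, z⟫_ℝ = ⟪w', z⟫_ℝ) (by rintro _ ⟨f, rfl⟩; exact h f)
        (isClosed_eq (by fun_prop) (by fun_prop)) z
    exact ext_inner_right ℝ h1
  have hφ : U.adjoint φ = e 1 := hext _ _ fun f => by
    rw [← hadj, hU, hinner, ← hint]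
    simp
  have hone : e 1 =ᵐ[μ] fun _ => (1 : ℝ) := by
    filter_upwards [ContinuousMap.coeFn_toLp (p := 2) (𝕜 := ℝ) μ (1 : C(X, ℝ))] with E hE
    rw [hE]; rfl
  refine ⟨X, inferInstance, inferInstance, Subtype.val,
    Subtype.val_injective, μ, hμf, U, U.adjoint.toLinearMap, hadj, fun χ => ?_, ?_, fun χ => ?_, fun χ => ?_⟩
  · refine (U.adjoint.le_opNorm χ).trans (mul_le_of_le_one_left (norm_nonneg _) ?_)
    rw [LinearIsometryEquiv.norm_map]
    exact LinearMap.opNorm_extendOfNorm_le hdense zero_le_one hnorm'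
  · change U.adjoint φ =ᵐ[μ] _
    rw [hφ]; exact hone
  · have h1 : U (e 1) = φ := by rw [hU, map_one, one_apply_eq_self]
    conv_lhs => rw [← h1]
    rw [hadj, L2.inner_def]
    refine integral_congr_ae ?_
    filter_upwards [hone] with E hE
    rw [hE]
    simp
  · let w := U.adjoint χ
    have hmem : MemLp (fun E : X => (E : ℝ) * w E) 2 μ := by
      have hb : ∃ C, ∀ E : X, ‖(E : ℝ)‖ ≤ C := by
        obtain ⟨C, hC⟩ := (isCompact_univ (X := X)).exists_bound_of_continuousOn
          (f := fun E : X => (E : ℝ)) continuous_subtype_val.continuousOn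
        exact ⟨C, fun E => hC E trivial⟩
      obtain ⟨C, hC⟩ := hb
      refine (Lp.memLp w).of_le_mul (c := C)
        (continuous_subtype_val.aestronglyMeasurable.mul (Lp.memLp w).1) (ae_of_all _ fun E => ?_)
      rw [norm_mul]
      exact mul_le_mul_of_nonneg_right (hC E) (norm_nonneg _)
    have hAadj : ∀ χ', ⟪A χ, χ'⟫_ℂ = ⟪χ, A χ'⟫_ℂ := fun χ' => by
      rw [← ContinuousLinearMap.adjoint_inner_left, ← ContinuousLinearMap.star_eq_adjoint,
        hA.star_eq]
    -- `U` intertwines multiplication by the energy with `A`; the self-adjointness of `A` passes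
    -- this to the adjoint.
    have h1 : U.adjoint (A χ) = hmem.toLp _ := hext _ _ fun f => by
      have h2 : A (U (e f)) = U (e ((ContinuousMap.id ℝ).restrict X * f)) := by
        rw [hU, hU, map_mul, cfcHom_id, mul_apply_eq_comp]
      rw [← hadj, hAadj, h2, hadj, L2.inner_def, L2.inner_def]
      refine integral_congr_ae ?_
      filter_upwards [hmem.coeFn_toLp, ContinuousMap.coeFn_toLp (p := 2) (𝕜 := ℝ) μ f,
        ContinuousMap.coeFn_toLp (p := 2) (𝕜 := ℝ) μ ((ContinuousMap.id ℝ).restrict X * f)]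
        with E h3 h4 h5
      simp only [e, h3, h4, h5]
      simp [w]
      ring
    change ∀ᵐ E ∂μ, (U.adjoint (A χ)) E = _
    rw [h1]
    exact hmem.coeFn_toLp

end SpectralMeasure

/-! ### The Schrödinger operator with bounded potential -/

section Operator

open scoped InnerProductSpace

variable {d : ℕ}

theorem memℓp_two_iff {f : (Fin d → ℤ) → ℂ} :
    Memℓp f 2 ↔ Summable fun x => ‖f x‖ ^ 2 := by
  rw [memℓp_gen_iff (by norm_num)]
  simp

theorem memℓp_shift {f : (Fin d → ℤ) → ℂ} (hf : Memℓp f 2) (e : Fin d → ℤ) :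
    Memℓp (fun x => f (x + e)) 2 := by
  rw [memℓp_two_iff] at hf ⊢
  exact ((Equiv.addRight e).summable_iff (f := fun x => ‖f x‖ ^ 2)).2 hf

/-- Translation of square-summable functions. -/
noncomputable def shiftLp (e : Fin d → ℤ) : EllTwo d →ₗ[ℂ] EllTwo d where
  toFun f := ⟨fun x => f (x + e), memℓp_shift (lp.memℓp f) e⟩
  map_add' _ _ := rfl
  map_smul' _ _ := rfl

theorem shiftLp_apply (e : Fin d → ℤ) (f : EllTwo d) (x : Fin d → ℤ) :
    shiftLp e f x = f (x + e) := rfl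

/-- Multiplication of square-summable functions by a bounded function. -/
noncomputable def multiplicationLp (V : (Fin d → ℤ) → ℝ) (K : ℝ) (hV : ∀ x, |V x| ≤ K) :
    EllTwo d →ₗ[ℂ] EllTwo d where
  toFun f := ⟨fun x => (V x : ℂ) * f x, memℓp_two_iff.2 (by
    refine Summable.of_nonneg_of_le (fun x => by positivity) (fun x => ?_)
      ((memℓp_two_iff.1 (lp.memℓp f)).mul_left (K ^ 2))
    rw [norm_mul, mul_pow, Complex.norm_real, Real.norm_eq_abs]
    have := hV x
    gcongr)⟩
  map_add' f h := by
    ext x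
    exact mul_add _ _ _
  map_smul' c f := by
    ext x
    exact mul_left_comm _ _ _

theorem multiplicationLp_apply {V : (Fin d → ℤ) → ℝ} {K : ℝ} (hV : ∀ x, |V x| ≤ K) (f : EllTwo d)
    (x : Fin d → ℤ) : multiplicationLp V K hV f x = V x * f x := rfl

theorem inner_shiftLp (e : Fin d → ℤ) (f h : EllTwo d) :
    ⟪shiftLp e f, h⟫_ℂ = ⟪f, shiftLp (-e) h⟫_ℂ := by
  rw [lp.inner_eq_tsum, lp.inner_eq_tsum,
    ← (Equiv.addRight e).tsum_eq fun x => ⟪f x, shiftLp (-e) h x⟫_ℂ]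
  refine tsum_congr fun x => ?_
  simp [shiftLp_apply]

theorem inner_multiplicationLp {V : (Fin d → ℤ) → ℝ} {K : ℝ} (hV : ∀ x, |V x| ≤ K)
    (f h : EllTwo d) : ⟪multiplicationLp V K hV f, h⟫_ℂ = ⟪f, multiplicationLp V K hV h⟫_ℂ := by
  rw [lp.inner_eq_tsum, lp.inner_eq_tsum]
  refine tsum_congr fun x => ?_
  rw [multiplicationLp_apply, multiplicationLp_apply]
  simp only [RCLike.inner_apply, map_mul, Complex.conj_ofReal]
  ring

/-- The Schrödinger operator with a bounded potential is a bounded self-adjoint operator. -/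
theorem exists_isSelfAdjoint_schrodinger {V : (Fin d → ℤ) → ℝ} {K : ℝ} (hV : ∀ x, |V x| ≤ K) :
    ∃ A : EllTwo d →L[ℂ] EllTwo d, IsSelfAdjoint A ∧ ∀ f x, A f x = schrodingerExpr V f x := by
  let T : EllTwo d →ₗ[ℂ] EllTwo d :=
    (∑ i : Fin d, (shiftLp (Pi.single i 1) + shiftLp (-Pi.single i 1))) + multiplicationLp V K hV
  have hT : T.IsSymmetric := by
    intro f h
    simp only [T, LinearMap.add_apply, LinearMap.sum_apply, inner_add_left, inner_add_right,
      sum_inner, inner_sum, inner_shiftLp, inner_multiplicationLp, neg_neg]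
    congr 1
    exact Finset.sum_congr rfl fun i _ => add_comm _ _
  -- Hellinger–Toeplitz: a symmetric operator defined everywhere is bounded.
  refine ⟨hT.toSelfAdjoint, hT.toSelfAdjoint.2, fun f x => ?_⟩
  change T f x = _
  simp only [T, LinearMap.add_apply, LinearMap.sum_apply, lp.coeFn_add, lp.coeFn_sum, Pi.add_apply,
    Finset.sum_apply, shiftLp_apply, multiplicationLp_apply, schrodingerExpr, sub_eq_add_neg]

theorem schrodinger_eq_toPMap {V : (Fin d → ℤ) → ℝ} {A : EllTwo d →L[ℂ] EllTwo d}
    (hA : ∀ f x, A f x = schrodingerExpr V f x) :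
    schrodinger V = (A : EllTwo d →ₗ[ℂ] EllTwo d).toPMap ⊤ := by
  refine LinearPMap.ext ?_ ?_
  · ext f
    refine ⟨fun _ => trivial, fun _ => ?_⟩
    have h : schrodingerExpr V f = A f := (funext (hA f)).symm
    change Memℓp (schrodingerExpr V f) 2
    rw [h]
    exact lp.memℓp _
  · intro f h1 h2
    ext x
    exact (hA f x).symm

theorem isSelfAdjoint_schrodinger {V : (Fin d → ℤ) → ℝ} {K : ℝ} (hV : ∀ x, |V x| ≤ K) :
    IsSelfAdjoint (schrodinger V) := by
  obtain ⟨A, hA, hAV⟩ := exists_isSelfAdjoint_schrodinger hV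
  rw [schrodinger_eq_toPMap hAV, LinearPMap.isSelfAdjoint_def,
    ContinuousLinearMap.toPMap_adjoint_eq_adjoint_toPMap_of_dense _ (by simp),
    ← ContinuousLinearMap.star_eq_adjoint, hA.star_eq]

theorem isEigenvector_schrodinger_iff {V : (Fin d → ℤ) → ℝ} {A : EllTwo d →L[ℂ] EllTwo d}
    (hA : ∀ f x, A f x = schrodingerExpr V f x) {E : ℂ} {ψ : EllTwo d} :
    IsEigenvector (schrodinger V) E ψ ↔ ψ ≠ 0 ∧ A ψ = E • ψ := by
  rw [schrodinger_eq_toPMap hA]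
  exact and_congr_right fun _ => ⟨fun ⟨_, h⟩ => h, fun h => ⟨trivial, h⟩⟩

/-- Only countably many real numbers are eigenvalues. -/
theorem countable_eigenvalues {A : EllTwo d →L[ℂ] EllTwo d} (hA : IsSelfAdjoint A) :
    {E : ℝ | ∃ ψ : EllTwo d, ψ ≠ 0 ∧ A ψ = (E : ℂ) • ψ}.Countable := by
  classical
  set S := {E : ℝ | ∃ ψ : EllTwo d, ψ ≠ 0 ∧ A ψ = (E : ℂ) • ψ} with hS
  have hex : ∀ E : S, ∃ ψ : EllTwo d, ‖ψ‖ = 1 ∧ A ψ = ((E : ℝ) : ℂ) • ψ := by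
    rintro ⟨E, ψ, hψ, hAψ⟩
    refine ⟨((‖ψ‖⁻¹ : ℝ) : ℂ) • ψ, ?_, ?_⟩
    · rw [norm_smul, Complex.norm_real, norm_inv, norm_norm, inv_mul_cancel₀ (norm_ne_zero_iff.2 hψ)]
    · rw [map_smul, smul_comm]
      exact congrArg _ hAψ
  choose ψ hψ1 hψ using hex
  have hsymm : ∀ f h, ⟪A f, h⟫_ℂ = ⟪f, A h⟫_ℂ := fun f h => by
    rw [← ContinuousLinearMap.adjoint_inner_left, ← ContinuousLinearMap.star_eq_adjoint, hA.star_eq]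
  have horth : Orthonormal ℂ ψ := by
    refine ⟨hψ1, fun E E' hne => ?_⟩
    have h1 := hsymm (ψ E) (ψ E')
    rw [hψ, hψ, inner_smul_left, inner_smul_right, Complex.conj_ofReal, ← sub_eq_zero, ← sub_mul,
      mul_eq_zero, sub_eq_zero] at h1
    rcases h1 with h1 | h1
    · exact absurd (Subtype.ext (Complex.ofReal_injective h1)) hne
    · exact h1
  -- Normalised eigenvectors of distinct eigenvalues are orthonormal, and by Bessel only countably
  -- many are nonzero at a given site. Each is nonzero at some site.
  have hcount : ∀ x : Fin d → ℤ, {E : S | ψ E x ≠ 0}.Countable := by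
    intro x
    have h1 := (horth.inner_products_summable (lp.single 2 x (1 : ℂ))).countable_support
    refine h1.mono fun E hE => ?_
    rw [Function.mem_support]
    have h2 : ⟪ψ E, lp.single 2 x (1 : ℂ)⟫_ℂ = (starRingEnd ℂ) (ψ E x) := by
      rw [lp.inner_single_right]
      simp
    rw [h2]
    simpa using hE
  have hall : (Set.univ : Set S) ⊆ ⋃ x, {E : S | ψ E x ≠ 0} := by
    intro E _
    by_contra hno
    simp only [Set.mem_iUnion, Set.mem_ofPred_eq, not_exists, not_not] at hno
    have : ψ E = 0 := by
      ext x
      exact hno x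
    have h1 := hψ1 E
    rw [this, norm_zero] at h1
    exact zero_ne_one h1
  have hu : (Set.univ : Set S).Countable := (Set.countable_iUnion hcount).mono hall
  exact Set.countable_coe_iff.1 (Set.countable_univ_iff.1 hu)

/-- The weight of the `ℓ¹` norm factorises over the coordinates into geometric series on `ℤ`. -/
theorem summable_exp_neg_latticeNorm {a : ℝ} (ha : 0 < a) :
    Summable fun x : Fin d → ℤ => Real.exp (-(a * latticeNorm x)) := by
  have hZ : Summable fun k : ℤ => Real.exp (-(a * k.natAbs)) := by
    have hN : Summable fun n : ℕ => Real.exp (-(a * n)) := by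
      have := Real.summable_exp_nat_mul_iff.2 (neg_lt_zero.2 ha)
      refine this.congr fun n => ?_
      congr 1; ring
    refine Summable.of_nat_of_neg ?_ ?_ <;> simpa using hN
  have hprod : ∀ x : Fin d → ℤ, Real.exp (-(a * latticeNorm x)) =
      ∏ i, Real.exp (-(a * (x i).natAbs)) := by
    intro x
    rw [← Real.exp_sum]
    congr 1
    unfold latticeNorm
    push_cast
    rw [Finset.mul_sum, Finset.sum_neg_distrib]
  refine summable_of_sum_le (c := (∑' k : ℤ, Real.exp (-(a * k.natAbs))) ^ d)
    (fun x => (Real.exp_pos _).le) fun u => ?_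
  classical
  set t : Finset ℤ := u.biUnion fun x => Finset.univ.image x
  calc ∑ x ∈ u, Real.exp (-(a * latticeNorm x))
      ≤ ∑ x ∈ Fintype.piFinset fun _ : Fin d => t, Real.exp (-(a * latticeNorm x)) := by
        refine Finset.sum_le_sum_of_subset_of_nonneg (fun x hx => ?_) fun _ _ _ =>
          (Real.exp_pos _).le
        rw [Fintype.mem_piFinset]
        exact fun i => Finset.mem_biUnion.2 ⟨x, hx, Finset.mem_image_of_mem _ (Finset.mem_univ i)⟩
    _ = ∏ _i : Fin d, ∑ k ∈ t, Real.exp (-(a * k.natAbs)) := by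
        simp_rw [hprod]
        rw [Finset.prod_univ_sum]
    _ ≤ _ := by
        rw [Finset.prod_const, Finset.card_univ, Fintype.card_fin]
        gcongr
        exact hZ.sum_le_tsum _ fun _ _ => (Real.exp_pos _).le

/-- Exponentially decaying real solutions are eigenvectors. -/
theorem exists_eigenvector_of_decay {V : (Fin d → ℤ) → ℝ} {A : EllTwo d →L[ℂ] EllTwo d}
    (hA : ∀ f x, A f x = schrodingerExpr V f x) {E C : ℝ} {ψ : (Fin d → ℤ) → ℝ}
    (hψ : ∀ x, hopping 1 V ψ x = E * ψ x) (hC : ∀ x, |ψ x| ≤ C * Real.exp (-latticeNorm x))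
    {x₀ : Fin d → ℤ} (hx₀ : ψ x₀ ≠ 0) : ∃ f : EllTwo d, f ≠ 0 ∧ A f = (E : ℂ) • f := by
  have hmem : Memℓp (fun x => (ψ x : ℂ)) 2 := by
    rw [memℓp_two_iff]
    refine Summable.of_nonneg_of_le (fun x => by positivity) (fun x => ?_)
      ((summable_exp_neg_latticeNorm (d := d) two_pos).mul_left (C ^ 2))
    rw [Complex.norm_real, Real.norm_eq_abs]
    calc |ψ x| ^ 2 ≤ (C * Real.exp (-latticeNorm x)) ^ 2 :=
          pow_le_pow_left₀ (abs_nonneg _) (hC x) 2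
      _ = _ := by rw [mul_pow, ← Real.exp_nat_mul]; congr 2; push_cast; ring
  refine ⟨⟨_, hmem⟩, fun h => hx₀ ?_, ?_⟩
  · have := congrArg (fun f : EllTwo d => f x₀) h
    simpa using this
  · ext x
    rw [hA]
    have h := hψ x
    simp only [hopping, neighborSum, one_mul] at h
    change schrodingerExpr V (fun x => (ψ x : ℂ)) x = (E : ℂ) * ψ x
    simp only [schrodingerExpr]
    exact_mod_cast h

end Operator

/-! ### From decay of solutions to pure point spectrum -/

section PurePoint

open scoped InnerProductSpace

variable {d : ℕ}

/-- Square-summability in mean gives, almost everywhere, subexponential bounds in `x`. -/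
theorem ae_exists_abs_le_exp {X : Type*} [MeasurableSpace X] {μ : Measure X}
    (p : (Fin d → ℤ) → Lp ℝ 2 μ) (hp : ∀ x, ‖p x‖ ≤ 1) :
    ∀ᵐ E ∂μ, ∃ C, ∀ x, |p x E| ≤ C * Real.exp (latticeNorm x / 4) := by
  -- The weighted sum of squares has finite integral, hence is finite almost everywhere. The weight
  -- rate 1/2 gives the growth rate 1/4 for the functions themselves.
  let w : (Fin d → ℤ) → ℝ := fun x => Real.exp (-(1 / 2 * latticeNorm x))
  have hw : Summable w := summable_exp_neg_latticeNorm (by norm_num)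
  have hw0 : ∀ x, 0 < w x := fun x => Real.exp_pos _
  have hmeas : ∀ x, AEMeasurable (fun E => ENNReal.ofReal (w x * (p x E) ^ 2)) μ := fun x =>
    (((Lp.aestronglyMeasurable (p x)).aemeasurable.pow_const 2).const_mul _).ennreal_ofReal
  have hint : ∀ x, ∫⁻ E, ENNReal.ofReal (w x * (p x E) ^ 2) ∂μ ≤ ENNReal.ofReal (w x) := by
    intro x
    have hsq : Integrable (fun E => (p x E) ^ 2) μ := (Lp.memLp (p x)).integrable_sq
    rw [← ofReal_integral_eq_lintegral_ofReal (hsq.const_mul _)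
      (ae_of_all _ fun E => mul_nonneg (hw0 x).le (sq_nonneg _)), integral_const_mul]
    refine ENNReal.ofReal_le_ofReal (mul_le_of_le_one_right (hw0 x).le ?_)
    have h1 : ∫ E, (p x E) ^ 2 ∂μ = ‖p x‖ ^ 2 := by
      rw [← real_inner_self_eq_norm_sq, L2.inner_def]
      refine integral_congr_ae (ae_of_all _ fun E => ?_)
      simp [sq]
    rw [h1]
    exact pow_le_one₀ (norm_nonneg _) (hp x)
  have hfin : ∫⁻ E, ∑' x, ENNReal.ofReal (w x * (p x E) ^ 2) ∂μ ≠ ∞ := by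
    rw [lintegral_tsum hmeas]
    refine ne_top_of_le_ne_top ?_ (ENNReal.tsum_le_tsum hint)
    rw [← ENNReal.ofReal_tsum_of_nonneg (fun x => (hw0 x).le) hw]
    exact ENNReal.ofReal_ne_top
  filter_upwards [ae_lt_top' (AEMeasurable.tsum hmeas) hfin] with E hE
  set B := (∑' x, ENNReal.ofReal (w x * (p x E) ^ 2)).toReal with hB
  have hB0 : 0 ≤ B := ENNReal.toReal_nonneg
  refine ⟨Real.sqrt B, fun x => ?_⟩
  have h1 : w x * (p x E) ^ 2 ≤ B := by
    rw [← ENNReal.ofReal_le_iff_le_toReal hE.ne]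
    exact ENNReal.le_tsum x
  have h2 : (p x E) ^ 2 ≤ (Real.sqrt B * Real.exp (latticeNorm x / 4)) ^ 2 := by
    rw [mul_pow, Real.sq_sqrt hB0, ← Real.exp_nat_mul]
    have h3 : w x * Real.exp ((2 : ℕ) * (latticeNorm x / 4 : ℝ)) = 1 := by
      rw [← Real.exp_add, Real.exp_eq_one_iff]
      push_cast
      ring
    calc (p x E) ^ 2 = w x * (p x E) ^ 2 * Real.exp ((2 : ℕ) * (latticeNorm x / 4 : ℝ)) := by
          rw [mul_right_comm, h3, one_mul]
      _ ≤ _ := by gcongr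
  exact abs_le_of_sq_le_sq h2 (by positivity)

/-- The action of the operator on the canonical basis. -/
theorem apply_single {V : (Fin d → ℤ) → ℝ} {A : EllTwo d →L[ℂ] EllTwo d}
    (hA : ∀ f x, A f x = schrodingerExpr V f x) (x : Fin d → ℤ) :
    A (lp.single 2 x 1) = (∑ i : Fin d, (lp.single 2 (x + Pi.single i 1) (1 : ℂ) +
      lp.single 2 (x - Pi.single i 1) (1 : ℂ))) + V x • lp.single 2 x (1 : ℂ) := by
  have hs : ∀ u y : Fin d → ℤ, (lp.single 2 u (1 : ℂ) : EllTwo d) y = if y = u then 1 else 0 := by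
    intro u y
    by_cases h : y = u
    · subst h; simp
    · simp [h]
  ext y
  rw [hA, lp.coeFn_add, lp.coeFn_sum, Pi.add_apply, Finset.sum_apply, lp.coeFn_smul, Pi.smul_apply]
  simp only [schrodingerExpr, lp.coeFn_add, Pi.add_apply, hs]
  congr 1
  · refine Finset.sum_congr rfl fun i _ => ?_
    rw [add_comm]
    congr 1
    · simp only [sub_eq_iff_eq_add]
    · simp only [eq_sub_iff_add_eq]
  · by_cases h : y = x
    · subst h; simp
    · simp [h]

/-- The Schrödinger operator has pure point spectrum if slowly growing solutions decay. -/
theorem hasPurePointSpectrum_schrodinger {V : (Fin d → ℤ) → ℝ} {K : ℝ} (hV : ∀ x, |V x| ≤ K)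
    (hdec : DecayingSolutions 1 V) : HasPurePointSpectrum (schrodinger V) := by
  refine ⟨isSelfAdjoint_schrodinger hV, ?_⟩
  obtain ⟨A, hA, hAV⟩ := exists_isSelfAdjoint_schrodinger hV
  set M := Submodule.span ℂ {ψ : EllTwo d | ∃ E : ℂ, IsEigenvector (schrodinger V) E ψ} with hM
  have hsymm : ∀ f h, ⟪A f, h⟫_ℂ = ⟪f, A h⟫_ℂ := fun f h => by
    rw [← ContinuousLinearMap.adjoint_inner_left, ← ContinuousLinearMap.star_eq_adjoint, hA.star_eq]
  have hcount := countable_eigenvalues hA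
  set S := {E : ℝ | ∃ ψ : EllTwo d, ψ ≠ 0 ∧ A ψ = (E : ℂ) • ψ} with hS
  have hmain : ∀ χ ∈ Mᗮ, ∀ x₀ : Fin d → ℤ, (⟪χ, (lp.single 2 x₀ (1 : ℂ) : EllTwo d)⟫_ℂ).re = 0 := by
    intro χ hχ x₀
    obtain ⟨X, _, _, e, he, μ, hμ, U, R, hUR, hR, hRφ, hRint, hRA⟩ :=
      exists_spectral_representation hA (lp.single 2 x₀ (1 : ℂ) : EllTwo d)
    rw [hRint]
    -- For almost every `E`, the values `R δ_x (E)` form a slowly growing solution in `x`. It is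
    -- nonzero because it equals 1 at `x₀`, so it decays and `E` is an eigenvalue.
    have hsupp : ∀ᵐ E ∂μ, e E ∈ S := by
      have hb := ae_exists_abs_le_exp (fun x => R (lp.single 2 x (1 : ℂ))) fun x =>
        (hR _).trans (by rw [lp.norm_single (by norm_num)]; simp)
      have hsol : ∀ᵐ E ∂μ, ∀ x, hopping 1 V (fun y => R (lp.single 2 y (1 : ℂ)) E) x =
          e E * R (lp.single 2 x (1 : ℂ)) E := by
        rw [ae_all_iff]
        intro x
        have h1 := hRA (lp.single 2 x (1 : ℂ))
        rw [apply_single hAV, map_add, map_sum, map_smul] at h1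
        have h2 : ∀ᵐ E ∂μ, ∀ i : Fin d, R (lp.single 2 (x + Pi.single i 1) (1 : ℂ) +
            lp.single 2 (x - Pi.single i 1) (1 : ℂ)) E =
            R (lp.single 2 (x + Pi.single i 1) (1 : ℂ)) E +
              R (lp.single 2 (x - Pi.single i 1) (1 : ℂ)) E := by
          rw [ae_all_iff]
          intro i
          rw [map_add]
          exact Lp.coeFn_add _ _
        filter_upwards [h1, h2, Lp.coeFn_add (∑ i : Fin d, R (lp.single 2 (x + Pi.single i 1) (1 : ℂ)
            + lp.single 2 (x - Pi.single i 1) (1 : ℂ))) (V x • R (lp.single 2 x (1 : ℂ))),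
          Lp.coeFn_smul (V x) (R (lp.single 2 x (1 : ℂ))),
          Lp.coeFn_fun_finsetSum Finset.univ fun i : Fin d =>
            R (lp.single 2 (x + Pi.single i 1) (1 : ℂ) + lp.single 2 (x - Pi.single i 1) (1 : ℂ))]
          with E h3 h4 h5 h6 h7
        rw [← h3, h5, Pi.add_apply, h6, h7]
        simp only [hopping, neighborSum, h4, one_mul, Pi.smul_apply, smul_eq_mul]
      filter_upwards [hb, hsol, hRφ] with E ⟨C, hC⟩ hE h1
      obtain ⟨C', hC'⟩ := hdec (e E) _ hE ⟨C, hC⟩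
      exact exists_eigenvector_of_decay hAV hE hC' (x₀ := x₀) (by rw [h1]; exact one_ne_zero)
    -- The image under `U` of the indicator of an atom is zero or an eigenvector, so `χ` is
    -- orthogonal to it; this pairing is `R χ E` times the mass of the atom.
    have hatom : ∀ E : X, R χ E = 0 ∨ μ {E} = 0 := by
      intro E
      have hfin : μ {E} ≠ ∞ := measure_ne_top _ _
      set f : Lp ℝ 2 μ := indicatorConstLp 2 (measurableSet_singleton E) hfin (1 : ℝ) with hf
      have hip : ∀ χ', (⟪χ', U f⟫_ℂ).re = R χ' E * μ.real {E} := by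
        intro χ'
        rw [hUR, real_inner_comm, hf, L2.inner_indicatorConstLp_one, integral_singleton]
        simp [mul_comm]
      by_cases hμE : μ {E} = 0
      · exact Or.inr hμE
      left
      have hμE' : μ.real {E} ≠ 0 := by
        rw [measureReal_def]
        exact (ENNReal.toReal_pos hμE hfin).ne'
      have hRE : ∀ χ', R (A χ') E = e E * R χ' E := by
        intro χ'
        by_contra hne
        exact hμE (measure_mono_null (Set.singleton_subset_iff.2 hne) (ae_iff.1 (hRA χ')))
      have heig : A (U f) = (e E : ℂ) • U f := by
        have h1 : ∀ χ', (⟪χ', A (U f) - (e E : ℂ) • U f⟫_ℂ).re = 0 := by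
          intro χ'
          rw [inner_sub_right, ← hsymm, inner_smul_right, Complex.sub_re, Complex.re_ofReal_mul, hip,
            hip, hRE]
          ring
        have h2 := h1 (A (U f) - (e E : ℂ) • U f)
        have h3 : ‖A (U f) - (e E : ℂ) • U f‖ ^ 2 = 0 := by
          rw [← h2, ← inner_self_eq_norm_sq (𝕜 := ℂ)]
          rfl
        exact sub_eq_zero.1 (norm_eq_zero.1 (pow_eq_zero_iff two_ne_zero |>.1 h3))
      have hUM : U f ∈ M := by
        by_cases h0 : U f = 0
        · rw [h0]; exact M.zero_mem
        · exact Submodule.subset_span ⟨_, (isEigenvector_schrodinger_iff hAV).2 ⟨h0, heig⟩⟩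
      have h4 := hip χ
      rw [Submodule.inner_left_of_mem_orthogonal hUM hχ, Complex.zero_re] at h4
      exact (mul_eq_zero.1 h4.symm).resolve_right hμE'
    have hzero : ∀ᵐ E ∂μ, R χ E = 0 := by
      have hcount' : {E : X | e E ∈ S ∧ R χ E ≠ 0}.Countable :=
        (hcount.preimage he).mono fun E hE => hE.1
      have hnull : μ {E : X | e E ∈ S ∧ R χ E ≠ 0} = 0 := by
        rw [← Set.biUnion_of_singleton {E : X | e E ∈ S ∧ R χ E ≠ 0},
          measure_biUnion_null_iff hcount']
        exact fun E hE => (hatom E).resolve_left hE.2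
      filter_upwards [hsupp, measure_eq_zero_iff_ae_notMem.1 hnull] with E h1 h2
      by_contra h3
      exact h2 ⟨h1, h3⟩
    rw [integral_congr_ae hzero, integral_zero]
  rw [Submodule.topologicalClosure_eq_top_iff, Submodule.eq_bot_iff]
  intro χ hχ
  ext x
  have h1 := hmain χ hχ x
  -- Only real parts were controlled; replacing `χ` by `i χ` gives the imaginary part.
  have h2 := hmain (Complex.I • χ) (Mᗮ.smul_mem _ hχ) x
  have h3 : ⟪χ, (lp.single 2 x (1 : ℂ) : EllTwo d)⟫_ℂ = (starRingEnd ℂ) (χ x) := by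
    rw [lp.inner_single_right]; simp
  rw [inner_smul_left, h3] at h2
  rw [h3] at h1
  simp at h1 h2
  exact Complex.ext h1 h2

/-- Eigenvectors decay exponentially if slowly growing solutions do. -/
theorem bddAbove_of_isEigenvector {V : (Fin d → ℤ) → ℝ} {K : ℝ} (hV : ∀ x, |V x| ≤ K)
    (hdec : DecayingSolutions 1 V) {E : ℂ} {ψ : EllTwo d}
    (hψ : IsEigenvector (schrodinger V) E ψ) :
    BddAbove (Set.range fun x : Fin d → ℤ => ‖ψ x‖ * Real.exp (latticeNorm x : ℝ)) := by
  obtain ⟨A, hA, hAV⟩ := exists_isSelfAdjoint_schrodinger hV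
  obtain ⟨hψ0, hAψ⟩ := (isEigenvector_schrodinger_iff hAV).1 hψ
  have hE : (starRingEnd ℂ) E = E := by
    have h1 : ⟪A ψ, ψ⟫_ℂ = ⟪ψ, A ψ⟫_ℂ := by
      rw [← ContinuousLinearMap.adjoint_inner_left, ← ContinuousLinearMap.star_eq_adjoint,
        hA.star_eq]
    rw [hAψ, inner_smul_left, inner_smul_right] at h1
    exact mul_right_cancel₀ (inner_self_ne_zero.2 hψ0) h1
  obtain ⟨E, rfl⟩ := Complex.conj_eq_iff_real.1 hE
  have heq : ∀ x, schrodingerExpr V ψ x = (E : ℂ) * ψ x := fun x => by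
    rw [← hAV, hAψ]; rfl
  have hsmall : ∀ x, ‖ψ x‖ ≤ ‖ψ‖ * Real.exp (latticeNorm x / 4) := fun x =>
    (lp.norm_apply_le_norm two_ne_zero ψ x).trans
      (le_mul_of_one_le_right (norm_nonneg _) (Real.one_le_exp (by positivity)))
  obtain ⟨C₁, hC₁⟩ := hdec E (fun x => (ψ x).re) (fun x => by
    have := congrArg Complex.re (heq x)
    simpa [schrodingerExpr, hopping, neighborSum, Complex.re_sum] using this)
    ⟨‖ψ‖, fun x => (Complex.abs_re_le_norm _).trans (hsmall x)⟩
  obtain ⟨C₂, hC₂⟩ := hdec E (fun x => (ψ x).im) (fun x => by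
    have := congrArg Complex.im (heq x)
    simpa [schrodingerExpr, hopping, neighborSum, Complex.im_sum] using this)
    ⟨‖ψ‖, fun x => (Complex.abs_im_le_norm _).trans (hsmall x)⟩
  refine ⟨C₁ + C₂, ?_⟩
  rintro _ ⟨x, rfl⟩
  calc ‖ψ x‖ * Real.exp (latticeNorm x)
      ≤ (C₁ * Real.exp (-latticeNorm x) + C₂ * Real.exp (-latticeNorm x)) *
          Real.exp (latticeNorm x) := by
        gcongr
        exact (Complex.norm_le_abs_re_add_abs_im _).trans (add_le_add (hC₁ x) (hC₂ x))
    _ = C₁ + C₂ := by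
        rw [← add_mul, mul_assoc, ← Real.exp_add, neg_add_cancel, Real.exp_zero, mul_one]

/-- Decay of slowly growing solutions does not depend on the normalisation of the operator. -/
theorem DecayingSolutions.smul {V : (Fin d → ℤ) → ℝ} {g : ℝ} (hg : g ≠ 0)
    (h : DecayingSolutions g⁻¹ V) : DecayingSolutions 1 fun x => g * V x := by
  intro E ψ hψ hC
  refine h (g⁻¹ * E) ψ (fun x => ?_) hC
  have h1 := hψ x
  simp only [hopping, one_mul] at h1 ⊢
  rw [mul_assoc, ← h1]
  field_simp

end PurePoint

end QuasiPeriodic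

/-! ### Choice of the events and conclusion -/

theorem proposition1 {d : ℕ} (hd : 1 ≤ d)
    {Ω : Type*} [MetricSpace Ω] [MeasurableSpace Ω] [BorelSpace Ω]
    (PΩ : Measure Ω) [IsProbabilityMeasure PΩ]
    [AddAction (Fin d → ℤ) Ω] [MeasurableConstVAdd (Fin d → ℤ) Ω]
    [ErgodicVAdd (Fin d → ℤ) Ω PΩ]
    {Θ : Type*} [MeasurableSpace Θ] (PΘ : Measure Θ) [IsProbabilityMeasure PΘ]
    (v : Ω → Θ → ℝ) (κ : ℝ≥0) (hκ : 0 < κ) (A η : ℝ)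
    (hΩ : QuasiPeriodic.FiniteMetricDimension Ω)
    (hT : QuasiPeriodic.TemperedAction d Ω)
    (hv : QuasiPeriodic.IsHolderProcess v κ)
    (hUPA : QuasiPeriodic.UPA d Ω A)
    (hLIB : QuasiPeriodic.LIB PΘ v η)
    (hAη : A * η < 1) :
    ∃ Θplus : ℝ → Set Θ,
      (∀ g : ℝ, 0 < g → MeasurableSet (Θplus g)) ∧
      Tendsto (fun g : ℝ => PΘ (Θplus g)) atTop (𝓝 1) ∧
      ∀ g : ℝ, 0 < g → ∀ θ ∈ Θplus g, ∀ᵐ ω ∂PΩ,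
        QuasiPeriodic.HasPurePointSpectrum (QuasiPeriodic.hamiltonian (d := d) v g ω θ) ∧
        ∀ (E : ℂ) (ψ : QuasiPeriodic.EllTwo d),
          QuasiPeriodic.IsEigenvector (QuasiPeriodic.hamiltonian v g ω θ) E ψ →
            BddAbove (Set.range fun x : Fin d → ℤ =>
              ‖ψ x‖ * Real.exp (QuasiPeriodic.latticeNorm x : ℝ)) := by
  have hbase : ∀ ε : ℝ, 0 < ε → ∃ g₀ : ℝ, 0 < g₀ ∧ ∀ g, g₀ ≤ g → ∃ G : Set Θ, MeasurableSet G ∧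
      PΘ Gᶜ ≤ ENNReal.ofReal ε ∧ ∀ θ ∈ G, ∀ᵐ ω ∂PΩ,
        QuasiPeriodic.DecayingSolutions g⁻¹ fun x : Fin d → ℤ => v (x +ᵥ ω) θ := fun ε hε =>
    QuasiPeriodic.exists_good_event PΩ PΘ hκ hΩ hT hv hUPA hLIB hAη hε
  let good : ℝ → Set (Set Θ) := fun g => {G | MeasurableSet G ∧ ∀ θ ∈ G, ∀ᵐ ω ∂PΩ,
    QuasiPeriodic.DecayingSolutions g⁻¹ fun x : Fin d → ℤ => v (x +ᵥ ω) θ}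
  have hempty : ∀ g, ∅ ∈ good g := fun g => ⟨MeasurableSet.empty, fun θ hθ => hθ.elim⟩
  -- The events found above depend on `ε` as well as on `g`. One event per `g`, independent of `ε`,
  -- is obtained by nearly minimising the probability of the complement; the slack `1 / g` is there
  -- since the infimum need not be attained. The empty set is admissible, so small `g` causes no
  -- difficulty.
  have hex : ∀ g : ℝ, ∃ G ∈ good g, ∀ G' ∈ good g, 0 < g →
      PΘ Gᶜ ≤ PΘ G'ᶜ + ENNReal.ofReal g⁻¹ := by
    intro g
    rcases le_or_gt g 0 with hg | hg
    · exact ⟨∅, hempty g, fun G' _ h => absurd h hg.not_gt⟩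
    have hne : (⨅ G ∈ good g, PΘ Gᶜ) ≠ ∞ :=
      ne_top_of_le_ne_top (measure_ne_top PΘ ∅ᶜ) (iInf₂_le ∅ (hempty g))
    have hlt := ENNReal.lt_add_right hne (ENNReal.ofReal_pos.2 (inv_pos.2 hg)).ne'
    obtain ⟨G, h⟩ := iInf_lt_iff.1 hlt
    obtain ⟨hG, h⟩ := iInf_lt_iff.1 h
    exact ⟨G, hG, fun G' hG' _ => h.le.trans (add_le_add_left (iInf₂_le G' hG') _)⟩
  choose Θplus hgood hmin using hex
  refine ⟨Θplus, fun g _ => (hgood g).1, ?_, fun g hg θ hθ => ?_⟩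
  · have hcompl : Tendsto (fun g => PΘ (Θplus g)ᶜ) atTop (𝓝 0) := by
      rw [ENNReal.tendsto_nhds_zero]
      intro δ hδ
      obtain ⟨ε, hε0, hε⟩ : ∃ ε : ℝ, 0 < ε ∧ ENNReal.ofReal (2 * ε) ≤ δ := by
        rcases eq_or_ne δ ∞ with rfl | hδ'
        · exact ⟨1, one_pos, le_top⟩
        · refine ⟨δ.toReal / 2, half_pos (ENNReal.toReal_pos hδ.ne' hδ'), ?_⟩
          rw [mul_div_cancel₀ _ two_ne_zero, ENNReal.ofReal_toReal hδ']
      obtain ⟨g₀, hg₀, h⟩ := hbase ε hε0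
      filter_upwards [eventually_ge_atTop g₀, eventually_ge_atTop ε⁻¹] with g hg hgε
      obtain ⟨G, hG, hGε, hGd⟩ := h g hg
      calc PΘ (Θplus g)ᶜ ≤ PΘ Gᶜ + ENNReal.ofReal g⁻¹ := hmin g G ⟨hG, hGd⟩ (hg₀.trans_le hg)
        _ ≤ ENNReal.ofReal ε + ENNReal.ofReal ε :=
          add_le_add hGε (ENNReal.ofReal_le_ofReal (inv_le_of_inv_le₀ hε0 hgε))
        _ = ENNReal.ofReal (2 * ε) := by rw [← ENNReal.ofReal_add hε0.le hε0.le, two_mul]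
        _ ≤ δ := hε
    have h1 := ENNReal.Tendsto.sub (tendsto_const_nhds (x := (1 : ℝ≥0∞))) hcompl
      (Or.inl ENNReal.one_ne_top)
    rw [tsub_zero] at h1
    refine h1.congr fun g => ?_
    rw [← prob_compl_eq_one_sub (hgood g).1.compl, compl_compl]
  -- Each realisation is bounded, so the operator is bounded and the spectral results apply, with a
  -- bound depending on `θ`.
  · obtain ⟨K, hK⟩ := Set.mem_iUnion.1
      ((QuasiPeriodic.iUnion_boundedSet hΩ hv).ge (Set.mem_univ θ))
    filter_upwards [(hgood g).2 θ hθ] with ω hω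
    have hV : ∀ x : Fin d → ℤ, |g * v (x +ᵥ ω) θ| ≤ g * K := fun x => by
      rw [abs_mul, abs_of_pos hg]
      exact mul_le_mul_of_nonneg_left (hK.1 _) hg.le
    have hdec := hω.smul hg.ne'
    exact ⟨QuasiPeriodic.hasPurePointSpectrum_schrodinger hV hdec, fun E ψ hψ =>
      QuasiPeriodic.bddAbove_of_isEigenvector hV hdec hψ⟩
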